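/- **Definitions.** Digraphs are finite, without parallel edges (loops are allowed), with $n$ vertices. A digraph is *strongly biconnected* if it is non-empty and strongly connected and its underlying undirected graph is biconnected, i.e. connected without articulation points. A *strongly biconnected component* of a digraph is a maximal vertex set inducing a strongly biconnected subgraph. (One vertex, and two vertices joined by an edge, count as biconnected undirected graphs; components may overlap.) A *block* of an undirected graph is a maximal vertex set inducing a biconnected subgraph. Let $G=(V,E)$ be a strongly biconnected digraph. A *b-bridge* of $G$ is an edge $b\in E$ such that $G\setminus\{b\}=(V,E\setminus\{b\})$ is not strongly biconnected. A *2-edge-biconnected block* of $G$ is a maximal set $U\subseteq V$ with $|U|>1$ such that for any two distinct $v,w\in U$ and every edge $b\in E$, the vertices $v,w$ lie in a common strongly biconnected component of $G\setminus\{b\}$. **Algorithm.** Input: a strongly biconnected digraph $G=(V,E)$. 1. Compute the b-bridges of $G$. If there are none, output $V$ and stop. 2. Otherwise let $L$ be a $V\times V$ matrix of $1$s. For each b-bridge $b$ of $G$: compute the strongly biconnected components of $G\setminus\{b\}$ and, for each pair $(x,y)\in V\times V$ that does not lie in a common component, set $L[x,y]\leftarrow 0$. 3. Let $E^{eb}$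 be the set of pairs $(x,y)\in V\times V$ with $L[x,y]=1$ and $L[y,x]=1$. Compute all blocks of size at least $2$ of the undirected graph $G^{eb}=(V,E^{eb})$ (loops ignored) and output them. **Machine.** The algorithm is a program for a random access machine with scalar registers and two-dimensional arrays of natural numbers, whose arithmetic is successor and predecessor only, and on which each elementary operation costs one unit of time. Digraphs are given by their adjacency matrices, and families of vertex sets by lists of duplicate-free lists. The three computations "b-bridges of a strongly biconnected digraph", "strongly biconnected components of a digraph" and "blocks of size at least $2$ of an undirected graph" are calls of subroutines, which must leave the memory of the calling program unchanged except for their output arrays and scratch memory. **Theorem.** (i) There are subroutines that perform these three computations in time $O(n^3)$, $O(n^2)$ and $O(n^2)$, respectively. (ii) With any subroutines that perform the three computations within such time bounds, there is a constant $C$ such that on every strongly biconnected digraph with $n$ vertices the algorithm halts within $C n^3$ units of time, and, if $n\ge 2$, it outputs exactly the 2-edge-biconnected blocks of $G$, each of them once. In particular, the 2-edge-biconnected blocks of a strongly biconnected digraph with $n\geq 2$ vertices can be computed in $O(n^3)$ time. -/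

import Mathlib

/-! ### Strongly biconnected digraphs and their blocks -/

/-- An undirected graph is biconnected if it is connected and has no articulation point. -/
def SimpleGraph.IsBiconnected {V : Type*} (H : SimpleGraph V) : Prop :=
  H.Connected ∧ ∀ v : V, (H.induce {v}ᶜ).Preconnected

/-- A block of an undirected graph: a maximal vertex set inducing a biconnected subgraph. -/
def SimpleGraph.IsBlock {V : Type*} (H : SimpleGraph V) (S : Set V) : Prop :=
  Maximal (fun T : Set V => (H.induce T).IsBiconnected) S

namespace Digraph

variable {V : Type*}

/-- The subgraph induced on a vertex set. -/
def induce (G : Digraph V) (S : Set V) : Digraph S where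
  Adj x y := G.Adj x y

/-- `G ∖ {b}`: delete the edge `b`, keep all vertices. -/
def deleteEdge (G : Digraph V) (b : V × V) : Digraph V where
  Adj x y := G.Adj x y ∧ (x, y) ≠ b

/-- There is a directed path from every vertex to every vertex. -/
def IsStronglyConnected (G : Digraph V) : Prop :=
  Nonempty V ∧ ∀ x y : V, Relation.ReflTransGen G.Adj x y

/-- Strongly connected, and the underlying undirected graph is biconnected. -/
def IsStronglyBiconnected (G : Digraph V) : Prop :=
  G.IsStronglyConnected ∧ G.toSimpleGraphInclusive.IsBiconnected

/-- A strongly biconnected component: a maximal vertex set inducing a strongly biconnected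
subgraph. -/
def IsStronglyBiconnectedComponent (G : Digraph V) (C : Set V) : Prop :=
  Maximal (fun T : Set V => (G.induce T).IsStronglyBiconnected) C

/-- A b-bridge of (the strongly biconnected digraph) `G`: an edge whose deletion leaves a digraph
that is not strongly biconnected. -/
def IsBBridge (G : Digraph V) (b : V × V) : Prop :=
  G.Adj b.1 b.2 ∧ ¬ (G.deleteEdge b).IsStronglyBiconnected

/-- For every edge `b`, the vertices `x` and `y` lie in a common strongly biconnected component of
`G ∖ {b}`. -/
def EdgeBiconnectedPair (G : Digraph V) (x y : V) : Prop :=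
  ∀ b : V × V, G.Adj b.1 b.2 →
    ∃ C : Set V, (G.deleteEdge b).IsStronglyBiconnectedComponent C ∧ x ∈ C ∧ y ∈ C

/-- A 2-edge-biconnected block: a maximal vertex set `U` with more than one element such that any
two distinct vertices of `U` form an `EdgeBiconnectedPair`. -/
def IsTwoEdgeBiconnectedBlock (G : Digraph V) (U : Set V) : Prop :=
  Maximal (fun T : Set V => T.Nontrivial ∧
    ∀ x ∈ T, ∀ y ∈ T, x ≠ y → G.EdgeBiconnectedPair x y) U

end Digraph

/-! ### A random access machine with a step count

A small imperative language over a memory of scalar registers and two-dimensional arrays of natural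
numbers (a one-dimensional array is column `0` of an array). The only arithmetic is successor and
predecessor, so that numbers grow by at most a constant in each step. Every evaluated node of an
expression or of a condition, and every executed statement, costs one unit of time.
`Reg.tmp` and `Arr.tmp` are scratch memory. -/

namespace RAM

/-- Scalar registers. -/
inductive Reg
  | n | numBridges | numComps | numOut
  | i | k | x | y
  | tmp (j : ℕ)
  deriving DecidableEq

/-- Two-dimensional arrays. -/
inductive Arr
  | adj | bridge | compSize | comp | same | L | eb | outSize | out
  | tmp (j : ℕ)
  deriving DecidableEq

/-- Contents of the memory. -/
structure State where
  reg : Reg → ℕ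
  arr : Arr → ℕ → ℕ → ℕ

/-- `s.setReg r v` is `s` after `r := v`. -/
def State.setReg (s : State) (r : Reg) (v : ℕ) : State :=
  ⟨Function.update s.reg r v, s.arr⟩

/-- `s.setArr a p q v` is `s` after `a[p][q] := v`. -/
def State.setArr (s : State) (a : Arr) (p q v : ℕ) : State :=
  ⟨s.reg, Function.update s.arr a
    (Function.update (s.arr a) p (Function.update (s.arr a p) q v))⟩

/-- Expressions. -/
inductive Expr
  | const (c : ℕ)
  | reg (r : Reg)
  | get (a : Arr) (e f : Expr)
  | succ (e : Expr)
  | pred (e : Expr)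

/-- Value of an expression. -/
def Expr.eval (s : State) : Expr → ℕ
  | .const c => c
  | .reg r => s.reg r
  | .get a e f => s.arr a (e.eval s) (f.eval s)
  | .succ e => e.eval s + 1
  | .pred e => e.eval s - 1

/-- Time for evaluating an expression: its number of nodes. -/
def Expr.cost : Expr → ℕ
  | .const _ => 1
  | .reg _ => 1
  | .get _ e f => e.cost + f.cost + 1
  | .succ e => e.cost + 1
  | .pred e => e.cost + 1

/-- Conditions. -/
inductive Cond
  | eq (e f : Expr)
  | lt (e f : Expr)
  | not (c : Cond)
  | and (c d : Cond)

/-- Truth of a condition. -/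
def Cond.holds (s : State) : Cond → Prop
  | .eq e f => e.eval s = f.eval s
  | .lt e f => e.eval s < f.eval s
  | .not c => ¬ c.holds s
  | .and c d => c.holds s ∧ d.holds s

/-- Time for evaluating a condition: its number of nodes. -/
def Cond.cost : Cond → ℕ
  | .eq e f => e.cost + f.cost + 1
  | .lt e f => e.cost + f.cost + 1
  | .not c => c.cost + 1
  | .and c d => c.cost + d.cost + 1

/-- Programs. -/
inductive Prog
  | skip
  | assign (r : Reg) (e : Expr)
  | store (a : Arr) (e f g : Expr)
  | seq (p q : Prog)
  | ite (c : Cond) (p q : Prog)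
  | while (c : Cond) (p : Prog)

/-- `Exec p s t s'`: started in the memory `s`, the program `p` halts after exactly `t` units of
time, with the memory `s'`. -/
inductive Exec : Prog → State → ℕ → State → Prop
  | skip (s : State) : Exec .skip s 1 s
  | assign (s : State) (r : Reg) (e : Expr) :
      Exec (.assign r e) s (e.cost + 1) (s.setReg r (e.eval s))
  | store (s : State) (a : Arr) (e f g : Expr) :
      Exec (.store a e f g) s (e.cost + f.cost + g.cost + 1)
        (s.setArr a (e.eval s) (f.eval s) (g.eval s))
  | seq {p q : Prog} {s s' s'' : State} {t t' : ℕ} :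
      Exec p s t s' → Exec q s' t' s'' → Exec (.seq p q) s (t + t' + 1) s''
  | iteTrue {c : Cond} {p q : Prog} {s s' : State} {t : ℕ} :
      c.holds s → Exec p s t s' → Exec (.ite c p q) s (c.cost + t + 1) s'
  | iteFalse {c : Cond} {p q : Prog} {s s' : State} {t : ℕ} :
      ¬ c.holds s → Exec q s t s' → Exec (.ite c p q) s (c.cost + t + 1) s'
  | whileFalse {c : Cond} {p : Prog} {s : State} :
      ¬ c.holds s → Exec (.while c p) s (c.cost + 1) s
  | whileTrue {c : Cond} {p : Prog} {s s' s'' : State} {t t' : ℕ} :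
      c.holds s → Exec p s t s' → Exec (.while c p) s' t' s'' →
        Exec (.while c p) s (c.cost + t + t' + 1) s''

/-- Sequential composition of a list of programs. -/
def block : List Prog → Prog
  | [] => .skip
  | [p] => p
  | p :: ps => .seq p (block ps)

/-- `for r := 0, 1, …, e - 1 do p`. -/
def forLt (r : Reg) (e : Expr) (p : Prog) : Prog :=
  .seq (.assign r (.const 0))
    (.while (.lt (.reg r) e) (.seq p (.assign r (.succ (.reg r)))))

/-- `for each pair (x, y) ∈ V × V do p`. -/
def forPairs (p : Prog) : Prog :=
  forLt .x (.reg .n) (forLt .y (.reg .n) p)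

/-! ### The algorithm

`findBridges`, `findComponents` and `findBlocks` are the subroutines which the algorithm calls for
computing the b-bridges, the strongly biconnected components, and the undirected blocks. -/

/-- Output of the vertex set `V` as the only block. -/
def outputV : Prog :=
  block
    [ .assign .numOut (.const 1),
      .store .outSize (.const 0) (.const 0) (.reg .n),
      forLt .x (.reg .n) (.store .out (.const 0) (.reg .x) (.reg .x)) ]

/-- Body of the loop over the b-bridges, for the `k`-th b-bridge `b`: delete `b` from the adjacency
matrix, compute the strongly biconnected components of `G ∖ {b}`, put `b` back; tabulate in `same`
which pairs of vertices lie in a common component; set `L[x,y]` to `0` for all other pairs. -/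
def processBridge (findComponents : Prog) : Prog :=
  block
    [ .store .adj (.get .bridge (.reg .k) (.const 0)) (.get .bridge (.reg .k) (.const 1)) (.const 0),
      findComponents,
      .store .adj (.get .bridge (.reg .k) (.const 0)) (.get .bridge (.reg .k) (.const 1)) (.const 1),
      forPairs (.store .same (.reg .x) (.reg .y) (.const 0)),
      forLt .i (.reg .numComps)
        (forLt .x (.get .compSize (.reg .i) (.const 0))
          (forLt .y (.get .compSize (.reg .i) (.const 0))
            (.store .same (.get .comp (.reg .i) (.reg .x)) (.get .comp (.reg .i) (.reg .y))
              (.const 1)))),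
      forPairs
        (.ite (.eq (.get .same (.reg .x) (.reg .y)) (.const 0))
          (.store .L (.reg .x) (.reg .y) (.const 0))
          .skip) ]

/-- The whole algorithm. -/
def blockAlgorithm (findBridges findComponents findBlocks : Prog) : Prog :=
  .seq findBridges
    (.ite (.eq (.reg .numBridges) (.const 0))
      outputV
      (block
        [ forPairs (.store .L (.reg .x) (.reg .y) (.const 1)),
          forLt .k (.reg .numBridges) (processBridge findComponents),
          forPairs (.store .eb (.reg .x) (.reg .y) (.const 0)),
          forPairs
            (.ite (.and (.eq (.get .L (.reg .x) (.reg .y)) (.const 1))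
                (.eq (.get .L (.reg .y) (.reg .x)) (.const 1)))
              (.store .eb (.reg .x) (.reg .y) (.const 1))
              .skip),
          findBlocks ]))

/-! ### Input, output and the tasks of the subroutines -/

/-- The array `a` holds the adjacency matrix of the digraph `G` on `{0, …, n - 1}`, and the register
`n` holds the number of vertices. -/
def State.HoldsDigraph (s : State) (a : Arr) {n : ℕ} (G : Digraph (Fin n)) : Prop :=
  s.reg .n = n ∧
    ∀ x y : Fin n, (G.Adj x y → s.arr a x y = 1) ∧ (¬ G.Adj x y → s.arr a x y = 0)

/-- The vertex set given by row `i` of the array `elt`, which lists `size[i]` vertices. -/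
def State.rowSet (s : State) (n : ℕ) (size elt : Arr) (i : ℕ) : Set (Fin n) :=
  {v | ∃ j < s.arr size i 0, s.arr elt i j = v}

/-- The rows `0, …, cnt - 1` of `elt` list the members of the family `F` of vertex sets: every
member is listed by exactly one row, and every row lists a member of `F` without repetitions. -/
def State.HoldsFamily (s : State) {n : ℕ} (cnt : Reg) (size elt : Arr) (F : Set (Set (Fin n))) :
    Prop :=
  (∀ i < s.reg cnt, ∀ j < s.arr size i 0, s.arr elt i j < n) ∧
  (∀ i < s.reg cnt, Set.InjOn (s.arr elt i) (Set.Iio (s.arr size i 0))) ∧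
  Set.BijOn (s.rowSet n size elt) (Set.Iio (s.reg cnt)) F

/-- The rows `0, …, numBridges - 1` of the array `bridge` list the b-bridges of `G`, each one
once. -/
def State.HoldsBridges (s : State) {n : ℕ} (G : Digraph (Fin n)) : Prop :=
  Set.BijOn (fun i => (s.arr .bridge i 0, s.arr .bridge i 1)) (Set.Iio (s.reg .numBridges))
    {p | ∃ b : Fin n × Fin n, G.IsBBridge b ∧ p = ((b.1 : ℕ), (b.2 : ℕ))}

/-- Apart from scratch memory, `s` and `s'` differ at most in the registers of `R` and in the arrays
of `A`. -/
def State.AgreeOutside (s s' : State) (R : Set Reg) (A : Set Arr) : Prop :=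
  (∀ r, r ∉ R → (∀ j, r ≠ .tmp j) → s'.reg r = s.reg r) ∧
  (∀ a, a ∉ A → (∀ j, a ≠ .tmp j) → s'.arr a = s.arr a)

/-- `p` computes the b-bridges of strongly biconnected digraphs, in time at most `T n`. -/
def ComputesBBridges (p : Prog) (T : ℕ → ℕ) : Prop :=
  ∀ (n : ℕ) (G : Digraph (Fin n)), G.IsStronglyBiconnected →
    ∀ s : State, s.HoldsDigraph .adj G →
      ∃ t s', Exec p s t s' ∧ t ≤ T n ∧ s'.HoldsBridges G ∧
        s.AgreeOutside s' {.numBridges} {.bridge}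

/-- `p` computes the strongly biconnected components of digraphs, in time at most `T n`. -/
def ComputesComponents (p : Prog) (T : ℕ → ℕ) : Prop :=
  ∀ (n : ℕ) (G : Digraph (Fin n)), 1 ≤ n →
    ∀ s : State, s.HoldsDigraph .adj G →
      ∃ t s', Exec p s t s' ∧ t ≤ T n ∧
        s'.HoldsFamily .numComps .compSize .comp {C | G.IsStronglyBiconnectedComponent C} ∧
        s.AgreeOutside s' {.numComps} {.compSize, .comp}

/-- `p` computes and outputs the blocks of size at least `2` of undirected graphs (the orientations
and the loops of the digraph held in `eb` are ignored), in time at most `T n`. -/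
def ComputesBlocks (p : Prog) (T : ℕ → ℕ) : Prop :=
  ∀ (n : ℕ) (H : Digraph (Fin n)), 1 ≤ n →
    ∀ s : State, s.HoldsDigraph .eb H →
      ∃ t s', Exec p s t s' ∧ t ≤ T n ∧
        s'.HoldsFamily .numOut .outSize .out
          {B | H.toSimpleGraphInclusive.IsBlock B ∧ B.Nontrivial} ∧
        s.AgreeOutside s' {.numOut} {.outSize, .out}

/-- Started on any strongly biconnected digraph with `n` vertices, `p` halts within `T n` units of
time, and if `2 ≤ n`, its output consists of the 2-edge-biconnected blocks. -/
def ComputesTwoEdgeBiconnectedBlocks (p : Prog) (T : ℕ → ℕ) : Prop :=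
  ∀ (n : ℕ) (G : Digraph (Fin n)), G.IsStronglyBiconnected →
    ∀ s : State, s.HoldsDigraph .adj G →
      ∃ t s', Exec p s t s' ∧ t ≤ T n ∧
        (2 ≤ n → s'.HoldsFamily .numOut .outSize .out {U | G.IsTwoEdgeBiconnectedBlock U})

end RAM

/-!
The statement has three parts: the algorithm is correct, it is fast with fast subroutines, and
fast subroutines exist.

*Correctness.* An edge that is not a b-bridge leaves a single strongly biconnected component, so
only the b-bridges restrict the pairs of `G.EdgeBiconnectedPair`, and the graph `G^eb` computed by
the algorithm has exactly these pairs as edges. If a set `S` is biconnected in the graph that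
joins the vertices with a common strongly biconnected set, then the whole of `S` lies in one
strongly biconnected set (`Digraph.exists_stronglyBiconnected_superset`). Applied to `G ∖ {b}` for
every edge `b`, this shows that a set which is biconnected in `G^eb` is a clique of `G^eb`. Hence
the blocks of `G^eb` with at least two vertices are its maximal cliques, which are the
2-edge-biconnected blocks (`Digraph.isBlock_nontrivial_iff`).

*Running time.* The loop over the b-bridges has `O(n)` rounds, because a strongly biconnected
digraph has only linearly many b-bridges (`RAM.State.HoldsBridges.numBridges_le`): some `O(n)`
edges already form a strongly biconnected spanning subgraph, and every b-bridge must be among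
them. A round takes quadratic time although components overlap: by the union lemma two components
share at most one vertex, so that the squares of their sizes sum up to `O(n ^ 2)`
(`RAM.sum_ncard_sq_le`).

*Subroutines.* All three use one path-based search (`Search`), in two modes. It keeps a path of
vertex classes, extends the path along edges to unseen vertices, collapses a part of it along
edges that lead back, and splits off the last class when this has no more edges to inspect. In the
first mode the classes are the strongly connected components. In the second mode every class but the
first hangs at a vertex of its predecessor, and the classes are the blocks of a graph;
the part of the path that collapses stays biconnected because it is a chain of biconnected sets
closed by an edge (`Search.Ends`). A potential bounded by `3 n` decreases in every step, and a
step takes linear time.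

The strongly biconnected components of a digraph are the blocks of its inner graph, which consists
of the edges inside strongly connected components: such a block is strongly connected, because a
directed path between two of its vertices can be projected into the block
(`Search.BccResult.connOn_vertexBlock`). The edges which made the path grow or collapse are
recorded, at most `3 n` in each mode. Together they form the spanning subgraph mentioned above
(`Search.SccResult.isStronglyBiconnected_deleteEdge`), so that for computing the b-bridges it
suffices to test the recorded edges, in quadratic time each.
-/

/-! ### Connectivity inside a vertex set -/

section Connectivity

variable {V W : Type*}

/-- The relation `R`, restricted to the set `S`. -/
def RelOn (R : V → V → Prop) (S : Set V) (a b : V) : Prop := R a b ∧ a ∈ S ∧ b ∈ S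

/-- Any two vertices of `S` are joined by a directed `R`-path that stays in `S`. -/
def ConnOn (R : V → V → Prop) (S : Set V) : Prop :=
  ∀ x ∈ S, ∀ y ∈ S, Relation.ReflTransGen (RelOn R S) x y

/-- `S` stays connected when at most one vertex is removed from it. Removing a subsingleton covers
connectivity (remove nothing) and the absence of articulation points (remove one vertex). -/
def BiOn (R : V → V → Prop) (S : Set V) : Prop :=
  ∀ Z : Set V, Z.Subsingleton → ConnOn R (S \ Z)

lemma RelOn.reflTransGen_mono {R R' : V → V → Prop} {S T : Set V} (hR : ∀ a b, R a b → R' a b)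
    (h : S ⊆ T) {x y : V} (hxy : Relation.ReflTransGen (RelOn R S) x y) :
    Relation.ReflTransGen (RelOn R' T) x y :=
  Relation.ReflTransGen.mono (fun _ _ hab => ⟨hR _ _ hab.1, h hab.2.1, h hab.2.2⟩) _ _ hxy

lemma RelOn.reflTransGen_subset {R : V → V → Prop} {S T : Set V} (h : S ⊆ T) {x y : V}
    (hxy : Relation.ReflTransGen (RelOn R S) x y) : Relation.ReflTransGen (RelOn R T) x y :=
  RelOn.reflTransGen_mono (fun _ _ h => h) h hxy

lemma RelOn.reflTransGen_symm {R : V → V → Prop} (hR : ∀ a b, R a b → R b a) {S : Set V} {x y : V}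
    (hxy : Relation.ReflTransGen (RelOn R S) x y) : Relation.ReflTransGen (RelOn R S) y x := by
  induction hxy with
  | refl => exact .refl
  | tail _ h ih => exact .head ⟨hR _ _ h.1, h.2.2, h.2.1⟩ ih

lemma BiOn.mono_on {R R' : V → V → Prop} {S : Set V} (h : BiOn R S)
    (hR : ∀ a ∈ S, ∀ b ∈ S, R a b → R' a b) : BiOn R' S :=
  fun Z hZ x hx y hy => Relation.ReflTransGen.mono
    (fun a b hab => ⟨hR a hab.2.1.1 b hab.2.2.1 hab.1, hab.2⟩) _ _ (h Z hZ x hx y hy)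

lemma BiOn.mono {R R' : V → V → Prop} (hR : ∀ a b, R a b → R' a b) {S : Set V}
    (h : BiOn R S) : BiOn R' S :=
  h.mono_on fun a _ b _ => hR a b

lemma BiOn.connOn {R : V → V → Prop} {S : Set V} (h : BiOn R S) : ConnOn R S := by
  simpa using h ∅ Set.subsingleton_empty

lemma BiOn.of_subsingleton {R : V → V → Prop} {S : Set V} (h : S.Subsingleton) : BiOn R S := by
  intro Z _ x hx y hy
  rw [h hx.1 hy.1]

lemma BiOn.pair {R : V → V → Prop} (hR : ∀ a b, R a b → R b a) {x y : V}
    (hxy : R x y) : BiOn R {x, y} := by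
  rintro Z - a ha b hb
  have ha' := ha.1
  have hb' := hb.1
  rcases ha' with rfl | rfl <;> rcases hb' with rfl | rfl
  · exact .refl
  · exact .single ⟨hxy, ha, hb⟩
  · exact .single ⟨hR _ _ hxy, ha, hb⟩
  · exact .refl

/-- A path which starts in a set that `R` does not leave stays in that set. -/
lemma Relation.ReflTransGen.mem_of_closed {R : V → V → Prop} {P : V → Prop}
    (hP : ∀ a b, R a b → P a → P b) {x y : V} (h : Relation.ReflTransGen R x y) (hx : P x) :
    P y := by
  induction h with
  | refl => exact hx
  | tail _ h ih => exact hP _ _ h ih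

lemma connOn_range {f : W → V} (hf : f.Injective) (R : V → V → Prop) :
    ConnOn R (Set.range f) ↔ ∀ x y, Relation.ReflTransGen (fun a b => R (f a) (f b)) x y := by
  constructor
  · intro h x y
    have key : ∀ z, Relation.ReflTransGen (RelOn R (Set.range f)) (f x) z →
        ∀ y, f y = z → Relation.ReflTransGen (fun a b => R (f a) (f b)) x y := by
      intro z hz
      induction hz with
      | refl => intro y hy; rw [hf hy]
      | tail _ h ih =>
        intro y hy
        obtain ⟨h1, ⟨c, hc⟩, -⟩ := h
        exact (ih c hc).tail (by rw [hc, hy]; exact h1)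
    exact key _ (h _ ⟨x, rfl⟩ _ ⟨y, rfl⟩) y rfl
  · rintro h _ ⟨x, rfl⟩ _ ⟨y, rfl⟩
    exact (h x y).lift f fun a b hab => ⟨hab, ⟨a, rfl⟩, ⟨b, rfl⟩⟩

lemma connOn_image {f : W → V} (hf : f.Injective) (R : V → V → Prop) (S : Set W) :
    ConnOn R (f '' S) ↔ ConnOn (fun a b => R (f a) (f b)) S := by
  have h1 : f '' S = Set.range (fun x : S => f x) := by ext; simp
  have h2 : S = Set.range (fun x : S => (x : W)) := by simp
  rw [h1, connOn_range (fun a b h => Subtype.ext (hf h))]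
  conv_rhs => rw [h2]
  rw [connOn_range Subtype.val_injective]

lemma biOn_image {f : W → V} (hf : f.Injective) (R : V → V → Prop) (S : Set W) :
    BiOn R (f '' S) ↔ BiOn (fun a b => R (f a) (f b)) S := by
  constructor
  · intro h Z hZ
    rw [← connOn_image hf, Set.image_sdiff hf]
    exact h _ (hZ.image f)
  · intro h Z hZ
    have := h (f ⁻¹' Z) (hZ.preimage hf)
    rw [← connOn_image hf] at this
    convert this using 1
    ext x
    constructor
    · rintro ⟨⟨y, hy, rfl⟩, hz⟩
      exact ⟨y, ⟨hy, hz⟩, rfl⟩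
    · rintro ⟨y, ⟨hy, hz⟩, rfl⟩
      exact ⟨⟨y, hy, rfl⟩, hz⟩

lemma SimpleGraph.preconnected_induce_iff_connOn (H : SimpleGraph V) (S : Set V) :
    (H.induce S).Preconnected ↔ ConnOn H.Adj S := by
  have h2 : S = Set.range (fun x : S => (x : V)) := by simp
  conv_rhs => rw [h2]
  rw [connOn_range Subtype.val_injective]
  refine forall₂_congr fun x y => ?_
  rw [SimpleGraph.reachable_iff_reflTransGen]
  rfl

lemma SimpleGraph.isBiconnected_induce_iff (H : SimpleGraph V) (S : Set V) :
    (H.induce S).IsBiconnected ↔ S.Nonempty ∧ BiOn H.Adj S := by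
  have key : ∀ v : S, ((H.induce S).induce {v}ᶜ).Preconnected ↔ ConnOn H.Adj (S \ {(v : V)}) := by
    intro v
    have h2 : S \ {(v : V)} = (fun x : S => (x : V)) '' ({v}ᶜ : Set S) := by
      ext x; simp
    rw [SimpleGraph.preconnected_induce_iff_connOn, h2, connOn_image Subtype.val_injective]
    rfl
  rw [SimpleGraph.IsBiconnected, SimpleGraph.connected_iff,
    SimpleGraph.preconnected_induce_iff_connOn, Set.nonempty_coe_sort]
  constructor
  · rintro ⟨⟨h1, h2⟩, h3⟩
    refine ⟨h2, fun Z hZ => ?_⟩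
    rcases hZ.eq_empty_or_singleton with rfl | ⟨z, rfl⟩
    · simpa using h1
    · by_cases hz : z ∈ S
      · exact (key ⟨z, hz⟩).1 (h3 _)
      · rwa [Set.sdiff_singleton_eq_self hz]
  · rintro ⟨h1, h2⟩
    exact ⟨⟨h2.connOn, h1⟩, fun v => (key v).2 (h2 _ Set.subsingleton_singleton)⟩

namespace Digraph

/-- The edges of the underlying undirected graph. -/
def SymAdj (G : Digraph V) : V → V → Prop := G.toSimpleGraphInclusive.Adj

lemma symAdj_iff {G : Digraph V} {x y : V} : G.SymAdj x y ↔ x ≠ y ∧ (G.Adj x y ∨ G.Adj y x) :=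
  Iff.rfl

/-- The form of the definition that is used below: all conditions are about paths inside `S`, not in
the induced subgraph. -/
lemma isStronglyBiconnected_induce_iff (G : Digraph V) (S : Set V) :
    (G.induce S).IsStronglyBiconnected ↔ S.Nonempty ∧ ConnOn G.Adj S ∧ BiOn G.SymAdj S := by
  have h1 : (G.induce S).toSimpleGraphInclusive = G.toSimpleGraphInclusive.induce S := by
    ext x y
    simp [toSimpleGraphInclusive, induce, Subtype.ext_iff]
  have h2 : S = Set.range (fun x : S => (x : V)) := by simp
  have h3 : (G.induce S).IsStronglyConnected ↔ S.Nonempty ∧ ConnOn G.Adj S := by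
    conv_rhs => rw [h2]
    rw [connOn_range Subtype.val_injective, ← h2, IsStronglyConnected, Set.nonempty_coe_sort]
    rfl
  rw [IsStronglyBiconnected, h1, h3, SimpleGraph.isBiconnected_induce_iff]
  unfold SymAdj
  tauto

lemma isStronglyBiconnected_iff_univ (G : Digraph V) :
    G.IsStronglyBiconnected ↔ (G.induce Set.univ).IsStronglyBiconnected := by
  have h1 : G.IsStronglyConnected ↔ Nonempty V ∧ ConnOn G.Adj Set.univ := by
    rw [← Set.range_id, connOn_range Function.injective_id]
    rfl
  have h2 : ∀ v : V, (G.toSimpleGraphInclusive.induce {v}ᶜ).Preconnected ↔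
      ConnOn G.SymAdj (Set.univ \ {v}) := by
    intro v
    rw [SimpleGraph.preconnected_induce_iff_connOn, Set.compl_eq_univ_sdiff]
    rfl
  have h3 : G.toSimpleGraphInclusive.Connected ↔ Nonempty V ∧ ConnOn G.SymAdj Set.univ := by
    rw [SimpleGraph.connected_iff, ← Set.range_id, connOn_range Function.injective_id, and_comm]
    refine and_congr_right fun _ => forall₂_congr fun x y => ?_
    rw [SimpleGraph.reachable_iff_reflTransGen]
    rfl
  rw [isStronglyBiconnected_induce_iff, IsStronglyBiconnected, SimpleGraph.IsBiconnected, h1, h3]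
  constructor
  · rintro ⟨⟨hn, hc⟩, ⟨-, h4⟩, h5⟩
    refine ⟨⟨hn.some, trivial⟩, hc, fun Z hZ => ?_⟩
    rcases hZ.eq_empty_or_singleton with rfl | ⟨z, rfl⟩
    · simpa using h4
    · exact (h2 z).1 (h5 z)
  · rintro ⟨⟨v, -⟩, hc, hb⟩
    exact ⟨⟨⟨v⟩, hc⟩, ⟨⟨v⟩, hb.connOn⟩, fun v => (h2 v).2 (hb _ Set.subsingleton_singleton)⟩

end Digraph

end Connectivity

/-! ### Unions of strongly biconnected sets -/

section Union

variable {V : Type*}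

/-- Connected sets, all of which meet `S`, have a connected union if `S` is connected in the graph
that joins the vertices with a common set of the family. Everything takes place outside of `Z`. -/
lemma connOn_sUnion_diff {R : V → V → Prop} {F : Set (Set V)} {S Z : Set V}
    (hF : ∀ C ∈ F, ConnOn R (C \ Z)) (hm : ∀ C ∈ F, ∃ s ∈ S \ Z, s ∈ C)
    (hS : ConnOn (fun a b => ∃ C ∈ F, a ∈ C ∧ b ∈ C) (S \ Z)) : ConnOn R (⋃₀ F \ Z) := by
  have hsub : ∀ C ∈ F, C \ Z ⊆ ⋃₀ F \ Z := fun C hC =>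
    Set.sdiff_subset_sdiff_left (Set.subset_sUnion_of_mem hC)
  have key : ∀ x y, Relation.ReflTransGen
      (RelOn (fun a b => ∃ C ∈ F, a ∈ C ∧ b ∈ C) (S \ Z)) x y →
      Relation.ReflTransGen (RelOn R (⋃₀ F \ Z)) x y := by
    intro x y h
    induction h with
    | refl => exact .refl
    | tail _ h ih =>
      obtain ⟨⟨C, hC, ha, hb⟩, ha', hb'⟩ := h
      exact ih.trans (RelOn.reflTransGen_subset (hsub C hC)
        (hF C hC _ ⟨ha, ha'.2⟩ _ ⟨hb, hb'.2⟩))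
  rintro x ⟨⟨C, hC, hx⟩, hxZ⟩ y ⟨⟨D, hD, hy⟩, hyZ⟩
  obtain ⟨s, hs, hsC⟩ := hm C hC
  obtain ⟨t, ht, htD⟩ := hm D hD
  exact (RelOn.reflTransGen_subset (hsub C hC) (hF C hC x ⟨hx, hxZ⟩ s ⟨hsC, hs.2⟩)).trans
    ((key s t (hS s hs t ht)).trans
      (RelOn.reflTransGen_subset (hsub D hD) (hF D hD t ⟨htD, ht.2⟩ y ⟨hy, hyZ⟩)))

namespace Digraph

/-- If `S` is biconnected in the graph that joins the vertices with a common strongly biconnected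
set, then `S` lies in one strongly biconnected set `W`, which absorbs every strongly biconnected set
that meets `S` twice: the union of all of these will do. -/
lemma exists_stronglyBiconnected_superset {G : Digraph V} {S : Set V} (hnt : S.Nontrivial)
    (hS : BiOn (fun a b => a ≠ b ∧
      ∃ C, (G.induce C).IsStronglyBiconnected ∧ a ∈ C ∧ b ∈ C) S) :
    ∃ W, (G.induce W).IsStronglyBiconnected ∧ S ⊆ W ∧
      ∀ C, (G.induce C).IsStronglyBiconnected → (C ∩ S).Nontrivial → C ⊆ W := by
  set F : Set (Set V) := {C | (G.induce C).IsStronglyBiconnected ∧ (C ∩ S).Nontrivial} with hFdef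
  have hmeet : ∀ Z : Set V, Z.Subsingleton → ∀ C ∈ F, ∃ s ∈ S \ Z, s ∈ C := by
    rintro Z hZ C ⟨-, x, hx, y, hy, hxy⟩
    by_cases hxZ : x ∈ Z
    · exact ⟨y, ⟨hy.2, fun h => hxy (hZ hxZ h)⟩, hy.1⟩
    · exact ⟨x, ⟨hx.2, hxZ⟩, hx.1⟩
  have hconn : ∀ Z : Set V, Z.Subsingleton →
      ConnOn (fun a b => ∃ C ∈ F, a ∈ C ∧ b ∈ C) (S \ Z) := by
    intro Z hZ x hx y hy
    refine Relation.ReflTransGen.mono ?_ _ _ (hS Z hZ x hx y hy)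
    rintro a b ⟨⟨hab, C, hC, ha, hb⟩, ha', hb'⟩
    exact ⟨⟨C, ⟨hC, a, ⟨ha, ha'.1⟩, b, ⟨hb, hb'.1⟩, hab⟩, ha, hb⟩, ha', hb'⟩
  have hSW : S ⊆ ⋃₀ F := by
    intro x hx
    obtain ⟨y, hy, hyx⟩ := hnt.exists_ne x
    rcases (hS.connOn x hx y hy).cases_head with h | ⟨c, ⟨⟨hxc, C, hC, hxC, hcC⟩, -, hc⟩, -⟩
    · exact absurd h.symm hyx
    · exact ⟨C, ⟨hC, x, ⟨hxC, hx⟩, c, ⟨hcC, hc⟩, hxc⟩, hxC⟩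
  refine ⟨⋃₀ F, ?_, hSW, fun C hC hCS => Set.subset_sUnion_of_mem ⟨hC, hCS⟩⟩
  rw [isStronglyBiconnected_induce_iff]
  refine ⟨hnt.nonempty.mono hSW, ?_, fun Z hZ => ?_⟩
  · rw [← Set.sdiff_empty (s := ⋃₀ F)]
    refine connOn_sUnion_diff (S := S) (fun C hC => ?_) (hmeet ∅ Set.subsingleton_empty)
      (hconn ∅ Set.subsingleton_empty)
    simpa using ((isStronglyBiconnected_induce_iff G C).1 hC.1).2.1
  · exact connOn_sUnion_diff (S := S)
      (fun C hC => ((isStronglyBiconnected_induce_iff G C).1 hC.1).2.2 Z hZ) (hmeet Z hZ)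
      (hconn Z hZ)

lemma exists_component_superset [Finite V] {G : Digraph V} {W : Set V}
    (hW : (G.induce W).IsStronglyBiconnected) :
    ∃ C, G.IsStronglyBiconnectedComponent C ∧ W ⊆ C := by
  obtain ⟨C, h1, h2⟩ := Set.Finite.exists_le_maximal
    (Set.toFinite {T : Set V | (G.induce T).IsStronglyBiconnected}) hW
  exact ⟨C, h2, h1⟩

lemma exists_component_superset_of_biOn [Finite V] {G : Digraph V} {S : Set V}
    (hnt : S.Nontrivial)
    (hS : BiOn (fun a b => a ≠ b ∧
      ∃ C, G.IsStronglyBiconnectedComponent C ∧ a ∈ C ∧ b ∈ C) S) :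
    ∃ C, G.IsStronglyBiconnectedComponent C ∧ S ⊆ C := by
  obtain ⟨W, hW, hSW, -⟩ := exists_stronglyBiconnected_superset (G := G) hnt
    (hS.mono fun a b ⟨h1, C, hC, h2⟩ => ⟨h1, C, hC.prop, h2⟩)
  obtain ⟨C, hC, hWC⟩ := exists_component_superset hW
  exact ⟨C, hC, hSW.trans hWC⟩

/-- Two different strongly biconnected components share at most one vertex. -/
lemma IsStronglyBiconnectedComponent.eq_of_mem {G : Digraph V} {C D : Set V}
    (hC : G.IsStronglyBiconnectedComponent C) (hD : G.IsStronglyBiconnectedComponent D) {x y : V}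
    (hxy : x ≠ y) (hxC : x ∈ C) (hyC : y ∈ C) (hxD : x ∈ D) (hyD : y ∈ D) : C = D := by
  have hS : BiOn (fun a b => a ≠ b ∧
      ∃ C, (G.induce C).IsStronglyBiconnected ∧ a ∈ C ∧ b ∈ C) {x, y} := by
    rintro Z - a ha b hb
    by_cases hab : a = b
    · rw [hab]
    · refine .single ⟨⟨hab, C, hC.prop, ?_, ?_⟩, ha, hb⟩
      · rcases ha.1 with h | h <;> rw [h] <;> assumption
      · rcases hb.1 with h | h <;> rw [h] <;> assumption
  obtain ⟨W, hW, -, hsub⟩ := exists_stronglyBiconnected_superset (Set.nontrivial_pair hxy) hS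
  have key : ∀ D, G.IsStronglyBiconnectedComponent D → x ∈ D → y ∈ D → D = W :=
    fun D hD hx hy => hD.eq_of_subset hW
      (hsub D hD.prop ⟨x, ⟨hx, by simp⟩, y, ⟨hy, by simp⟩, hxy⟩)
  rw [key C hC hxC hyC, key D hD hxD hyD]

lemma IsStronglyBiconnected.isComponent_univ {G : Digraph V} (h : G.IsStronglyBiconnected) :
    G.IsStronglyBiconnectedComponent Set.univ :=
  ⟨(isStronglyBiconnected_iff_univ G).1 h, fun _ _ _ => Set.subset_univ _⟩

lemma IsStronglyBiconnected.eq_univ_of_isComponent {G : Digraph V} (h : G.IsStronglyBiconnected)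
    {C : Set V} (hC : G.IsStronglyBiconnectedComponent C) : C = Set.univ :=
  hC.eq_of_subset h.isComponent_univ.prop (Set.subset_univ _)

/-! ### Blocks of the graph of the pairs which survive every deletion -/

lemma EdgeBiconnectedPair.symm {G : Digraph V} {x y : V} (h : G.EdgeBiconnectedPair x y) :
    G.EdgeBiconnectedPair y x := by
  intro b hb
  obtain ⟨C, hC, hx, hy⟩ := h b hb
  exact ⟨C, hC, hy, hx⟩

/-- Only the b-bridges matter for the edge-biconnectivity of a pair. -/
lemma edgeBiconnectedPair_iff {G : Digraph V} {x y : V} :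
    G.EdgeBiconnectedPair x y ↔ ∀ b, G.IsBBridge b →
      ∃ C : Set V, (G.deleteEdge b).IsStronglyBiconnectedComponent C ∧ x ∈ C ∧ y ∈ C := by
  refine ⟨fun h b hb => h b hb.1, fun h b hb => ?_⟩
  by_cases hbr : (G.deleteEdge b).IsStronglyBiconnected
  · exact ⟨_, hbr.isComponent_univ, trivial, trivial⟩
  · exact h b ⟨hb, hbr⟩

/-- Two vertices of a set that is biconnected in the graph of the edge-biconnected pairs form such a
pair themselves. -/
lemma EdgeBiconnectedPair.of_biOn [Finite V] {G : Digraph V} {S : Set V} (hnt : S.Nontrivial)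
    (hS : BiOn (fun a b => a ≠ b ∧ G.EdgeBiconnectedPair a b) S) {x y : V} (hx : x ∈ S)
    (hy : y ∈ S) : G.EdgeBiconnectedPair x y := by
  intro b hb
  obtain ⟨C, hC, hSC⟩ := exists_component_superset_of_biOn (G := G.deleteEdge b) hnt
    (hS.mono fun a c h => ⟨h.1, h.2 b hb⟩)
  exact ⟨C, hC, hSC hx, hSC hy⟩

theorem isBlock_nontrivial_iff [Finite V] {G H : Digraph V}
    (hH : ∀ x y, x ≠ y → (H.Adj x y ↔ G.EdgeBiconnectedPair x y)) (U : Set V) :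
    H.toSimpleGraphInclusive.IsBlock U ∧ U.Nontrivial ↔ G.IsTwoEdgeBiconnectedBlock U := by
  have hsym : ∀ x y, H.SymAdj x y ↔ x ≠ y ∧ G.EdgeBiconnectedPair x y := by
    intro x y
    rw [symAdj_iff]
    refine and_congr_right fun hxy => ?_
    rw [hH x y hxy, hH y x hxy.symm]
    exact ⟨fun h => h.elim id EdgeBiconnectedPair.symm, Or.inl⟩
  have hSym : H.toSimpleGraphInclusive.Adj = fun x y => x ≠ y ∧ G.EdgeBiconnectedPair x y := by
    funext x y
    exact propext (hsym x y)
  have hclique : ∀ T : Set V, T.Nontrivial →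
      ((H.toSimpleGraphInclusive.induce T).IsBiconnected ↔
        ∀ x ∈ T, ∀ y ∈ T, x ≠ y → G.EdgeBiconnectedPair x y) := by
    intro T hT
    rw [SimpleGraph.isBiconnected_induce_iff, hSym]
    constructor
    · exact fun h x hx y hy _ => EdgeBiconnectedPair.of_biOn hT h.2 hx hy
    · refine fun h => ⟨hT.nonempty, ?_⟩
      rintro Z - a ha b hb
      by_cases hab : a = b
      · rw [hab]
      · exact .single ⟨⟨hab, h a ha.1 b hb.1 hab⟩, ha, hb⟩
  constructor
  · rintro ⟨hU, hnt⟩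
    refine ⟨⟨hnt, (hclique U hnt).1 hU.prop⟩, fun T hT hUT => ?_⟩
    exact hU.le_of_ge ((hclique T hT.1).2 hT.2) hUT
  · intro hU
    refine ⟨⟨(hclique U hU.prop.1).2 hU.prop.2, fun T hT hUT => ?_⟩, hU.prop.1⟩
    have hT' := hU.prop.1.mono hUT
    exact hU.le_of_ge ⟨hT', (hclique T hT').1 hT⟩ hUT

lemma isTwoEdgeBiconnectedBlock_iff_eq_univ {G : Digraph V} [Nontrivial V]
    (h : ∀ b, ¬ G.IsBBridge b) (U : Set V) :
    G.IsTwoEdgeBiconnectedBlock U ↔ U = Set.univ := by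
  have hall : ∀ x y, G.EdgeBiconnectedPair x y := fun x y =>
    edgeBiconnectedPair_iff.2 fun b hb => absurd hb (h b)
  have huniv : (Set.univ : Set V).Nontrivial ∧ ∀ x ∈ (Set.univ : Set V),
      ∀ y ∈ (Set.univ : Set V), x ≠ y → G.EdgeBiconnectedPair x y :=
    ⟨Set.nontrivial_univ, fun x _ y _ _ => hall x y⟩
  constructor
  · exact fun hU => hU.eq_of_subset huniv (Set.subset_univ U)
  · rintro rfl
    exact ⟨huniv, fun _ _ _ => Set.subset_univ _⟩

end Digraph

end Union

/-! ### The path-based search -/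

/-- A state of the path-based search on a graph with vertices `0, …, n - 1`.

The search maintains a path of disjoint vertex classes, the levels `1, …, k`. A vertex `v` is
*finished* if `done v ≠ 0`, *unseen* if `done v = 0` and `lev v = 0`, and otherwise it belongs to
the level `lev v`. Level `l` hangs at the vertex `rt l` of level `l - 1`; `rt l = n` encodes that
there is no such vertex. `exh v ≠ 0` means that the edges out of `v` need no further inspection.
Finished classes are numbered from `0` to `id - 1`: the class with index `i` consists of the
vertices with `done v = i + 1`, and hung at `root i`. The edges `(lu i, lw i)`, for `i < cnt`, are
those that made the path grow or collapse. -/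
structure Search where
  k : ℕ
  id : ℕ
  cnt : ℕ
  lev : ℕ → ℕ
  done : ℕ → ℕ
  exh : ℕ → ℕ
  rt : ℕ → ℕ
  root : ℕ → ℕ
  lu : ℕ → ℕ
  lw : ℕ → ℕ

namespace Search

variable {n : ℕ} {E : ℕ → ℕ → Prop} {b : Bool} {σ τ : Search}

/-- The unseen vertex `u` becomes the first level of a new path. -/
def start (n : ℕ) (σ : Search) (u : ℕ) : Search :=
  { σ with k := 1, lev := Function.update σ.lev u 1, rt := Function.update σ.rt 1 n }

/-- The last level is finished. -/
def pop (n : ℕ) (σ : Search) : Search :=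
  { σ with
    k := σ.k - 1
    id := σ.id + 1
    done := fun v => if v < n ∧ σ.lev v = σ.k ∧ σ.done v = 0 then σ.id + 1 else σ.done v
    root := Function.update σ.root σ.id (σ.rt σ.k) }

/-- The vertex `u` is exhausted. -/
def exhaust (σ : Search) (u : ℕ) : Search :=
  { σ with exh := Function.update σ.exh u 1 }

/-- The path is extended by the unseen vertex `w`, along the edge from `u` to `w`. The new level
hangs at `u` if `b` is true, and nowhere otherwise. -/
def push (n : ℕ) (b : Bool) (σ : Search) (u w : ℕ) : Search :=
  { σ with
    k := σ.k + 1
    cnt := σ.cnt + 1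
    lev := Function.update σ.lev w (σ.k + 1)
    rt := Function.update σ.rt (σ.k + 1) (if b then u else n)
    lu := Function.update σ.lu σ.cnt u
    lw := Function.update σ.lw σ.cnt w }

/-- The level at which the path collapses along an edge to the vertex `w`: the last class that
contains `w`, where the vertex at which a level hangs is included in the class of this level. -/
def target (σ : Search) (w : ℕ) : ℕ :=
  if σ.rt (σ.lev w + 1) = w then σ.lev w + 1 else σ.lev w

/-- The levels from the target level on are united, because of the edge from `u` back to `w`. -/
def merge (n : ℕ) (σ : Search) (u w : ℕ) : Search :=
  { σ with
    k := σ.target w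
    cnt := σ.cnt + 1
    lev := fun v => if v < n ∧ σ.done v = 0 ∧ σ.target w < σ.lev v then σ.target w else σ.lev v
    lu := Function.update σ.lu σ.cnt u
    lw := Function.update σ.lw σ.cnt w }

/-- `u` is a vertex of the last level which is not exhausted; if there is no path, `u` is unseen. -/
def Open (n : ℕ) (σ : Search) (u : ℕ) : Prop :=
  u < n ∧ σ.lev u = σ.k ∧ σ.exh u = 0 ∧ σ.done u = 0

/-- The edge from `u` to `w` leads out of the last level, and not to a finished vertex. -/
def Leads (n : ℕ) (E : ℕ → ℕ → Prop) (σ : Search) (u w : ℕ) : Prop :=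
  w < n ∧ E u w ∧ σ.lev w ≠ σ.k ∧ σ.done w = 0 ∧ w ≠ σ.rt σ.k

/-- One step of the search. If `b` is false, it searches for strongly connected components; if `b`
is true, for blocks. -/
inductive Step (n : ℕ) (E : ℕ → ℕ → Prop) (b : Bool) (σ : Search) : Search → Prop
  | start (u : ℕ) : σ.k = 0 → σ.Open n u → Step n E b σ (σ.start n u)
  | pop : 0 < σ.k → (∀ u, ¬ σ.Open n u) → Step n E b σ (σ.pop n)
  | exhaust (u : ℕ) : 0 < σ.k → σ.Open n u → (∀ w, ¬ σ.Leads n E u w) →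
      Step n E b σ (σ.exhaust u)
  | push (u w : ℕ) : 0 < σ.k → σ.Open n u → σ.Leads n E u w → σ.lev w = 0 →
      Step n E b σ (σ.push n b u w)
  | merge (u w : ℕ) : 0 < σ.k → σ.Open n u → σ.Leads n E u w → σ.lev w ≠ 0 →
      Step n E b σ (σ.merge n u w)

/-- The part of the invariant that is common to both kinds of search. By `exh_edge`, an exhausted
vertex has edges only to finished vertices, to its own level, and to the vertex at which this level
hangs. By `done_edge` and `root_eq`, an edge out of a finished class leads to a class finished
earlier, or to the vertex at which the class hung, which is finished later. -/
structure Inv (n : ℕ) (E : ℕ → ℕ → Prop) (b : Bool) (σ : Search) : Prop where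
  lev_le : ∀ v < n, σ.done v = 0 → σ.lev v ≤ σ.k
  exh_zero : ∀ v < n, σ.lev v = 0 → σ.done v = 0 → σ.exh v = 0
  level_nonempty : ∀ l, 1 ≤ l → l ≤ σ.k → ∃ v < n, σ.done v = 0 ∧ σ.lev v = l
  done_le : ∀ v < n, σ.done v ≤ σ.id
  home_nonempty : ∀ i < σ.id, ∃ v < n, σ.done v = i + 1
  rt_eq : ∀ l, 1 ≤ l → l ≤ σ.k → (σ.rt l = n ∧ (b = true → l = 1)) ∨
    (b = true ∧ σ.rt l < n ∧ σ.done (σ.rt l) = 0 ∧ σ.lev (σ.rt l) + 1 = l ∧ 2 ≤ l)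
  exh_edge : ∀ v < n, σ.done v = 0 → σ.exh v ≠ 0 → ∀ w < n, E v w →
    σ.done w ≠ 0 ∨ σ.lev w = σ.lev v ∨ w = σ.rt (σ.lev v)
  done_edge : ∀ v < n, σ.done v ≠ 0 → ∀ w < n, E v w →
    σ.done w = σ.done v ∨ w = σ.root (σ.done v - 1) ∨ (σ.done w ≠ 0 ∧ σ.done w < σ.done v)
  root_eq : ∀ i < σ.id, σ.root i = n ∨
    (b = true ∧ σ.root i < n ∧ (σ.done (σ.root i) = 0 ∨ i + 1 < σ.done (σ.root i)))
  edge : ∀ i < σ.cnt, σ.lu i < n ∧ σ.lw i < n ∧ E (σ.lu i) (σ.lw i)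

lemma Inv.start (h : σ.Inv n E b) {u : ℕ} (hk : σ.k = 0) (hu : σ.Open n u) :
    (σ.start n u).Inv n E b := by
  obtain ⟨h1, h2, h3, h4, h5, h6, h7, h8, h9, h10⟩ := h
  obtain ⟨hu1, hu2, hu3, hu4⟩ := hu
  constructor <;> simp only [Search.start, Function.update_apply] <;> try assumption
  · grind
  · grind
  · intro l hl hl'
    exact ⟨u, hu1, hu4, by grind⟩
  · intro l hl hl'
    left
    grind
  · intro v hv hd he w hw hE
    have := h1 v hv hd
    have := h2 v hv (by omega) hd
    contradiction

lemma Inv.pop (h : σ.Inv n E b) (hk : 0 < σ.k) (hu : ∀ u, ¬ σ.Open n u) :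
    (σ.pop n).Inv n E b := by
  have hu' : ∀ v < n, σ.lev v = σ.k → σ.done v = 0 → σ.exh v ≠ 0 := by
    intro v hv hl hd he
    exact hu v ⟨hv, hl, he, hd⟩
  obtain ⟨h1, h2, h3, h4, h5, h6, h7, h8, h9, h10⟩ := h
  constructor <;> simp only [Search.pop, Function.update_apply] <;> try assumption
  · grind
  · grind
  · intro l hl hl'
    obtain ⟨v, hv, hd, hl⟩ := h3 l hl (by omega)
    exact ⟨v, hv, by grind, hl⟩
  · intro v hv
    have := h4 v hv
    split_ifs <;> omega
  · intro i hi
    by_cases hii : i = σ.id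
    · obtain ⟨v, hv, hd, hl⟩ := h3 σ.k hk le_rfl
      exact ⟨v, hv, by grind⟩
    · obtain ⟨v, hv, hd⟩ := h5 i (by omega)
      exact ⟨v, hv, by grind⟩
  · intro l hl hl'
    have := h6 l hl (by omega)
    grind
  · grind
  · intro v hv hd w hw hE
    have a1 := h4 v hv
    have a2 := h4 w hw
    have a3 := h7 v hv
    have a4 := h8 v hv
    have a5 := hu' v hv
    grind
  · intro i hi
    by_cases hii : i = σ.id
    · have a2 := h6 σ.k hk le_rfl
      simp only [hii, if_true]
      refine a2.imp (fun h => h.1) fun h => ⟨h.1, h.2.1, ?_⟩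
      split_ifs <;> omega
    · simp only [hii, if_false]
      refine (h9 i (by omega)).imp_right fun h => ⟨h.1, h.2.1, ?_⟩
      split_ifs <;> omega

lemma Inv.exhaust (h : σ.Inv n E b) {u : ℕ} (hk : 0 < σ.k) (hu : σ.Open n u)
    (hw : ∀ w, ¬ σ.Leads n E u w) : (σ.exhaust u).Inv n E b := by
  obtain ⟨h1, h2, h3, h4, h5, h6, h7, h8, h9, h10⟩ := h
  obtain ⟨hu1, hu2, hu3, hu4⟩ := hu
  constructor <;> simp only [Search.exhaust, Function.update_apply] <;> try assumption
  · grind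
  · intro v hv hd he w hw' hE
    have a1 := h7 v hv hd
    have a2 := hw w
    unfold Leads at a2
    grind

lemma Inv.push (h : σ.Inv n E b) {u w : ℕ} (hk : 0 < σ.k) (hu : σ.Open n u)
    (hw : σ.Leads n E u w) (hl : σ.lev w = 0) : (σ.push n b u w).Inv n E b := by
  obtain ⟨h1, h2, h3, h4, h5, h6, h7, h8, h9, h10⟩ := h
  obtain ⟨hu1, hu2, hu3, hu4⟩ := hu
  obtain ⟨hw1, hw2, hw3, hw4, hw5⟩ := hw
  constructor <;> simp only [Search.push, Function.update_apply] <;> try assumption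
  · grind
  · grind
  · intro l hl hl'
    by_cases hlk : l = σ.k + 1
    · exact ⟨w, hw1, hw4, by grind⟩
    · obtain ⟨v, hv, hd, hl⟩ := h3 l hl (by omega)
      exact ⟨v, hv, hd, by grind⟩
  · intro l hl hl'
    by_cases hlk : l = σ.k + 1
    · cases b <;> grind
    · have := h6 l hl (by omega)
      grind
  · intro v hv hd he x hx hE
    have a1 := h7 v hv hd he x hx hE
    have a2 := h1 v hv hd
    have a3 := h2 v hv
    have a4 := h6 (σ.lev v) (by grind) a2
    have a5 := h2 w hw1
    grind
  · intro i hi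
    by_cases hii : i = σ.cnt
    · simp only [hii, if_true]
      exact ⟨hu1, hw1, hw2⟩
    · simp only [hii, if_false]
      exact h10 i (by omega)

lemma Inv.target_lt (h : σ.Inv n E b) {u w : ℕ}
    (hw : σ.Leads n E u w) (hl : σ.lev w ≠ 0) :
    σ.target w < σ.k ∧ σ.lev w ≤ σ.target w ∧ 0 < σ.target w := by
  obtain ⟨hw1, hw2, hw3, hw4, hw5⟩ := hw
  have a1 := h.lev_le w hw1 hw4
  unfold target
  split_ifs with hr
  · refine ⟨lt_of_le_of_ne (by omega) fun he => ?_, by omega, by omega⟩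
    rw [he] at hr
    exact hw5 hr.symm
  · omega

lemma Inv.merge (h : σ.Inv n E b) {u w : ℕ} (hu : σ.Open n u)
    (hw : σ.Leads n E u w) (hl : σ.lev w ≠ 0) : (σ.merge n u w).Inv n E b := by
  obtain ⟨ht1, ht2, ht3⟩ := h.target_lt hw hl
  obtain ⟨h1, h2, h3, h4, h5, h6, h7, h8, h9, h10⟩ := h
  obtain ⟨hu1, hu2, hu3, hu4⟩ := hu
  obtain ⟨hw1, hw2, hw3, hw4, hw5⟩ := hw
  constructor <;> simp only [Search.merge, Function.update_apply] <;> try assumption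
  · intro v hv hd
    split_ifs <;> omega
  · grind
  · intro l hl hl'
    obtain ⟨v, hv, hd, hl⟩ := h3 l hl (by omega)
    exact ⟨v, hv, hd, by grind⟩
  · intro l hl hl'
    have := h6 l hl (by omega)
    grind
  · intro v hv hd he x hx hE
    have a1 := h7 v hv hd he x hx hE
    have a2 := h1 v hv hd
    have a3 := h2 v hv
    have a4 := h6 (σ.lev v) (by grind) a2
    grind
  · intro i hi
    by_cases hii : i = σ.cnt
    · simp only [hii, if_true]
      exact ⟨hu1, hw1, hw2⟩
    · simp only [hii, if_false]
      exact h10 i (by omega)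

lemma Inv.step (h : σ.Inv n E b) (hs : Step n E b σ τ) : τ.Inv n E b := by
  cases hs with
  | start u h1 h2 => exact h.start h1 h2
  | pop h1 h2 => exact h.pop h1 h2
  | exhaust u h1 h2 h3 => exact h.exhaust h1 h2 h3
  | push u w h1 h2 h3 h4 => exact h.push h1 h2 h3 h4
  | merge u w _ h2 h3 h4 => exact h.merge h2 h3 h4

/-- Number of the vertices that satisfy `p`. -/
noncomputable def count (n : ℕ) (p : ℕ → Prop) : ℕ := {v : Fin n | p v}.ncard

/-- Every step decreases the potential: an unseen vertex counts twice, since it enters the path as a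
new level. -/
noncomputable def potential (n : ℕ) (σ : Search) : ℕ :=
  2 * count n (fun v => σ.lev v = 0 ∧ σ.done v = 0) + σ.k + count n (fun v => σ.exh v = 0)

lemma count_congr {p q : ℕ → Prop} (h : ∀ v < n, p v ↔ q v) : count n p = count n q := by
  unfold count
  congr 1
  ext v
  exact h v v.2

lemma count_lt {p q : ℕ → Prop} (h : ∀ v < n, p v → q v) {u : ℕ} (hu : u < n) (hq : q u)
    (hp : ¬ p u) : count n p < count n q :=
  Set.ncard_lt_ncard ⟨fun v hv => h v v.2 hv, fun hh => hp (hh (a := ⟨u, hu⟩) hq)⟩ (Set.toFinite _)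

lemma count_le (n : ℕ) (p : ℕ → Prop) : count n p ≤ n := by
  simpa [count] using Set.ncard_le_ncard (Set.subset_univ {v : Fin n | p v}) (Set.toFinite _)

lemma Inv.potential_lt (h : σ.Inv n E b) (hs : Step n E b σ τ) :
    τ.potential n < σ.potential n ∧
      τ.cnt + τ.potential n ≤ σ.cnt + σ.potential n := by
  unfold potential
  cases hs with
  | start u h1 h2 =>
    obtain ⟨hu1, hu2, hu3, hu4⟩ := h2
    have := count_lt (n := n) (p := fun v => (σ.start n u).lev v = 0 ∧ (σ.start n u).done v = 0)
      (q := fun v => σ.lev v = 0 ∧ σ.done v = 0) (by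
        intro v hv
        simp only [Search.start, Function.update_apply]
        grind) hu1 (by grind)
      (by simp [Search.start])
    have e1 : (σ.start n u).k = 1 := rfl
    have e2 : (σ.start n u).exh = σ.exh := rfl
    have e3 : (σ.start n u).cnt = σ.cnt := rfl
    rw [e1, e2, e3]
    omega
  | pop h1 h2 =>
    have := count_congr (n := n) (p := fun v => (σ.pop n).lev v = 0 ∧ (σ.pop n).done v = 0)
      (q := fun v => σ.lev v = 0 ∧ σ.done v = 0) (by
        intro v hv
        simp only [Search.pop]
        grind)
    have e1 : (σ.pop n).k = σ.k - 1 := rfl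
    have e2 : (σ.pop n).exh = σ.exh := rfl
    have e3 : (σ.pop n).cnt = σ.cnt := rfl
    rw [e1, e2, e3, this]
    omega
  | exhaust u h1 h2 h3 =>
    obtain ⟨hu1, hu2, hu3, hu4⟩ := h2
    have := count_lt (n := n) (p := fun v => (σ.exhaust u).exh v = 0)
      (q := fun v => σ.exh v = 0) (by
        intro v hv
        simp only [Search.exhaust, Function.update_apply]
        grind) hu1 hu3
      (by simp [Search.exhaust])
    have e1 : (σ.exhaust u).k = σ.k := rfl
    have e2 : (σ.exhaust u).lev = σ.lev := rfl
    have e3 : (σ.exhaust u).cnt = σ.cnt := rfl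
    have e4 : (σ.exhaust u).done = σ.done := rfl
    rw [e1, e2, e3, e4]
    omega
  | push u w h1 h2 h3 h4 =>
    obtain ⟨hw1, hw2, hw3, hw4, hw5⟩ := h3
    have := count_lt (n := n) (p := fun v => (σ.push n b u w).lev v = 0 ∧
        (σ.push n b u w).done v = 0)
      (q := fun v => σ.lev v = 0 ∧ σ.done v = 0) (by
        intro v hv
        simp only [Search.push, Function.update_apply]
        grind) hw1 (by grind)
      (by simp [Search.push])
    have e1 : (σ.push n b u w).k = σ.k + 1 := rfl
    have e2 : (σ.push n b u w).exh = σ.exh := rfl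
    have e3 : (σ.push n b u w).cnt = σ.cnt + 1 := rfl
    rw [e1, e2, e3]
    omega
  | merge u w h1 h2 h3 h4 =>
    obtain ⟨ht1, ht2, ht3⟩ := h.target_lt h3 h4
    have := count_congr (n := n) (p := fun v => (σ.merge n u w).lev v = 0 ∧
        (σ.merge n u w).done v = 0)
      (q := fun v => σ.lev v = 0 ∧ σ.done v = 0) (by
        intro v hv
        simp only [Search.merge]
        grind)
    have e1 : (σ.merge n u w).k = σ.target w := rfl
    have e2 : (σ.merge n u w).exh = σ.exh := rfl
    have e3 : (σ.merge n u w).cnt = σ.cnt + 1 := rfl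
    rw [e1, e2, e3, this]
    omega

end Search

/-! ### What the search for strongly connected components computes -/

namespace Search

variable {n : ℕ} {E : ℕ → ℕ → Prop} {b : Bool} {σ τ : Search}

/-- The recorded edges. -/
def Rec (σ : Search) (x y : ℕ) : Prop := ∃ i < σ.cnt, σ.lu i = x ∧ σ.lw i = y

/-- Before the first step. -/
structure Initial (n : ℕ) (σ : Search) : Prop where
  k : σ.k = 0
  id : σ.id = 0
  cnt : σ.cnt = 0
  vertex : ∀ v < n, σ.lev v = 0 ∧ σ.done v = 0 ∧ σ.exh v = 0

lemma Initial.inv (h : σ.Initial n) : σ.Inv n E b := by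
  obtain ⟨h1, h2, h3, h4⟩ := h
  constructor <;> grind

/-- At the end of the search. -/
structure Final (n : ℕ) (σ : Search) : Prop where
  k : σ.k = 0
  closed : ∀ u, ¬ σ.Open n u

lemma Inv.done_ne_zero (h : σ.Inv n E b) (hf : σ.Final n) {v : ℕ} (hv : v < n) : σ.done v ≠ 0 := by
  intro hd
  have h1 := h.lev_le v hv hd
  rw [hf.k] at h1
  exact hf.closed v ⟨hv, by rw [hf.k]; omega, h.exh_zero v hv (by omega) hd, hd⟩

lemma rec_succ {u w : ℕ} (hc : τ.cnt = σ.cnt + 1) (hu : τ.lu = Function.update σ.lu σ.cnt u)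
    (hw : τ.lw = Function.update σ.lw σ.cnt w) {x y : ℕ} :
    τ.Rec x y ↔ σ.Rec x y ∨ (x = u ∧ y = w) := by
  unfold Rec
  rw [hc, hu, hw]
  constructor
  · rintro ⟨i, hi, h1, h2⟩
    by_cases hii : i = σ.cnt
    · subst hii
      simp only [Function.update_self] at h1 h2
      exact Or.inr ⟨h1.symm, h2.symm⟩
    · rw [Function.update_of_ne hii] at h1 h2
      exact Or.inl ⟨i, by omega, h1, h2⟩
  · rintro (⟨i, hi, h1, h2⟩ | ⟨rfl, rfl⟩)
    · refine ⟨i, by omega, ?_, ?_⟩ <;> rw [Function.update_of_ne (by omega)] <;> assumption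
    · exact ⟨σ.cnt, by omega, by simp, by simp⟩

lemma rec_push {u w x y : ℕ} :
    (σ.push n b u w).Rec x y ↔ σ.Rec x y ∨ (x = u ∧ y = w) := rec_succ rfl rfl rfl

lemma rec_merge {u w x y : ℕ} :
    (σ.merge n u w).Rec x y ↔ σ.Rec x y ∨ (x = u ∧ y = w) := rec_succ rfl rfl rfl

lemma Inv.edge_of_rec (h : σ.Inv n E b) {x y : ℕ} (hr : σ.Rec x y) : x < n ∧ y < n ∧ E x y := by
  obtain ⟨i, hi, rfl, rfl⟩ := hr
  exact h.edge i hi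

/-- Invariant of the search for strongly connected components: along recorded edges, earlier levels
reach later ones, and the vertices of a class reach each other. -/
structure SccInv (n : ℕ) (σ : Search) : Prop where
  path : ∀ v < n, ∀ w < n, σ.done v = 0 → σ.done w = 0 → 1 ≤ σ.lev v → σ.lev v ≤ σ.lev w →
    Relation.ReflTransGen σ.Rec v w
  same : ∀ v < n, ∀ w < n, σ.done v ≠ 0 → σ.done v = σ.done w → Relation.ReflTransGen σ.Rec v w

lemma Initial.sccInv (h : σ.Initial n) : σ.SccInv n := by
  obtain ⟨h1, h2, h3, h4⟩ := h
  constructor <;> grind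

lemma SccInv.step (h : σ.Inv n E false) (hc : σ.SccInv n) (hs : Step n E false σ τ) :
    τ.SccInv n := by
  obtain ⟨hp, hs'⟩ := hc
  cases hs with
  | start u h1 h2 =>
    obtain ⟨hu1, hu2, hu3, hu4⟩ := h2
    refine ⟨fun v hv w hw hdv hdw hlv hlw => ?_, hs'⟩
    have a1 := h.lev_le v hv hdv
    have a2 := h.lev_le w hw hdw
    have : v = u ∧ w = u := by
      simp only [Search.start, Function.update_apply] at hlv hlw
      grind
    rw [this.1, this.2]
  | pop h1 h2 =>
    constructor
    · intro v hv w hw hdv hdw hlv hlw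
      refine hp v hv w hw ?_ ?_ hlv hlw
      · simp only [Search.pop] at hdv; grind
      · simp only [Search.pop] at hdw; grind
    · intro v hv w hw hdv hvw
      have a1 := h.done_le v hv
      have a2 := h.done_le w hw
      simp only [Search.pop] at hdv hvw
      split_ifs at hdv hvw with c1 c2 c2
      · exact hp v hv w hw c1.2.2 c2.2.2 (by omega) (by omega)
      · omega
      · omega
      · exact hs' v hv w hw hdv hvw
  | exhaust u h1 h2 h3 => exact ⟨hp, hs'⟩
  | push u w h1 h2 h3 h4 =>
    have hmono : ∀ x y, Relation.ReflTransGen σ.Rec x y →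
        Relation.ReflTransGen (σ.push n false u w).Rec x y := fun x y hxy =>
      Relation.ReflTransGen.mono (fun a b hab => rec_push.2 (Or.inl hab)) _ _ hxy
    refine ⟨fun v hv x hx hdv hdx hlv hlx => ?_, fun v hv x hx hdv hvx =>
      hmono _ _ (hs' v hv x hx hdv hvx)⟩
    obtain ⟨hu1, hu2, hu3, hu4⟩ := h2
    have a1 := h.lev_le v hv hdv
    have a2 := h.lev_le x hx hdx
    simp only [Search.push, Function.update_apply] at hlv hlx
    by_cases hvw : v = w
    · by_cases hxw : x = w
      · rw [hvw, hxw]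
      · rw [if_pos hvw, if_neg hxw] at hlx
        omega
    · rw [if_neg hvw] at hlv hlx
      by_cases hxw : x = w
      · rw [hxw]
        exact (hmono _ _ (hp v hv u hu1 hdv hu4 hlv (by omega))).tail
          (rec_push.2 (Or.inr ⟨rfl, rfl⟩))
      · rw [if_neg hxw] at hlx
        exact hmono _ _ (hp v hv x hx hdv hdx hlv hlx)
  | merge u w h1 h2 h3 h4 =>
    have hmono : ∀ x y, Relation.ReflTransGen σ.Rec x y →
        Relation.ReflTransGen (σ.merge n u w).Rec x y := fun x y hxy =>
      Relation.ReflTransGen.mono (fun a b hab => rec_merge.2 (Or.inl hab)) _ _ hxy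
    refine ⟨fun v hv x hx hdv hdx hlv hlx => ?_, fun v hv x hx hdv hvx =>
      hmono _ _ (hs' v hv x hx hdv hvx)⟩
    have ht := h.target_lt h3 h4
    obtain ⟨hu1, hu2, hu3, hu4⟩ := h2
    obtain ⟨hw1, hw2, hw3, hw4, hw5⟩ := h3
    have hdv' : σ.done v = 0 := hdv
    have hdx' : σ.done x = 0 := hdx
    have a1 := h.lev_le v hv hdv
    have a2 := h.lev_le x hx hdx
    have a3 := h.lev_le w hw1 hw4
    have htar : σ.target w = σ.lev w := by
      have := h.rt_eq (σ.lev w + 1) (by omega) (by omega)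
      simp only [Bool.false_eq_true, false_and, or_false] at this
      rw [target, if_neg (by omega)]
    have hlv' : 1 ≤ σ.lev v := by
      simp only [Search.merge] at hlv
      split_ifs at hlv <;> omega
    by_cases hvx : σ.lev v ≤ σ.lev x
    · exact hmono _ _ (hp v hv x hx hdv hdx hlv' hvx)
    · have hwx : σ.lev w ≤ σ.lev x := by
        simp only [Search.merge, htar] at hlx
        split_ifs at hlx <;> omega
      exact (hmono _ _ (hp v hv u hu1 hdv hu4 hlv' (by omega))).trans
        (.head (rec_merge.2 (Or.inr ⟨rfl, rfl⟩)) (hmono _ _ (hp w hw1 x hx hw4 hdx (by omega) hwx)))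

/-- In the search for strongly connected components no edge leads to a class finished later. -/
lemma Inv.done_le_of_reach (h : σ.Inv n E false) (hf : σ.Final n) {v w : ℕ}
    (hv : v < n) (hr : Relation.ReflTransGen (fun x y => x < n ∧ y < n ∧ E x y) v w) :
    σ.done w ≤ σ.done v := by
  refine (hr.mem_of_closed (P := fun x => x < n ∧ σ.done x ≤ σ.done v) ?_ ⟨hv, le_rfl⟩).2
  rintro x y ⟨hx, hy, hE⟩ ⟨-, hxv⟩
  refine ⟨hy, ?_⟩
  have a1 := h.done_ne_zero hf hx
  have a2 := h.done_le x hx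
  have a3 := h.done_edge x hx a1 y hy hE
  have a4 := h.root_eq (σ.done x - 1) (by omega)
  simp only [Bool.false_eq_true, false_and, or_false] at a4
  omega

/-- The classes are the strongly connected components. -/
theorem SccInv.done_eq_iff (hc : σ.SccInv n) (h : σ.Inv n E false) (hf : σ.Final n) {v w : ℕ}
    (hv : v < n) (hw : w < n) : σ.done v = σ.done w ↔
      Relation.ReflTransGen (fun x y => x < n ∧ y < n ∧ E x y) v w ∧
      Relation.ReflTransGen (fun x y => x < n ∧ y < n ∧ E x y) w v := by
  have hmono : ∀ x y, Relation.ReflTransGen σ.Rec x y →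
      Relation.ReflTransGen (fun x y => x < n ∧ y < n ∧ E x y) x y :=
    fun x y hxy => Relation.ReflTransGen.mono (fun _ _ => h.edge_of_rec) _ _ hxy
  constructor
  · intro hvw
    exact ⟨hmono _ _ (hc.same v hv w hw (h.done_ne_zero hf hv) hvw),
      hmono _ _ (hc.same w hw v hv (h.done_ne_zero hf hw) hvw.symm)⟩
  · rintro ⟨h1, h2⟩
    exact le_antisymm (h.done_le_of_reach hf hw h2) (h.done_le_of_reach hf hv h1)

/-! ### What the search for blocks computes -/

/-- The recorded edges, without orientation. -/
def SymRec (σ : Search) (x y : ℕ) : Prop := σ.Rec x y ∨ σ.Rec y x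

lemma SymRec.symm {x y : ℕ} (h : σ.SymRec x y) : σ.SymRec y x := Or.symm h

/-- Every vertex of `W` has a path to `u`, and after the removal of a vertex it still has a path to
`p` or to `u`. Joining `p` and `u` by an edge thus makes `W` biconnected. -/
structure Ends {V : Type*} (R : V → V → Prop) (W : Set V) (p u : V) : Prop where
  left_mem : p ∈ W
  right_mem : u ∈ W
  conn : ∀ x ∈ W, Relation.ReflTransGen (RelOn R W) x u
  ends : ∀ Z : Set V, Z.Subsingleton → ∀ x ∈ W \ Z,
    (p ∉ Z ∧ Relation.ReflTransGen (RelOn R (W \ Z)) x p) ∨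
    (u ∉ Z ∧ Relation.ReflTransGen (RelOn R (W \ Z)) x u)

lemma Ends.of_biOn {V : Type*} {R : V → V → Prop} {B : Set V} {p u : V} (h : BiOn R B)
    (hp : p ∈ B) (hu : u ∈ B) (hpu : p ≠ u) : Ends R B p u := by
  refine ⟨hp, hu, fun x hx => h.connOn x hx u hu, fun Z hZ x hx => ?_⟩
  by_cases hpZ : p ∈ Z
  · have huZ : u ∉ Z := fun huZ => hpu (hZ hpZ huZ)
    exact Or.inr ⟨huZ, h Z hZ x hx u ⟨hu, huZ⟩⟩
  · exact Or.inl ⟨hpZ, h Z hZ x hx p ⟨hp, hpZ⟩⟩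

/-- A biconnected set `B` is put in front of `W` at the vertex `c`. -/
lemma Ends.extend {V : Type*} {R : V → V → Prop} {B W : Set V} {c p u : V} (hW : Ends R W c u)
    (hB : BiOn R B) (hc : c ∈ B) (hp : p ∈ B) (hpc : p ≠ c) (hpW : p ∉ W) :
    Ends R (B ∪ W) p u := by
  have hBW : ∀ Z : Set V, B \ Z ⊆ (B ∪ W) \ Z := fun Z =>
    Set.sdiff_subset_sdiff_left Set.subset_union_left
  have hWB : ∀ Z : Set V, W \ Z ⊆ (B ∪ W) \ Z := fun Z =>
    Set.sdiff_subset_sdiff_left Set.subset_union_right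
  refine ⟨Or.inl hp, Or.inr hW.right_mem, ?_, fun Z hZ => ?_⟩
  · have hcu := RelOn.reflTransGen_subset (Set.subset_union_right (s := B)) (hW.conn c hW.left_mem)
    rintro x (hx | hx)
    · exact (RelOn.reflTransGen_subset Set.subset_union_left (hB.connOn x hx c hc)).trans hcu
    · exact RelOn.reflTransGen_subset Set.subset_union_right (hW.conn x hx)
  · by_cases hpZ : p ∈ Z
    · -- Only `p` is removed, so `W` is intact and leads to `u`.
      have hWZ : W \ Z = W := by
        rw [sdiff_eq_left, Set.disjoint_right]
        intro z hz hzW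
        exact hpW (hZ hpZ hz ▸ hzW)
      have hcZ : c ∉ Z := fun hcZ => hpc (hZ hpZ hcZ)
      have huZ : u ∉ Z := fun huZ => hpW (hZ hpZ huZ ▸ hW.right_mem)
      have hW' : ∀ x ∈ W, Relation.ReflTransGen (RelOn R ((B ∪ W) \ Z)) x u := fun x hx =>
        RelOn.reflTransGen_subset (hWB Z) (hWZ.symm ▸ hW.conn x hx)
      rintro x ⟨hx | hx, hxZ⟩
      · exact Or.inr ⟨huZ, (RelOn.reflTransGen_subset (hBW Z)
          (hB Z hZ x ⟨hx, hxZ⟩ c ⟨hc, hcZ⟩)).trans (hW' c hW.left_mem)⟩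
      · exact Or.inr ⟨huZ, hW' x hx⟩
    · rintro x ⟨hx | hx, hxZ⟩
      · exact Or.inl ⟨hpZ, RelOn.reflTransGen_subset (hBW Z) (hB Z hZ x ⟨hx, hxZ⟩ p ⟨hp, hpZ⟩)⟩
      · rcases hW.ends Z hZ x ⟨hx, hxZ⟩ with ⟨hcZ, h⟩ | ⟨huZ, h⟩
        · exact Or.inl ⟨hpZ, (RelOn.reflTransGen_subset (hWB Z) h).trans
            (RelOn.reflTransGen_subset (hBW Z) (hB Z hZ c ⟨hc, hcZ⟩ p ⟨hp, hpZ⟩))⟩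
        · exact Or.inr ⟨huZ, RelOn.reflTransGen_subset (hWB Z) h⟩

lemma Ends.biOn {V : Type*} {R : V → V → Prop} {W : Set V} {p u : V} (hW : Ends R W p u)
    (hR : ∀ a b, R a b → R b a) (hpu : R p u) : BiOn R W := by
  intro Z hZ x hx y hy
  have hedge : p ∉ Z → u ∉ Z → Relation.ReflTransGen (RelOn R (W \ Z)) p u := fun hp hu =>
    .single ⟨hpu, ⟨hW.left_mem, hp⟩, ⟨hW.right_mem, hu⟩⟩
  have hsymm : ∀ {x y : V}, Relation.ReflTransGen (RelOn R (W \ Z)) x y →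
      Relation.ReflTransGen (RelOn R (W \ Z)) y x := RelOn.reflTransGen_symm hR
  rcases hW.ends Z hZ x hx with ⟨h1, hx⟩ | ⟨h1, hx⟩ <;>
    rcases hW.ends Z hZ y hy with ⟨h2, hy⟩ | ⟨h2, hy⟩
  · exact hx.trans (hsymm hy)
  · exact hx.trans ((hedge h1 h2).trans (hsymm hy))
  · exact hx.trans ((hsymm (hedge h2 h1)).trans (hsymm hy))
  · exact hx.trans (hsymm hy)

/-- The class of the level `l`: its vertices, and the vertex at which it hangs. -/
def levelClass (n : ℕ) (σ : Search) (l : ℕ) : Set ℕ :=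
  insert (σ.rt l) {v | v < n ∧ σ.done v = 0 ∧ σ.lev v = l}

/-- The union of the classes from the level `l` on. -/
def tailClass (n : ℕ) (σ : Search) (l : ℕ) : Set ℕ :=
  insert (σ.rt l) {v | v < n ∧ σ.done v = 0 ∧ l ≤ σ.lev v}

/-- The finished class with index `i`, together with the vertex at which it hung. -/
def block (n : ℕ) (σ : Search) (i : ℕ) : Set ℕ :=
  insert (σ.root i) {v | v < n ∧ σ.done v = i + 1}

/-- Invariant of the search for blocks: recorded edges make the classes biconnected. The first level
is the starting vertex alone, and hangs nowhere. -/
structure BccInv (n : ℕ) (σ : Search) : Prop where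
  first : ∀ v < n, ∀ w < n, σ.done v = 0 → σ.done w = 0 → σ.lev v = 1 → σ.lev w = 1 → v = w
  level : ∀ l, 2 ≤ l → l ≤ σ.k → BiOn σ.SymRec (σ.levelClass n l)
  block : ∀ i < σ.id, σ.root i < n → BiOn σ.SymRec (σ.block n i)
  single : ∀ i < σ.id, σ.root i = n → ∀ v < n, ∀ w < n, σ.done v = i + 1 → σ.done w = i + 1 → v = w

lemma Initial.bccInv (h : σ.Initial n) : σ.BccInv n := by
  obtain ⟨h1, h2, h3, h4⟩ := h
  constructor <;> grind

/-- The union of the classes from the level `l` on is biconnected once an edge joins a vertex `u` of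
the last level to a vertex `p` of the class of `l`. -/
lemma BccInv.ends (hc : σ.BccInv n) (h : σ.Inv n E true) {u : ℕ} (hu : u < n) (hdu : σ.done u = 0)
    (hlu : σ.lev u = σ.k) (d : ℕ) : ∀ l p, 2 ≤ l → l + d = σ.k → p ∈ σ.levelClass n l →
      (l < σ.k → p ≠ σ.rt (l + 1)) → (l = σ.k → p ≠ u) →
      Ends σ.SymRec (σ.tailClass n l) p u := by
  induction d with
  | zero =>
    intro l p hl hlk hp _ hpu
    have : σ.tailClass n l = σ.levelClass n l := by
      ext v
      simp only [tailClass, levelClass, Set.mem_insert_iff, Set.mem_ofPred_eq]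
      have := h.lev_le v
      grind
    rw [this]
    refine Ends.of_biOn (hc.level l hl (by omega)) hp ?_ (hpu (by omega))
    exact Or.inr ⟨hu, hdu, by omega⟩
  | succ d ih =>
    intro l p hl hlk hp hpr _
    have hr := h.rt_eq (l + 1) (by omega) (by omega)
    have hr0 := h.rt_eq l (by omega) (by omega)
    have hE := ih (l + 1) (σ.rt (l + 1)) (by omega) (by omega) (Or.inl rfl)
      (by
        intro hlt he
        have := h.rt_eq (l + 1 + 1) (by omega) (by omega)
        grind)
      (by
        intro hlt he
        grind)
    have hsplit : σ.tailClass n l = σ.levelClass n l ∪ σ.tailClass n (l + 1) := by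
      ext v
      simp only [tailClass, levelClass, Set.mem_insert_iff, Set.mem_ofPred_eq, Set.mem_union]
      grind
    rw [hsplit]
    refine hE.extend (hc.level l hl (by omega)) (Or.inr (by grind)) hp (hpr (by omega)) ?_
    simp only [tailClass, levelClass, Set.mem_insert_iff, Set.mem_ofPred_eq] at hp ⊢
    grind

lemma BccInv.step (h : σ.Inv n E true) (hc : σ.BccInv n) (hs : Step n E true σ τ) :
    τ.BccInv n := by
  cases hs with
  | start u h1 h2 =>
    obtain ⟨hu1, hu2, hu3, hu4⟩ := h2
    refine ⟨?_, ?_, hc.block, hc.single⟩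
    · intro v hv w hw hdv hdw hlv hlw
      have a1 := h.lev_le v hv hdv
      have a2 := h.lev_le w hw hdw
      simp only [Search.start, Function.update_apply] at hlv hlw
      grind
    · intro l hl hl'
      simp only [Search.start] at hl'
      omega
  | pop h1 h2 =>
    have hrt := h.rt_eq σ.k h1 le_rfl
    have hsym : (σ.pop n).SymRec = σ.SymRec := rfl
    have hnew : ∀ v < n, (σ.pop n).done v = σ.id + 1 ↔ σ.done v = 0 ∧ σ.lev v = σ.k := by
      intro v hv
      have := h.done_le v hv
      simp only [Search.pop]
      grind
    have hold : ∀ v < n, ∀ i < σ.id, (σ.pop n).done v = i + 1 ↔ σ.done v = i + 1 := by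
      intro v hv i hi
      have := h.done_le v hv
      simp only [Search.pop]
      grind
    have hroot : ∀ i < σ.id, (σ.pop n).root i = σ.root i := by
      intro i hi
      simp [Search.pop, Function.update_of_ne (show i ≠ σ.id by omega)]
    have hroot' : (σ.pop n).root σ.id = σ.rt σ.k := by simp [Search.pop]
    refine ⟨?_, ?_, ?_, ?_⟩
    · intro v hv w hw hdv hdw hlv hlw
      refine hc.first v hv w hw ?_ ?_ hlv hlw
      · simp only [Search.pop] at hdv; grind
      · simp only [Search.pop] at hdw; grind
    · intro l hl hl'
      simp only [Search.pop] at hl'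
      rw [hsym]
      convert hc.level l hl (by omega) using 1
      ext v
      simp only [levelClass, Search.pop, Set.mem_insert_iff, Set.mem_ofPred_eq]
      grind
    · intro i hi hr
      rw [hsym]
      by_cases hii : i = σ.id
      · subst hii
        rw [hroot'] at hr
        convert hc.level σ.k (by grind) le_rfl using 1
        ext v
        simp only [levelClass, Search.block, hroot', Set.mem_insert_iff, Set.mem_ofPred_eq]
        exact or_congr_right (and_congr_right fun hv => hnew v hv)
      · have hi' : i < σ.id := by simp only [Search.pop] at hi; omega
        rw [hroot i hi'] at hr
        convert hc.block i hi' hr using 1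
        ext v
        simp only [Search.block, hroot i hi', Set.mem_insert_iff, Set.mem_ofPred_eq]
        exact or_congr_right (and_congr_right fun hv => hold v hv i hi')
    · intro i hi hr v hv w hw hdv hdw
      by_cases hii : i = σ.id
      · subst hii
        rw [hroot'] at hr
        rw [hnew v hv] at hdv
        rw [hnew w hw] at hdw
        exact hc.first v hv w hw hdv.1 hdw.1 (by grind) (by grind)
      · have hi' : i < σ.id := by simp only [Search.pop] at hi; omega
        rw [hroot i hi'] at hr
        rw [hold v hv i hi'] at hdv
        rw [hold w hw i hi'] at hdw
        exact hc.single i hi' hr v hv w hw hdv hdw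
  | exhaust u h1 h2 h3 => exact ⟨hc.first, hc.level, hc.block, hc.single⟩
  | push u w h1 h2 h3 h4 =>
    have hmono : ∀ x y, σ.SymRec x y → (σ.push n true u w).SymRec x y := fun x y hxy =>
      hxy.imp (fun h => rec_push.2 (Or.inl h)) (fun h => rec_push.2 (Or.inl h))
    obtain ⟨hu1, hu2, hu3, hu4⟩ := h2
    obtain ⟨hw1, hw2, hw3, hw4, hw5⟩ := h3
    refine ⟨?_, ?_, fun i hi hr => (hc.block i hi hr).mono hmono, hc.single⟩
    · intro v hv x hx hdv hdx hlv hlx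
      refine hc.first v hv x hx hdv hdx ?_ ?_
      · simp only [Search.push, Function.update_apply] at hlv; grind
      · simp only [Search.push, Function.update_apply] at hlx; grind
    · intro l hl hl'
      by_cases hlk : l = σ.k + 1
      · have : (σ.push n true u w).levelClass n l = {u, w} := by
          ext v
          have := h.lev_le v
          simp only [levelClass, Search.push, Function.update_apply, Set.mem_insert_iff,
            Set.mem_ofPred_eq, Set.mem_singleton_iff]
          grind
        rw [this]
        exact BiOn.pair (fun _ _ => SymRec.symm) (Or.inl (rec_push.2 (Or.inr ⟨rfl, rfl⟩)))
      · have hlk' : l ≤ σ.k := by simp only [Search.push] at hl'; omega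
        convert (hc.level l hl hlk').mono hmono using 1
        ext v
        simp only [levelClass, Search.push, Function.update_apply, Set.mem_insert_iff,
          Set.mem_ofPred_eq]
        grind
  | merge u w h1 h2 h3 h4 =>
    have hmono : ∀ x y, σ.SymRec x y → (σ.merge n u w).SymRec x y := fun x y hxy =>
      hxy.imp (fun h => rec_merge.2 (Or.inl h)) (fun h => rec_merge.2 (Or.inl h))
    obtain ⟨ht1, ht2, ht3⟩ := h.target_lt h3 h4
    obtain ⟨hu1, hu2, hu3, hu4⟩ := h2
    obtain ⟨hw1, hw2, hw3, hw4, hw5⟩ := h3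
    have hrt := h.rt_eq (σ.lev w + 1) (by omega) (by have := h.lev_le w hw1 hw4; omega)
    -- The first level is a single vertex, so that an edge back to it is an edge to `rt 2`.
    have htwo : 2 ≤ σ.target w := by
      by_contra hlt
      have h1 : σ.lev w = 1 := by omega
      have := hc.first w hw1 (σ.rt (σ.lev w + 1))
      unfold target at hlt
      grind
    refine ⟨?_, ?_, fun i hi hr => (hc.block i hi hr).mono hmono, hc.single⟩
    · intro v hv x hx hdv hdx hlv hlx
      refine hc.first v hv x hx hdv hdx ?_ ?_
      · simp only [Search.merge] at hlv; grind
      · simp only [Search.merge] at hlx; grind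
    · intro l hl hl'
      by_cases hlt : l = σ.target w
      · have hcls : (σ.merge n u w).levelClass n l = σ.tailClass n l := by
          ext v
          simp only [levelClass, tailClass, Search.merge, Set.mem_insert_iff, Set.mem_ofPred_eq]
          grind
        have hends := hc.ends h hu1 hu4 hu2 (σ.k - l) l w hl (by omega)
          (by
            subst hlt
            unfold target
            split_ifs with hif
            · exact Or.inl hif.symm
            · exact Or.inr ⟨hw1, hw4, rfl⟩)
          (by
            intro _ he
            have hrt' := h.rt_eq (l + 1) (by omega) (by omega)
            subst hlt
            unfold target at he hrt'
            grind)
          (by omega)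
        rw [hcls]
        have hends' : Ends (σ.merge n u w).SymRec (σ.tailClass n l) w u :=
          ⟨hends.left_mem, hends.right_mem,
            fun x hx => RelOn.reflTransGen_mono hmono le_rfl (hends.conn x hx),
            fun Z hZ x hx => (hends.ends Z hZ x hx).imp
              (fun h => ⟨h.1, RelOn.reflTransGen_mono hmono le_rfl h.2⟩)
              (fun h => ⟨h.1, RelOn.reflTransGen_mono hmono le_rfl h.2⟩)⟩
        exact hends'.biOn (fun _ _ => SymRec.symm) (Or.inr (rec_merge.2 (Or.inr ⟨rfl, rfl⟩)))
      · have hlk : l < σ.target w := by simp only [Search.merge] at hl'; omega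
        convert (hc.level l hl (by omega)).mono hmono using 1
        ext v
        simp only [levelClass, Search.merge, Set.mem_insert_iff, Set.mem_ofPred_eq]
        grind

end Search

/-! ### The blocks of a graph, from a finished search -/

namespace Search

variable {n : ℕ} {E : ℕ → ℕ → Prop} {σ : Search}

/-- `σ` is the result of a search for strongly connected components. -/
structure SccResult (n : ℕ) (E : ℕ → ℕ → Prop) (σ : Search) : Prop where
  inv : σ.Inv n E false
  scc : σ.SccInv n
  final : σ.Final n

/-- `σ` is the result of a search for blocks. -/
structure BccResult (n : ℕ) (E : ℕ → ℕ → Prop) (σ : Search) : Prop where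
  inv : σ.Inv n E true
  bcc : σ.BccInv n
  final : σ.Final n

lemma BccResult.done_mem (r : σ.BccResult n E) {v : ℕ} (hv : v < n) :
    0 < σ.done v ∧ σ.done v ≤ σ.id :=
  ⟨Nat.pos_of_ne_zero (r.inv.done_ne_zero r.final hv), r.inv.done_le v hv⟩

lemma BccResult.lt_done_root (r : σ.BccResult n E) {i : ℕ} (hi : i < σ.id) (hr : σ.root i < n) :
    i + 1 < σ.done (σ.root i) := by
  have h1 := r.inv.root_eq i hi
  have h2 := r.inv.done_ne_zero r.final hr
  omega

/-- Every edge runs inside a class, or between a class and the vertex at which it hangs. -/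
lemma BccResult.edge (r : σ.BccResult n E) (hE : ∀ x < n, ∀ y < n, E x y → E y x) {v w : ℕ}
    (hv : v < n) (hw : w < n) (h : E v w) : σ.done w = σ.done v ∨ w = σ.root (σ.done v - 1) ∨
      v = σ.root (σ.done w - 1) := by
  have h1 := r.inv.done_edge v hv (r.inv.done_ne_zero r.final hv) w hw h
  have h2 := r.inv.done_edge w hw (r.inv.done_ne_zero r.final hw) v hv (hE v hv w hw h)
  omega

/-- Every biconnected set with at least two elements lies in a finished class. Its vertex which was
finished first determines the class: the set can leave the class neither through a vertex of the
class, since this would lead to vertices finished earlier, nor only through the vertex at which the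
class hangs. -/
lemma BccResult.exists_subset_block (r : σ.BccResult n E) (hE : ∀ x < n, ∀ y < n, E x y → E y x)
    {S : Set ℕ} (hS : ∀ v ∈ S, v < n) (hnt : S.Nontrivial) (hb : BiOn E S) :
    ∃ i < σ.id, σ.root i < n ∧ S ⊆ σ.block n i := by
  obtain ⟨x, hx, hmin⟩ : ∃ x ∈ S, ∀ y ∈ S, σ.done x ≤ σ.done y := by
    obtain ⟨x, hx, hx'⟩ := (InvImage.wf σ.done wellFounded_lt).has_min S hnt.nonempty
    exact ⟨x, hx, fun y hy => not_lt.1 (hx' y hy)⟩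
  have hdx := r.done_mem (hS x hx)
  set i := σ.done x - 1 with hi
  have hsub : S ⊆ σ.block n i := by
    intro y hy
    by_cases hyr : y = σ.root i
    · exact Or.inl hyr
    have hxr : x ≠ σ.root i := by
      intro he
      have hrn : σ.root i < n := he ▸ hS x hx
      have := r.lt_done_root (by omega) hrn
      rw [← he] at this
      omega
    have hpath := hb {σ.root i} Set.subsingleton_singleton x ⟨hx, hxr⟩ y ⟨hy, hyr⟩
    refine Or.inr ⟨hS y hy, ?_⟩
    refine hpath.mem_of_closed (P := fun z => σ.done z = i + 1) ?_ (by omega)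
    rintro a c ⟨hac, ⟨ha, har⟩, hc, hcr⟩ hda
    have hmc := hmin c hc
    rcases r.edge hE (hS a ha) (hS c hc) hac with h | h | h
    · omega
    · exact absurd (by rw [h]; congr 1; omega) hcr
    · have hdc := r.done_mem (hS c hc)
      have := r.lt_done_root (i := σ.done c - 1) (by omega) (h ▸ hS a ha)
      rw [← h] at this
      omega
  refine ⟨i, by omega, ?_, hsub⟩
  by_contra hr
  have hroot := r.inv.root_eq i (by omega)
  obtain ⟨y, hy, hyx⟩ := hnt.exists_ne x
  have hy' : σ.done y = i + 1 := by
    rcases hsub hy with h | h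
    · exact absurd (h ▸ hS y hy) hr
    · exact h.2
  exact hyx (r.bcc.single i (by omega) (by omega) y (hS y hy) x (hS x hx) hy' (by omega))

lemma BccResult.block_lt (_r : σ.BccResult n E) {i : ℕ} (hr : σ.root i < n) :
    ∀ v ∈ σ.block n i, v < n := by
  rintro v (rfl | hv)
  · exact hr
  · exact hv.1

lemma BccResult.block_nontrivial (r : σ.BccResult n E) {i : ℕ} (hi : i < σ.id)
    (hr : σ.root i < n) : (σ.block n i).Nontrivial := by
  obtain ⟨v, hv, hd⟩ := r.inv.home_nonempty i hi
  refine ⟨v, Or.inr ⟨hv, hd⟩, σ.root i, Or.inl rfl, ?_⟩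
  rintro rfl
  have := r.lt_done_root hi hr
  omega

lemma BccResult.eq_of_block_subset (r : σ.BccResult n E) {i j : ℕ} (hi : i < σ.id)
    (hri : σ.root i < n) (hj : j < σ.id) (hrj : σ.root j < n)
    (h : σ.block n i ⊆ σ.block n j) : i = j := by
  by_contra hij
  obtain ⟨v, hv, hd⟩ := r.inv.home_nonempty i hi
  have h1 := r.lt_done_root hi hri
  have h2 := r.lt_done_root hj hrj
  have hvj : v = σ.root j := by
    rcases h (Or.inr ⟨hv, hd⟩) with h | h
    · exact h
    · exact absurd h.2 (by omega)
  subst hvj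
  rcases h (Or.inl rfl) with h | h
  · rw [h] at h1
    omega
  · have := h.2
    omega

/-- The finished class with index `i`, as a set of vertices. -/
def vertexBlock (n : ℕ) (σ : Search) (i : ℕ) : Set (Fin n) := {v | (v : ℕ) ∈ σ.block n i}

lemma BccResult.image_vertexBlock (r : σ.BccResult n E) {i : ℕ} (hr : σ.root i < n) :
    Fin.val '' σ.vertexBlock n i = σ.block n i := by
  ext v
  constructor
  · rintro ⟨w, hw, rfl⟩
    exact hw
  · exact fun hv => ⟨⟨v, r.block_lt hr v hv⟩, hv, rfl⟩

lemma BccResult.eq_of_vertexBlock_subset (r : σ.BccResult n E) {i j : ℕ} (hi : i < σ.id)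
    (hri : σ.root i < n) (hj : j < σ.id) (hrj : σ.root j < n)
    (h : σ.vertexBlock n i ⊆ σ.vertexBlock n j) : i = j := by
  refine r.eq_of_block_subset hi hri hj hrj ?_
  rw [← r.image_vertexBlock hri, ← r.image_vertexBlock hrj]
  exact Set.image_mono h

lemma BccResult.vertexBlock_nontrivial (r : σ.BccResult n E) {i : ℕ} (hi : i < σ.id)
    (hr : σ.root i < n) : (σ.vertexBlock n i).Nontrivial := by
  have := r.block_nontrivial hi hr
  rw [← r.image_vertexBlock hr] at this
  exact Set.nontrivial_of_image _ _ this

lemma BccResult.exists_subset_vertexBlock (r : σ.BccResult n E) {H : SimpleGraph (Fin n)}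
    (hH : ∀ x y : Fin n, E x y ↔ H.Adj x y) {S : Set (Fin n)} (hnt : S.Nontrivial)
    (hb : BiOn H.Adj S) : ∃ i < σ.id, σ.root i < n ∧ S ⊆ σ.vertexBlock n i := by
  have hE : ∀ x < n, ∀ y < n, E x y → E y x := by
    intro x hx y hy h
    exact (hH ⟨y, hy⟩ ⟨x, hx⟩).2 ((hH ⟨x, hx⟩ ⟨y, hy⟩).1 h).symm
  obtain ⟨i, hi, hr, hsub⟩ := r.exists_subset_block hE (S := Fin.val '' S)
    (by rintro _ ⟨v, -, rfl⟩; exact v.2) (hnt.image Fin.val_injective)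
    ((biOn_image Fin.val_injective E S).2 (hb.mono fun a b => (hH a b).2))
  exact ⟨i, hi, hr, fun v hv => hsub ⟨v, hv, rfl⟩⟩

lemma BccResult.biOn_vertexBlock (r : σ.BccResult n E) {i : ℕ} (hi : i < σ.id)
    (hr : σ.root i < n) : BiOn (fun x y : Fin n => σ.SymRec x y) (σ.vertexBlock n i) := by
  rw [← biOn_image Fin.val_injective, r.image_vertexBlock hr]
  exact r.bcc.block i hi hr

lemma BccResult.adj_of_symRec (r : σ.BccResult n E) {H : SimpleGraph (Fin n)}
    (hH : ∀ x y : Fin n, E x y ↔ H.Adj x y) (x y : Fin n) (h : σ.SymRec x y) : H.Adj x y := by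
  rcases h with h | h
  · exact (hH x y).1 (r.inv.edge_of_rec h).2.2
  · exact ((hH y x).1 (r.inv.edge_of_rec h).2.2).symm

/-- The finished classes that hang at a vertex, together with this vertex, are the blocks with at
least two vertices. -/
theorem BccResult.isBlock_nontrivial_iff (r : σ.BccResult n E) {H : SimpleGraph (Fin n)}
    (hH : ∀ x y : Fin n, E x y ↔ H.Adj x y) (S : Set (Fin n)) :
    H.IsBlock S ∧ S.Nontrivial ↔ ∃ i < σ.id, σ.root i < n ∧ S = σ.vertexBlock n i := by
  have hblk : ∀ i < σ.id, σ.root i < n → (H.induce (σ.vertexBlock n i)).IsBiconnected := by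
    intro i hi hr
    rw [SimpleGraph.isBiconnected_induce_iff]
    exact ⟨(r.vertexBlock_nontrivial hi hr).nonempty,
      (r.biOn_vertexBlock hi hr).mono (r.adj_of_symRec hH)⟩
  have hsub : ∀ T : Set (Fin n), T.Nontrivial → (H.induce T).IsBiconnected →
      ∃ i < σ.id, σ.root i < n ∧ T ⊆ σ.vertexBlock n i := fun T hT hb =>
    r.exists_subset_vertexBlock hH hT ((SimpleGraph.isBiconnected_induce_iff H T).1 hb).2
  constructor
  · rintro ⟨hS, hnt⟩
    obtain ⟨i, hi, hr, h⟩ := hsub S hnt hS.prop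
    exact ⟨i, hi, hr, hS.eq_of_subset (hblk i hi hr) h⟩
  · rintro ⟨i, hi, hr, rfl⟩
    have hnt := r.vertexBlock_nontrivial hi hr
    refine ⟨⟨hblk i hi hr, fun T hT hiT => ?_⟩, hnt⟩
    obtain ⟨j, hj, hrj, h⟩ := hsub T (hnt.mono hiT) hT
    have := r.eq_of_vertexBlock_subset hi hr hj hrj (hiT.trans h)
    rw [this]
    exact h

end Search

/-- The blocks with a single vertex are the isolated vertices. -/
lemma SimpleGraph.isBlock_not_nontrivial_iff {V : Type*} (H : SimpleGraph V) (S : Set V) :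
    H.IsBlock S ∧ ¬ S.Nontrivial ↔ ∃ v, S = {v} ∧ ∀ w, ¬ H.Adj v w := by
  constructor
  · rintro ⟨hS, hnt⟩
    obtain ⟨v, hv⟩ := ((isBiconnected_induce_iff H S).1 hS.prop).1
    have hSv : S = {v} := (Set.not_nontrivial_iff.1 hnt).eq_singleton_of_mem hv
    refine ⟨v, hSv, fun w hw => hnt ?_⟩
    have hT : (H.induce {v, w}).IsBiconnected := by
      rw [isBiconnected_induce_iff]
      exact ⟨⟨v, by simp⟩, BiOn.pair (fun _ _ h => h.symm) hw⟩
    rw [hS.eq_of_subset hT (by simp [hSv])]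
    exact Set.nontrivial_pair hw.ne
  · rintro ⟨v, rfl, hv⟩
    refine ⟨⟨?_, fun T hT hvT => ?_⟩, Set.not_nontrivial_singleton⟩
    · change (H.induce {v}).IsBiconnected
      rw [isBiconnected_induce_iff]
      exact ⟨Set.singleton_nonempty v, BiOn.of_subsingleton Set.subsingleton_singleton⟩
    · replace hT := (isBiconnected_induce_iff H T).1 hT
      intro w hw
      rcases (hT.2.connOn v (hvT rfl) w hw).cases_head with h | ⟨c, h, -⟩
      · exact h.symm
      · exact absurd h.1 (hv c)

/-! ### Strongly biconnected components as blocks -/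

namespace Digraph

variable {V : Type*}

/-- There are directed paths from `x` to `y` and back. -/
def StronglyConnectedPair (G : Digraph V) (x y : V) : Prop :=
  Relation.ReflTransGen G.Adj x y ∧ Relation.ReflTransGen G.Adj y x

/-- The undirected graph of the edges whose ends are in the same strongly connected component. -/
def innerGraph (G : Digraph V) : SimpleGraph V where
  Adj x y := x ≠ y ∧ G.StronglyConnectedPair x y ∧ (G.Adj x y ∨ G.Adj y x)
  symm := ⟨fun _ _ h => ⟨h.1.symm, ⟨h.2.1.2, h.2.1.1⟩, h.2.2.symm⟩⟩
  loopless := ⟨fun _ h => h.1 rfl⟩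

lemma innerGraph_adj {G : Digraph V} {x y : V} : G.innerGraph.Adj x y ↔
    x ≠ y ∧ G.StronglyConnectedPair x y ∧ (G.Adj x y ∨ G.Adj y x) := Iff.rfl

lemma StronglyConnectedPair.path {G : Digraph V} {x y : V} (h : G.StronglyConnectedPair x y) :
    Relation.ReflTransGen (fun a b => G.Adj a b ∧ G.StronglyConnectedPair a b) x y := by
  obtain ⟨h1, h2⟩ := h
  induction h1 using Relation.ReflTransGen.head_induction_on with
  | refl => exact .refl
  | head hab hb ih =>
    exact .head ⟨hab, .single hab, hb.trans h2⟩ (ih (h2.tail hab))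

/-- If the blocks of the inner graph are strongly connected, they are the strongly biconnected
components. -/
lemma isComponent_iff_isBlock [Finite V] {G : Digraph V}
    (hG : ∀ C, G.innerGraph.IsBlock C → ConnOn G.Adj C) (C : Set V) :
    G.IsStronglyBiconnectedComponent C ↔ G.innerGraph.IsBlock C := by
  have h1 : ∀ T, (G.induce T).IsStronglyBiconnected → (G.innerGraph.induce T).IsBiconnected := by
    intro T hT
    rw [isStronglyBiconnected_induce_iff] at hT
    rw [SimpleGraph.isBiconnected_induce_iff]
    have hpath : ∀ a ∈ T, ∀ b ∈ T, Relation.ReflTransGen G.Adj a b := fun a ha b hb =>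
      Relation.ReflTransGen.mono (fun _ _ h => h.1) _ _ (hT.2.1 a ha b hb)
    exact ⟨hT.1, hT.2.2.mono_on fun a ha b hb hab =>
      ⟨hab.1, ⟨hpath a ha b hb, hpath b hb a ha⟩, hab.2⟩⟩
  have h2 : ∀ T, G.innerGraph.IsBlock T → (G.induce T).IsStronglyBiconnected := by
    intro T hT
    have hT' := (SimpleGraph.isBiconnected_induce_iff _ T).1 hT.prop
    rw [isStronglyBiconnected_induce_iff]
    exact ⟨hT'.1, hG T hT, hT'.2.mono fun a b h => ⟨h.1, h.2.2⟩⟩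
  constructor
  · intro hC
    obtain ⟨D, hCD, hD⟩ := Set.Finite.exists_le_maximal
      (Set.toFinite {T : Set V | (G.innerGraph.induce T).IsBiconnected}) (h1 C hC.prop)
    rw [hC.eq_of_subset (h2 D hD) hCD]
    exact hD
  · exact fun hC => ⟨h2 C hC, fun T hT hCT => hC.le_of_ge (h1 T hT) hCT⟩

end Digraph

namespace Search

variable {n : ℕ} {E : ℕ → ℕ → Prop} {σ : Search}

/-- The vertex of the class `i` that is nearest to `v` in the tree of the classes: follow the
vertices at which the classes hang until the class `i` is met; if it is not met, it is the vertex at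
which the class `i` hangs. The second condition makes the recursion terminate, and holds for the
result of a search for blocks whenever the class of `v` hangs at a vertex. -/
noncomputable def proj (n : ℕ) (σ : Search) (i v : ℕ) : ℕ :=
  if σ.done v = i + 1 then v
  else if h : σ.done v < σ.done (σ.root (σ.done v - 1)) ∧
      σ.done (σ.root (σ.done v - 1)) ≤ σ.id ∧ σ.root (σ.done v - 1) < n then
    proj n σ i (σ.root (σ.done v - 1))
  else σ.root i
termination_by σ.id - σ.done v
decreasing_by omega

lemma proj_of_eq {i v : ℕ} (h : σ.done v = i + 1) : σ.proj n i v = v := by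
  rw [proj, if_pos h]

lemma proj_congr {i v w : ℕ} (hv : σ.done v ≠ i + 1) (h : σ.done v = σ.done w) :
    σ.proj n i v = σ.proj n i w := by
  conv_lhs => rw [proj]
  conv_rhs => rw [proj]
  rw [if_neg hv, if_neg (h ▸ hv), h]

lemma BccResult.proj_root (r : σ.BccResult n E) {i v : ℕ} (hv : v < n) (h : σ.done v ≠ i + 1)
    (hr : σ.root (σ.done v - 1) < n) : σ.proj n i v = σ.proj n i (σ.root (σ.done v - 1)) := by
  have h1 := r.done_mem hv
  have h2 := r.lt_done_root (i := σ.done v - 1) (by omega) hr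
  have h3 := r.done_mem hr
  conv_lhs => rw [proj]
  rw [if_neg h, dif_pos ⟨by omega, by omega, hr⟩]

lemma proj_of_lt (i : ℕ) (v : ℕ) (h : i + 1 < σ.done v) : σ.proj n i v = σ.root i := by
  induction hd : σ.id - σ.done v using Nat.strong_induction_on generalizing v with
  | _ d ih =>
    rw [proj, if_neg (by omega)]
    split_ifs with hc
    · exact ih _ (by omega) _ (by omega) rfl
    · rfl

/-- The projection to a class contracts every edge outside of it. -/
lemma BccResult.proj_edge (r : σ.BccResult n E) (hE : ∀ x < n, ∀ y < n, E x y → E y x) {i : ℕ}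
    (hi : i < σ.id) (hri : σ.root i < n) {v w : ℕ} (hv : v < n) (hw : w < n) (h : E v w) :
    σ.proj n i v = σ.proj n i w ∨
      (σ.proj n i v = v ∧ σ.proj n i w = w ∧ v ∈ σ.block n i ∧ w ∈ σ.block n i) := by
  have key : ∀ v w, v < n → w < n → w = σ.root (σ.done v - 1) → σ.proj n i v = σ.proj n i w ∨
      (σ.proj n i v = v ∧ σ.proj n i w = w ∧ v ∈ σ.block n i ∧ w ∈ σ.block n i) := by
    intro v w hv hw hvw
    by_cases hvi : σ.done v = i + 1
    · have hwi : w = σ.root i := by rw [hvw, hvi, Nat.add_sub_cancel]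
      refine Or.inr ⟨proj_of_eq hvi, ?_, Or.inr ⟨hv, hvi⟩, Or.inl hwi⟩
      rw [hwi]
      exact proj_of_lt i _ (r.lt_done_root hi hri)
    · left
      rw [hvw]
      exact r.proj_root hv hvi (hvw ▸ hw)
  rcases r.edge hE hv hw h with h | h | h
  · by_cases hvi : σ.done v = i + 1
    · exact Or.inr ⟨proj_of_eq hvi, proj_of_eq (h.trans hvi), Or.inr ⟨hv, hvi⟩,
        Or.inr ⟨hw, h.trans hvi⟩⟩
    · exact Or.inl (proj_congr hvi h.symm)
  · exact key v w hv hw h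
  · rcases key w v hw hv h with h | ⟨h1, h2, h3, h4⟩
    · exact Or.inl h.symm
    · exact Or.inr ⟨h2, h1, h4, h3⟩

lemma BccResult.proj_of_mem (r : σ.BccResult n E) {i : ℕ} (hi : i < σ.id) (hri : σ.root i < n)
    {v : ℕ} (hv : v ∈ σ.block n i) : σ.proj n i v = v := by
  rcases hv with rfl | hv
  · exact proj_of_lt i _ (r.lt_done_root hi hri)
  · exact proj_of_eq hv.2

/-- A block of the inner graph is strongly connected: a path between two of its vertices, projected
to the block, is a path inside the block. -/
lemma BccResult.connOn_vertexBlock {G : Digraph (Fin n)} (r : σ.BccResult n E)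
    (hE : ∀ x y : Fin n, E x y ↔ G.innerGraph.Adj x y) {i : ℕ} (hi : i < σ.id)
    (hri : σ.root i < n) : ConnOn G.Adj (σ.vertexBlock n i) := by
  have hE' : ∀ x < n, ∀ y < n, E x y → E y x := by
    intro x hx y hy h
    exact (hE ⟨y, hy⟩ ⟨x, hx⟩).2 ((hE ⟨x, hx⟩ ⟨y, hy⟩).1 h).symm
  intro x hx y hy
  have hpair : G.StronglyConnectedPair x y := by
    have hconn := ((r.biOn_vertexBlock hi hri).mono (r.adj_of_symRec hE)).connOn x hx y hy
    have hrefl : ∀ v, G.StronglyConnectedPair v v := fun v => ⟨.refl, .refl⟩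
    refine hconn.mem_of_closed (P := fun z => G.StronglyConnectedPair x z) ?_ (hrefl x)
    intro a b hab ha
    have hab' := (Digraph.innerGraph_adj.1 hab.1).2.1
    exact ⟨ha.1.trans hab'.1, hab'.2.trans ha.2⟩
  have key : ∀ z, Relation.ReflTransGen (fun a b => G.Adj a b ∧ G.StronglyConnectedPair a b) x z →
      ∃ z' : Fin n, (z' : ℕ) = σ.proj n i z ∧
        Relation.ReflTransGen (RelOn G.Adj (σ.vertexBlock n i)) x z' := by
    intro z hz
    induction hz with
    | refl => exact ⟨x, (r.proj_of_mem hi hri hx).symm, .refl⟩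
    | @tail a b _ hab ih =>
      obtain ⟨a', ha', hpath⟩ := ih
      by_cases hne : a = b
      · exact ⟨a', hne ▸ ha', hpath⟩
      · have hEab := (hE a b).2 ⟨hne, hab.2, Or.inl hab.1⟩
        rcases r.proj_edge hE' hi hri a.2 b.2 hEab with h | ⟨h1, h2, h3, h4⟩
        · exact ⟨a', ha'.trans h, hpath⟩
        · have : a' = a := Fin.ext (ha'.trans h1)
          subst this
          exact ⟨b, h2.symm, hpath.tail ⟨hab.1, h3, h4⟩⟩
  obtain ⟨y', hy', hpath⟩ := key y hpair.path
  have : y' = y := Fin.ext (hy'.trans (r.proj_of_mem hi hri hy))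
  exact this ▸ hpath

lemma BccResult.isComponent_iff {G : Digraph (Fin n)} (r : σ.BccResult n E)
    (hE : ∀ x y : Fin n, E x y ↔ G.innerGraph.Adj x y) (C : Set (Fin n)) :
    G.IsStronglyBiconnectedComponent C ↔
      (∃ i < σ.id, σ.root i < n ∧ C = σ.vertexBlock n i) ∨
      ∃ v : Fin n, C = {v} ∧ ∀ w : Fin n, ¬ E v w := by
  have hsplit : ∀ D, G.innerGraph.IsBlock D ↔
      (∃ i < σ.id, σ.root i < n ∧ D = σ.vertexBlock n i) ∨
      ∃ v : Fin n, D = {v} ∧ ∀ w : Fin n, ¬ E v w := by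
    intro D
    simp only [hE, ← r.isBlock_nontrivial_iff hE, ← SimpleGraph.isBlock_not_nontrivial_iff]
    tauto
  rw [Digraph.isComponent_iff_isBlock, hsplit]
  intro D hD
  rcases (hsplit D).1 hD with ⟨i, hi, hr, rfl⟩ | ⟨v, rfl, -⟩
  · exact r.connOn_vertexBlock hE hi hr
  · rintro _ rfl _ rfl
    exact .refl

/-! ### A sparse certificate -/

lemma SccResult.reach_iff (r : σ.SccResult n E) {G : Digraph (Fin n)}
    (hE : ∀ x y : Fin n, E x y ↔ G.Adj x y) (x y : Fin n) :
    σ.done x = σ.done y ↔ G.StronglyConnectedPair x y := by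
  have key : ∀ x y : Fin n, Relation.ReflTransGen (fun x y => x < n ∧ y < n ∧ E x y) (x : ℕ) y ↔
      Relation.ReflTransGen G.Adj x y := by
    intro x y
    constructor
    · intro h
      have aux : ∀ z, Relation.ReflTransGen (fun x y => x < n ∧ y < n ∧ E x y) (x : ℕ) z →
          ∀ y : Fin n, (y : ℕ) = z → Relation.ReflTransGen G.Adj x y := by
        intro z hz
        induction hz with
        | refl => intro y hy; rw [Fin.ext hy]
        | tail _ h ih =>
          intro y hy
          exact (ih ⟨_, h.1⟩ rfl).tail ((hE _ _).1 (by rw [hy]; exact h.2.2))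
      exact aux y h y rfl
    · exact fun h => h.lift Fin.val fun a b hab => ⟨a.2, b.2, (hE a b).2 hab⟩
  rw [r.scc.done_eq_iff r.inv r.final x.2 y.2, key, key]
  rfl

/-- The edges recorded by the two searches form a strongly biconnected subgraph. Hence an edge that
neither search recorded is not a b-bridge. -/
theorem SccResult.isStronglyBiconnected_deleteEdge {E' : ℕ → ℕ → Prop} {σ' : Search}
    {G : Digraph (Fin n)} (hG : G.IsStronglyBiconnected) (r : σ.SccResult n E)
    (hE : ∀ x y : Fin n, E x y ↔ G.Adj x y) (r' : σ'.BccResult n E')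
    (hE' : ∀ x y : Fin n, E' x y ↔ G.SymAdj x y) {b : Fin n × Fin n}
    (hb : ¬ σ.Rec b.1 b.2) (hb' : ¬ σ'.SymRec b.1 b.2) :
    (G.deleteEdge b).IsStronglyBiconnected := by
  have huniv := (Digraph.isStronglyBiconnected_induce_iff G _).1
    ((Digraph.isStronglyBiconnected_iff_univ G).1 hG)
  rw [Digraph.isStronglyBiconnected_iff_univ, Digraph.isStronglyBiconnected_induce_iff]
  refine ⟨huniv.1, ?_, ?_⟩
  · rw [← Set.range_id, connOn_range Function.injective_id]
    intro x y
    have hxy : σ.done x = σ.done y := (r.reach_iff hE x y).2 ⟨hG.1.2 x y, hG.1.2 y x⟩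
    have hpath := r.scc.same x x.2 y y.2 (r.inv.done_ne_zero r.final x.2) hxy
    have aux : ∀ z, Relation.ReflTransGen σ.Rec (x : ℕ) z → ∀ y : Fin n, (y : ℕ) = z →
        Relation.ReflTransGen (fun a c => (G.deleteEdge b).Adj a c) x y := by
      intro z hz
      induction hz with
      | refl => intro y hy; rw [Fin.ext hy]
      | @tail c d _ h ih =>
        intro y hy
        have h' := r.inv.edge_of_rec h
        refine (ih ⟨c, h'.1⟩ rfl).tail ⟨(hE _ _).1 (by rw [hy]; exact h'.2.2), ?_⟩
        rintro rfl
        exact hb (by rw [← hy] at h; exact h)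
    exact aux y hpath y rfl
  · have hmono : BiOn (fun x y : Fin n => σ'.SymRec x y) (Set.univ : Set (Fin n)) := by
      by_cases hnt : (Set.univ : Set (Fin n)).Nontrivial
      · obtain ⟨i, hi, hr, hsub⟩ := r'.exists_subset_vertexBlock
          (H := G.toSimpleGraphInclusive) hE' hnt huniv.2.2
        rw [Set.univ_subset_iff] at hsub
        rw [← hsub]
        exact r'.biOn_vertexBlock hi hr
      · exact BiOn.of_subsingleton (Set.not_nontrivial_iff.1 hnt)
    refine hmono.mono fun x y hxy => ?_
    have hadj := r'.adj_of_symRec (H := G.toSimpleGraphInclusive) hE' x y hxy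
    have h1 : (x, y) ≠ b := by
      rintro rfl
      exact hb' hxy
    have h2 : (y, x) ≠ b := by
      rintro rfl
      exact hb' hxy.symm
    exact ⟨hadj.1, hadj.2.imp (fun h => ⟨h, h1⟩) (fun h => ⟨h, h2⟩)⟩

end Search

/-! ### Reasoning about programs

Time bounds are generous: only the order of growth matters. -/

namespace RAM

/-- Started in `s`, the program `p` halts, and `Q` holds for the time taken and the final memory. -/
def Runs (p : Prog) (s : State) (Q : ℕ → State → Prop) : Prop := ∃ t s', Exec p s t s' ∧ Q t s'

variable {p q : Prog} {s s' : State} {Q Q' : ℕ → State → Prop}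

lemma Runs.imp (h : Runs p s Q) (hQ : ∀ t s', Q t s' → Q' t s') : Runs p s Q' :=
  let ⟨t, s', h1, h2⟩ := h
  ⟨t, s', h1, hQ t s' h2⟩

lemma runs_skip : Runs .skip s Q ↔ Q 1 s := by
  constructor
  · rintro ⟨_, _, h, hQ⟩
    cases h
    exact hQ
  · exact fun h => ⟨_, _, .skip s, h⟩

lemma runs_assign {r : Reg} {e : Expr} :
    Runs (.assign r e) s Q ↔ Q (e.cost + 1) (s.setReg r (e.eval s)) := by
  constructor
  · rintro ⟨_, _, h, hQ⟩
    cases h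
    exact hQ
  · exact fun h => ⟨_, _, .assign s r e, h⟩

lemma runs_store {a : Arr} {e f g : Expr} : Runs (.store a e f g) s Q ↔
    Q (e.cost + f.cost + g.cost + 1) (s.setArr a (e.eval s) (f.eval s) (g.eval s)) := by
  constructor
  · rintro ⟨_, _, h, hQ⟩
    cases h
    exact hQ
  · exact fun h => ⟨_, _, .store s a e f g, h⟩

lemma runs_seq : Runs (.seq p q) s Q ↔
    Runs p s fun t s' => Runs q s' fun t' s'' => Q (t + t' + 1) s'' := by
  constructor
  · rintro ⟨_, _, h, hQ⟩
    cases h with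
    | seq h1 h2 => exact ⟨_, _, h1, _, _, h2, hQ⟩
  · rintro ⟨_, _, h1, _, _, h2, hQ⟩
    exact ⟨_, _, .seq h1 h2, hQ⟩

lemma runs_ite {c : Cond} : Runs (.ite c p q) s Q ↔
    (c.holds s → Runs p s fun t => Q (c.cost + t + 1)) ∧
    (¬ c.holds s → Runs q s fun t => Q (c.cost + t + 1)) := by
  constructor
  · rintro ⟨_, _, h, hQ⟩
    cases h with
    | iteTrue hc h => exact ⟨fun _ => ⟨_, _, h, hQ⟩, fun hn => absurd hc hn⟩
    | iteFalse hc h => exact ⟨fun hn => absurd hn hc, fun _ => ⟨_, _, h, hQ⟩⟩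
  · rintro ⟨h1, h2⟩
    by_cases hc : c.holds s
    · obtain ⟨_, _, h, hQ⟩ := h1 hc
      exact ⟨_, _, .iteTrue hc h, hQ⟩
    · obtain ⟨_, _, h, hQ⟩ := h2 hc
      exact ⟨_, _, .iteFalse hc h, hQ⟩

lemma runs_block_singleton : Runs (block [p]) s Q ↔ Runs p s Q := Iff.rfl

lemma runs_block_cons {l : List Prog} : Runs (block (p :: q :: l)) s Q ↔
    Runs p s fun t s' => Runs (block (q :: l)) s' fun t' s'' => Q (t + t' + 1) s'' := runs_seq

/-- Rule for loops: the measure `μ` decreases in every iteration. -/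
lemma Runs.while {c : Cond} {T : ℕ} (Inv : State → Prop) (μ : State → ℕ)
    (hstep : ∀ s, Inv s → c.holds s → Runs p s fun t s' => t ≤ T ∧ Inv s' ∧ μ s' < μ s)
    (hs : Inv s) : Runs (.while c p) s fun t s' =>
      t ≤ (μ s + 1) * (T + c.cost + 1) ∧ Inv s' ∧ ¬ c.holds s' := by
  induction hm : μ s using Nat.strong_induction_on generalizing s with
  | _ m ih =>
    by_cases hc : c.holds s
    · obtain ⟨t, s', h1, ht, hI, hlt⟩ := hstep s hs hc
      obtain ⟨t', s'', h2, ht', hI', hc'⟩ := ih _ (hm ▸ hlt) hI rfl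
      refine ⟨_, s'', .whileTrue hc h1 h2, ?_, hI', hc'⟩
      have : (μ s' + 1) * (T + c.cost + 1) ≤ m * (T + c.cost + 1) := by gcongr; omega
      rw [add_mul m 1]
      omega
    · refine ⟨_, s, .whileFalse hc, ?_, hs, hc⟩
      rw [add_mul]
      omega

/-- Rule for counting loops, with a time bound `T i` for each iteration. -/
lemma Runs.forLt_sum {r : Reg} {e : Expr} {m : ℕ} {T : ℕ → ℕ} (Inv : ℕ → State → Prop)
    (h0 : Inv 0 (s.setReg r 0)) (hm : ∀ i s', Inv i s' → e.eval s' = m)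
    (hstep : ∀ i < m, ∀ s', Inv i s' → s'.reg r = i → Runs p s' fun t s'' =>
      t ≤ T i ∧ s''.reg r = i ∧ Inv (i + 1) (s''.setReg r (i + 1))) :
    Runs (forLt r e p) s fun t s' =>
      t ≤ ∑ i ∈ Finset.range m, (T i + e.cost + 7) + e.cost + 7 ∧ s'.reg r = m ∧ Inv m s' := by
  have key : ∀ d i s, i + d = m → Inv i s → s.reg r = i →
      Runs (.while (.lt (.reg r) e) (.seq p (.assign r (.succ (.reg r))))) s fun t s' =>
        t ≤ ∑ i ∈ Finset.Ico i m, (T i + e.cost + 7) + e.cost + 3 ∧ s'.reg r = m ∧ Inv m s' := by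
    intro d
    induction d with
    | zero =>
      intro i s him hI hr
      have him : i = m := him
      subst him
      refine ⟨_, s, .whileFalse ?_, ?_, hr, hI⟩
      · simp [Cond.holds, Expr.eval, hr, hm i s hI]
      · simp only [Cond.cost, Expr.cost]
        omega
    | succ d ih =>
      intro i s him hI hr
      obtain ⟨t, s', h1, ht, hr', hI'⟩ := hstep i (by omega) s hI hr
      have h2 := Exec.assign s' r (.succ (.reg r))
      have he : Expr.eval s' (.succ (.reg r)) = i + 1 := by simp [Expr.eval, hr']
      rw [he] at h2
      obtain ⟨t', s'', h3, ht', hr'', hI''⟩ := ih (i + 1) _ (by omega) hI'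
        (by simp [State.setReg])
      refine ⟨_, s'', .whileTrue ?_ (.seq h1 h2) h3, ?_, hr'', hI''⟩
      · simp only [Cond.holds, Expr.eval, hr, hm i s hI]
        omega
      · rw [Finset.sum_eq_sum_Ico_succ_bot (by omega)]
        simp only [Cond.cost, Expr.cost]
        omega
  unfold RAM.forLt
  rw [runs_seq, runs_assign]
  refine (key m 0 _ (by omega) h0 (by simp [State.setReg])).imp ?_
  rintro t s' ⟨ht, h⟩
  refine ⟨?_, h⟩
  rw [Finset.range_eq_Ico]
  simp only [Expr.cost]
  omega

/-- Rule for counting loops. -/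
lemma Runs.forLt {r : Reg} {e : Expr} {m T : ℕ} (Inv : ℕ → State → Prop)
    (h0 : Inv 0 (s.setReg r 0)) (hm : ∀ i s', Inv i s' → e.eval s' = m)
    (hstep : ∀ i < m, ∀ s', Inv i s' → s'.reg r = i → Runs p s' fun t s'' =>
      t ≤ T ∧ s''.reg r = i ∧ Inv (i + 1) (s''.setReg r (i + 1))) :
    Runs (forLt r e p) s fun t s' =>
      t ≤ m * (T + e.cost + 7) + e.cost + 7 ∧ s'.reg r = m ∧ Inv m s' := by
  simpa using Runs.forLt_sum (T := fun _ => T) Inv h0 hm hstep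

/-- The program contains no assignment to `r`. -/
def Prog.keepsReg (r : Reg) : Prog → Bool
  | .skip => true
  | .assign r' _ => r' ≠ r
  | .store .. => true
  | .seq p q => p.keepsReg r && q.keepsReg r
  | .ite _ p q => p.keepsReg r && q.keepsReg r
  | .while _ p => p.keepsReg r

/-- The program does not write to `a`. -/
def Prog.keepsArr (a : Arr) : Prog → Bool
  | .skip => true
  | .assign .. => true
  | .store a' .. => a' ≠ a
  | .seq p q => p.keepsArr a && q.keepsArr a
  | .ite _ p q => p.keepsArr a && q.keepsArr a
  | .while _ p => p.keepsArr a

lemma Exec.reg_eq {t : ℕ} {r : Reg} (h : Exec p s t s') (hr : p.keepsReg r) :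
    s'.reg r = s.reg r := by
  induction h with
  | skip => rfl
  | assign s r' e =>
    simp only [Prog.keepsReg, decide_eq_true_eq] at hr
    simp [State.setReg, Function.update_of_ne (Ne.symm hr)]
  | store => rfl
  | seq _ _ ih1 ih2 =>
    simp only [Prog.keepsReg, Bool.and_eq_true] at hr
    rw [ih2 hr.2, ih1 hr.1]
  | iteTrue _ _ ih =>
    simp only [Prog.keepsReg, Bool.and_eq_true] at hr
    exact ih hr.1
  | iteFalse _ _ ih =>
    simp only [Prog.keepsReg, Bool.and_eq_true] at hr
    exact ih hr.2
  | whileFalse => rfl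
  | whileTrue _ _ _ ih1 ih2 => rw [ih2 hr, ih1 hr]

lemma Exec.arr_eq {t : ℕ} {a : Arr} (h : Exec p s t s') (ha : p.keepsArr a) :
    s'.arr a = s.arr a := by
  induction h with
  | skip => rfl
  | assign => rfl
  | store s a' =>
    simp only [Prog.keepsArr, decide_eq_true_eq] at ha
    simp [State.setArr, Function.update_of_ne (Ne.symm ha)]
  | seq _ _ ih1 ih2 =>
    simp only [Prog.keepsArr, Bool.and_eq_true] at ha
    rw [ih2 ha.2, ih1 ha.1]
  | iteTrue _ _ ih =>
    simp only [Prog.keepsArr, Bool.and_eq_true] at ha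
    exact ih ha.1
  | iteFalse _ _ ih =>
    simp only [Prog.keepsArr, Bool.and_eq_true] at ha
    exact ih ha.2
  | whileFalse => rfl
  | whileTrue _ _ _ ih1 ih2 => rw [ih2 ha, ih1 ha]

/-- A program changes only the registers and arrays that occur as targets in its text. -/
lemma Runs.frame (h : Runs p s Q) : Runs p s fun t s' => Q t s' ∧
    (∀ r, p.keepsReg r → s'.reg r = s.reg r) ∧ (∀ a, p.keepsArr a → s'.arr a = s.arr a) :=
  let ⟨t, s', h1, h2⟩ := h
  ⟨t, s', h1, h2, fun _ => h1.reg_eq, fun _ => h1.arr_eq⟩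

@[simp] lemma State.setReg_arr (s : State) (r : Reg) (v : ℕ) : (s.setReg r v).arr = s.arr := rfl

@[simp] lemma State.setArr_reg (s : State) (a : Arr) (i j v : ℕ) :
    (s.setArr a i j v).reg = s.reg := rfl

lemma State.setReg_reg (s : State) (r r' : Reg) (v : ℕ) :
    (s.setReg r v).reg r' = if r' = r then v else s.reg r' := by
  simp [State.setReg, Function.update_apply]

lemma State.setArr_arr (s : State) (a a' : Arr) (i j v x y : ℕ) :
    (s.setArr a i j v).arr a' x y = if a' = a ∧ x = i ∧ y = j then v else s.arr a' x y := by
  simp only [State.setArr, Function.update_apply]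
  by_cases h1 : a' = a
  · subst h1
    by_cases h2 : x = i
    · subst h2
      by_cases h3 : y = j <;> simp [h3]
    · simp [h2]
  · simp [h1]

@[simp] lemma State.setReg_self (s : State) (r : Reg) (v : ℕ) : (s.setReg r v).reg r = v := by
  simp [State.setReg_reg]

lemma State.setReg_of_ne (s : State) {r r' : Reg} (v : ℕ) (h : r' ≠ r) :
    (s.setReg r v).reg r' = s.reg r' := by
  simp [State.setReg_reg, h]

lemma State.setArr_of_ne (s : State) {a a' : Arr} (i j v : ℕ) (h : a' ≠ a) :
    (s.setArr a i j v).arr a' = s.arr a' := by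
  funext x y
  simp [State.setArr_arr, h]

@[simp] lemma State.setArr_self (s : State) (a : Arr) (i j v : ℕ) :
    (s.setArr a i j v).arr a i j = v := by
  simp [State.setArr_arr]

@[simp] lemma State.setArr_eq_self (s : State) (a : Arr) (i j : ℕ) :
    s.setArr a i j (s.arr a i j) = s := by
  simp [State.setArr]

/-! ### Loops that fill arrays -/

/-- A loop whose `i`-th iteration sets `a[i][0]` to `f i` and changes nothing else. -/
lemma Runs.fillColumn {r : Reg} {e : Expr} {a : Arr} {f : ℕ → ℕ} {m T : ℕ}
    (hm : ∀ s', (∀ r', r' ≠ r → s'.reg r' = s.reg r') → (∀ a', a' ≠ a → s'.arr a' = s.arr a') →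
      e.eval s' = m)
    (hstep : ∀ i < m, ∀ s', (∀ r', r' ≠ r → s'.reg r' = s.reg r') →
      (∀ a', a' ≠ a → s'.arr a' = s.arr a') → s'.arr a i = s.arr a i → s'.reg r = i →
      Runs p s' fun t s'' => t ≤ T ∧ s'' = s'.setArr a i 0 (f i)) :
    Runs (RAM.forLt r e p) s fun t s' => t ≤ m * (T + e.cost + 7) + e.cost + 7 ∧
      (∀ r', r' ≠ r → s'.reg r' = s.reg r') ∧ (∀ a', a' ≠ a → s'.arr a' = s.arr a') ∧
      ∀ x y, s'.arr a x y = if x < m ∧ y = 0 then f x else s.arr a x y := by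
  refine (Runs.forLt (m := m) (T := T) (fun i s' =>
    (∀ r', r' ≠ r → s'.reg r' = s.reg r') ∧ (∀ a', a' ≠ a → s'.arr a' = s.arr a') ∧
      ∀ x y, s'.arr a x y = if x < i ∧ y = 0 then f x else s.arr a x y) ?_ ?_ ?_).imp ?_
  · exact ⟨fun r' hr => by simp [State.setReg_of_ne _ _ hr], by simp, by simp⟩
  · rintro i s' ⟨h1, h2, -⟩
    exact hm s' h1 h2
  · rintro i hi s' ⟨h1, h2, h3⟩ hr
    refine (hstep i hi s' h1 h2 (by funext y; simp [h3]) hr).imp ?_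
    rintro t _ ⟨ht, rfl⟩
    refine ⟨ht, hr, fun r' hr' => ?_, fun a' ha' => ?_, fun x y => ?_⟩
    · rw [State.setReg_of_ne _ _ hr']
      exact h1 r' hr'
    · rw [State.setReg_arr, State.setArr_of_ne _ _ _ _ ha']
      exact h2 a' ha'
    · rw [State.setReg_arr, State.setArr_arr, h3]
      by_cases hx : x = i <;> by_cases hy : y = 0
      · subst hx; simp [hy]
      · simp [hy]
      · have : x < i ↔ x < i + 1 := by omega
        simp [hx, hy, this]
      · simp [hy]
  · rintro t s' ⟨ht, -, h⟩
    exact ⟨ht, h⟩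

/-- Rule for a double loop in which both counters run up to the same bound `m`. The assertion
`Inv x y` holds before the iteration for `(x, y)`. -/
lemma Runs.forLt_forLt {rx ry : Reg} {e : Expr} {m T : ℕ} (Inv : ℕ → ℕ → State → Prop)
    (hxy : rx ≠ ry) (hsx : ∀ x y s' v, Inv x y s' → Inv x y (s'.setReg rx v))
    (hsy : ∀ x y s' v, Inv x y s' → Inv x y (s'.setReg ry v)) (h0 : Inv 0 0 s)
    (hrow : ∀ x s', Inv x m s' → Inv (x + 1) 0 s')
    (hm : ∀ x y s', Inv x y s' → e.eval s' = m)
    (hstep : ∀ x < m, ∀ y < m, ∀ s', Inv x y s' → s'.reg rx = x → s'.reg ry = y →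
      Runs p s' fun t s'' => t ≤ T ∧ s''.reg rx = x ∧ s''.reg ry = y ∧ Inv x (y + 1) s'') :
    Runs (RAM.forLt rx e (RAM.forLt ry e p)) s fun t s' =>
      t ≤ m * (m * (T + e.cost + 7) + 2 * (e.cost + 7)) + e.cost + 7 ∧ Inv m 0 s' := by
  refine (Runs.forLt (m := m) (T := m * (T + e.cost + 7) + e.cost + 7)
    (fun x s' => Inv x 0 s') (hsx _ _ _ _ h0) (fun x s' h => hm x 0 s' h) ?_).imp ?_
  · intro x hx s' h hr
    refine (Runs.forLt (m := m) (T := T) (fun y s'' => Inv x y s'' ∧ s''.reg rx = x)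
      ⟨hsy _ _ _ _ h, by rw [State.setReg_of_ne _ _ hxy, hr]⟩
      (fun y s'' h => hm x y s'' h.1) ?_).imp ?_
    · rintro y hy s'' ⟨h', hr'⟩ hy'
      refine (hstep x hx y hy s'' h' hr' hy').imp ?_
      rintro t s₁ ⟨ht, hx₁, hy₁, h₁⟩
      exact ⟨ht, hy₁, hsy _ _ _ _ h₁, by rw [State.setReg_of_ne _ _ hxy, hx₁]⟩
    · rintro t s'' ⟨ht, -, h', hr'⟩
      exact ⟨ht, hr', hsx _ _ _ _ (hrow _ _ h')⟩
  · rintro t s' ⟨ht, -, h⟩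
    refine ⟨?_, h⟩
    convert ht using 4
    ring

/-- A loop over all pairs of vertices. -/
def pairLoop (rx ry : Reg) (p : Prog) : Prog :=
  forLt rx (.reg .n) (forLt ry (.reg .n) p)

/-- A loop over pairs whose iteration for `(x, y)` sets `a[x][y]` to `f x y` and changes nothing
else. -/
lemma Runs.fillSquare {rx ry : Reg} {a : Arr} {f : ℕ → ℕ → ℕ} {n T : ℕ}
    (hn : s.reg .n = n) (hx : rx ≠ .n) (hy : ry ≠ .n) (hxy : rx ≠ ry)
    (hstep : ∀ x < n, ∀ y < n, ∀ s', (∀ r', r' ≠ rx → r' ≠ ry → s'.reg r' = s.reg r') →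
      (∀ a', a' ≠ a → s'.arr a' = s.arr a') → s'.arr a x y = s.arr a x y → s'.reg rx = x →
      s'.reg ry = y → Runs p s' fun t s'' => t ≤ T ∧ s'' = s'.setArr a x y (f x y)) :
    Runs (pairLoop rx ry p) s fun t s' => t ≤ n * (n * (T + 8) + 16) + 8 ∧
      (∀ r', r' ≠ rx → r' ≠ ry → s'.reg r' = s.reg r') ∧ (∀ a', a' ≠ a → s'.arr a' = s.arr a') ∧
      ∀ x y, s'.arr a x y = if x < n ∧ y < n then f x y else s.arr a x y := by
  refine (Runs.forLt (m := n) (T := n * (T + 8) + 8) (fun i s' =>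
    (∀ r', r' ≠ rx → r' ≠ ry → s'.reg r' = s.reg r') ∧ (∀ a', a' ≠ a → s'.arr a' = s.arr a') ∧
      ∀ x y, s'.arr a x y = if x < i ∧ y < n then f x y else s.arr a x y) ?_ ?_ ?_).imp ?_
  · exact ⟨fun r' hr _ => by simp [State.setReg_of_ne _ _ hr], by simp, by simp⟩
  · rintro i s' ⟨h1, h2, -⟩
    simp [Expr.eval, h1 .n hx.symm hy.symm, hn]
  · rintro i hi s' ⟨h1, h2, h3⟩ hr
    refine (Runs.forLt (m := n) (T := T) (fun j s'' =>
      (∀ r', r' ≠ ry → s''.reg r' = s'.reg r') ∧ (∀ a', a' ≠ a → s''.arr a' = s.arr a') ∧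
        ∀ x y, s''.arr a x y = if x < i ∧ y < n ∨ x = i ∧ y < j then f x y else s.arr a x y)
        ?_ ?_ ?_).imp ?_
    · exact ⟨fun r' hr => by simp [State.setReg_of_ne _ _ hr], by simpa using h2, by simpa using h3⟩
    · rintro j s'' ⟨h1', h2', -⟩
      simp [Expr.eval, h1' .n hy.symm, h1 .n hx.symm hy.symm, hn]
    · rintro j hj s'' ⟨h1', h2', h3'⟩ hr'
      refine (hstep i hi j hj s'' (fun r' hx' hy' => (h1' r' hy').trans (h1 r' hx' hy')) h2'
        (by simp [h3']) ((h1' rx hxy).trans hr) hr').imp ?_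
      rintro t _ ⟨ht, rfl⟩
      refine ⟨ht, hr', fun r' hr' => ?_, fun a' ha' => ?_, fun x y => ?_⟩
      · rw [State.setReg_of_ne _ _ hr']
        exact h1' r' hr'
      · rw [State.setReg_arr, State.setArr_of_ne _ _ _ _ ha']
        exact h2' a' ha'
      · rw [State.setReg_arr, State.setArr_arr, h3']
        by_cases hx : x = i
        · subst hx
          by_cases hy : y = j
          · subst hy; simp
          · have : y < j ↔ y < j + 1 := by omega
            simp [hy, this]
        · simp [hx]
    · rintro t s'' ⟨ht, -, h1', h2', h3'⟩
      refine ⟨by simpa [Expr.cost, add_assoc] using ht, (h1' rx hxy).trans hr,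
        fun r' hx' hy' => ?_, ?_, fun x y => ?_⟩
      · rw [State.setReg_of_ne _ _ hx', h1' r' hy', h1 r' hx' hy']
      · simpa using h2'
      · rw [State.setReg_arr, h3']
        have : (x < i ∧ y < n ∨ x = i ∧ y < n) ↔ (x < i + 1 ∧ y < n) := by omega
        simp [this]
  · rintro t s' ⟨ht, -, h⟩
    refine ⟨?_, h⟩
    simpa [Expr.cost, add_assoc] using ht

end RAM

/-! ### The search as a program -/

namespace RAM

/-- `r := v` for some vertex `v` that satisfies `c`, where the candidate is in `tmp 3`; if there is
none, then `r := n`. -/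
def findVertex (r : Reg) (c : Cond) : Prog :=
  .seq (.assign r (.reg .n))
    (forLt (.tmp 3) (.reg .n) (.ite c (.assign r (.reg (.tmp 3))) .skip))

lemma runs_findVertex {s : State} {n : ℕ} {r : Reg} {c : Cond} {P : ℕ → Prop} (hn : s.reg .n = n)
    (hrn : r ≠ .n) (hr : r ≠ .tmp 3)
    (hc : ∀ i < n, ∀ s' : State, s'.arr = s.arr →
      (∀ q, q ≠ r → q ≠ .tmp 3 → s'.reg q = s.reg q) → s'.reg (.tmp 3) = i → (c.holds s' ↔ P i)) :
    Runs (findVertex r c) s fun t s' => t ≤ n * (c.cost + 11) + 11 ∧ s'.arr = s.arr ∧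
      (∀ q, q ≠ r → q ≠ .tmp 3 → s'.reg q = s.reg q) ∧
      ((s'.reg r = n ∧ ∀ v < n, ¬ P v) ∨ (s'.reg r < n ∧ P (s'.reg r))) := by
  rw [findVertex, runs_seq, runs_assign]
  refine (Runs.forLt (m := n) (T := c.cost + 3) (fun i s' => s'.arr = s.arr ∧
      (∀ q, q ≠ r → q ≠ .tmp 3 → s'.reg q = s.reg q) ∧
      ((s'.reg r = n ∧ ∀ v < i, ¬ P v) ∨ (s'.reg r < n ∧ P (s'.reg r)))) ?_ ?_ ?_).imp ?_
  · refine ⟨rfl, fun q h1 h2 => ?_, Or.inl ⟨?_, by simp⟩⟩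
    · rw [State.setReg_of_ne _ _ h2, State.setReg_of_ne _ _ h1]
    · rw [State.setReg_of_ne _ _ hr, State.setReg_self]
      exact hn
  · rintro i s' ⟨-, h, -⟩
    simp [Expr.eval, h .n hrn.symm, hn]
  · rintro i hi s' ⟨h1, h2, h3⟩ hri
    rw [runs_ite, hc i hi s' h1 h2 hri]
    refine ⟨fun hP => ?_, fun hP => ?_⟩
    · rw [runs_assign]
      refine ⟨by simp [Expr.cost], ?_, h1, fun q hq1 hq2 => ?_, Or.inr ?_⟩
      · rw [State.setReg_of_ne _ _ hr.symm, hri]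
      · rw [State.setReg_of_ne _ _ hq2, State.setReg_of_ne _ _ hq1]
        exact h2 q hq1 hq2
      · rw [State.setReg_of_ne _ _ hr, State.setReg_self]
        simp only [Expr.eval, hri]
        exact ⟨hi, hP⟩
    · rw [runs_skip]
      refine ⟨by omega, hri, h1, fun q hq1 hq2 => ?_, ?_⟩
      · rw [State.setReg_of_ne _ _ hq2]
        exact h2 q hq1 hq2
      · rw [State.setReg_of_ne _ _ hr]
        refine h3.imp (fun h => ⟨h.1, fun v hv => ?_⟩) fun h => h
        rcases Nat.lt_succ_iff_lt_or_eq.1 hv with h' | rfl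
        · exact h.2 v h'
        · exact hP
  · rintro t s' ⟨ht, -, h⟩
    refine ⟨?_, h⟩
    simp only [Expr.cost] at *
    have : n * (c.cost + 3 + 1 + 7) = n * (c.cost + 11) := by ring
    omega

/-! The search uses the registers `tmp 0`, …, `tmp 7` for the number of levels, the vertices `u` and
`w`, a loop variable, the numbers of finished classes and of recorded edges, the target level, and a
flag that is `1` until the search is finished. The arrays `tmp 0`, …, `tmp 7` hold the adjacency
matrix and the functions `lev`, `done`, `exh`, `rt`, `root`, `lu`, `lw`. -/

/-- The entry `a[r][0]`. -/
abbrev entry (a : Arr) (r : Reg) : Expr := .get a (.reg r) (.const 0)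

/-- The state of the search that is represented in the memory. -/
def State.toSearch (s : State) : Search where
  k := s.reg (.tmp 0)
  id := s.reg (.tmp 4)
  cnt := s.reg (.tmp 5)
  lev v := s.arr (.tmp 1) v 0
  done v := s.arr (.tmp 2) v 0
  exh v := s.arr (.tmp 3) v 0
  rt v := s.arr (.tmp 4) v 0
  root v := s.arr (.tmp 5) v 0
  lu v := s.arr (.tmp 6) v 0
  lw v := s.arr (.tmp 7) v 0

/-- The step `Search.start`, for the vertex in the register `tmp 1`. -/
def startProg : Prog :=
  block
    [ .assign (.tmp 0) (.const 1),
      .store (.tmp 1) (.reg (.tmp 1)) (.const 0) (.const 1),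
      .store (.tmp 4) (.const 1) (.const 0) (.reg .n) ]

/-- The step `Search.pop`. -/
def popProg : Prog :=
  block
    [ forLt (.tmp 3) (.reg .n)
        (.ite (.and (.eq (entry (.tmp 1) (.tmp 3)) (.reg (.tmp 0)))
            (.eq (entry (.tmp 2) (.tmp 3)) (.const 0)))
          (.store (.tmp 2) (.reg (.tmp 3)) (.const 0) (.succ (.reg (.tmp 4))))
          .skip),
      .store (.tmp 5) (.reg (.tmp 4)) (.const 0) (entry (.tmp 4) (.tmp 0)),
      .assign (.tmp 4) (.succ (.reg (.tmp 4))),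
      .assign (.tmp 0) (.pred (.reg (.tmp 0))) ]

/-- Append the edge from `tmp 1` to `tmp 2` to the recorded edges. -/
def recordProg : Prog :=
  block
    [ .store (.tmp 6) (.reg (.tmp 5)) (.const 0) (.reg (.tmp 1)),
      .store (.tmp 7) (.reg (.tmp 5)) (.const 0) (.reg (.tmp 2)),
      .assign (.tmp 5) (.succ (.reg (.tmp 5))) ]

/-- The step `Search.push`, for the edge from `tmp 1` to `tmp 2`; the new level hangs at the vertex
given by `e`. -/
def pushProg (e : Expr) : Prog :=
  block
    [ recordProg,
      .assign (.tmp 0) (.succ (.reg (.tmp 0))),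
      .store (.tmp 1) (.reg (.tmp 2)) (.const 0) (.reg (.tmp 0)),
      .store (.tmp 4) (.reg (.tmp 0)) (.const 0) e ]

/-- The step `Search.merge`, for the edge from `tmp 1` to `tmp 2`. -/
def mergeProg : Prog :=
  block
    [ recordProg,
      .assign (.tmp 6) (entry (.tmp 1) (.tmp 2)),
      .ite (.eq (.get (.tmp 4) (.succ (.reg (.tmp 6))) (.const 0)) (.reg (.tmp 2)))
        (.assign (.tmp 6) (.succ (.reg (.tmp 6))))
        .skip,
      forLt (.tmp 3) (.reg .n)
        (.ite (.and (.eq (entry (.tmp 2) (.tmp 3)) (.const 0))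
            (.lt (.reg (.tmp 6)) (entry (.tmp 1) (.tmp 3))))
          (.store (.tmp 1) (.reg (.tmp 3)) (.const 0) (.reg (.tmp 6)))
          .skip),
      .assign (.tmp 0) (.reg (.tmp 6)) ]

/-- One step of the search. A new level hangs at the vertex given by `e`. -/
def stepProg (e : Expr) : Prog :=
  .seq
    (findVertex (.tmp 1)
      (.and (.eq (entry (.tmp 1) (.tmp 3)) (.reg (.tmp 0)))
        (.and (.eq (entry (.tmp 3) (.tmp 3)) (.const 0))
          (.eq (entry (.tmp 2) (.tmp 3)) (.const 0)))))
    (.ite (.eq (.reg (.tmp 1)) (.reg .n))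
      (.ite (.eq (.reg (.tmp 0)) (.const 0)) (.assign (.tmp 7) (.const 0)) popProg)
      (.ite (.eq (.reg (.tmp 0)) (.const 0)) startProg
        (.seq
          (findVertex (.tmp 2)
            (.and (.eq (.get (.tmp 0) (.reg (.tmp 1)) (.reg (.tmp 3))) (.const 1))
              (.and (.not (.eq (entry (.tmp 1) (.tmp 3)) (.reg (.tmp 0))))
                (.and (.eq (entry (.tmp 2) (.tmp 3)) (.const 0))
                  (.not (.eq (.reg (.tmp 3)) (entry (.tmp 4) (.tmp 0))))))))
          (.ite (.eq (.reg (.tmp 2)) (.reg .n))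
            (.store (.tmp 3) (.reg (.tmp 1)) (.const 0) (.const 1))
            (.ite (.eq (entry (.tmp 1) (.tmp 2)) (.const 0)) (pushProg e) mergeProg)))))

/-- The vertex at which a new level hangs: `u` in the search for blocks, and `n`, for none, in the
search for strongly connected components. -/
def hangExpr (b : Bool) : Expr := if b then .reg (.tmp 1) else .reg .n

/-- The search on the graph with the adjacency matrix in `tmp 0`. -/
def searchProg (b : Bool) : Prog :=
  block
    [ forLt (.tmp 3) (.reg .n) (.store (.tmp 1) (.reg (.tmp 3)) (.const 0) (.const 0)),
      forLt (.tmp 3) (.reg .n) (.store (.tmp 2) (.reg (.tmp 3)) (.const 0) (.const 0)),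
      forLt (.tmp 3) (.reg .n) (.store (.tmp 3) (.reg (.tmp 3)) (.const 0) (.const 0)),
      .assign (.tmp 0) (.const 0),
      .assign (.tmp 4) (.const 0),
      .assign (.tmp 5) (.const 0),
      .assign (.tmp 7) (.const 1),
      .while (.eq (.reg (.tmp 7)) (.const 1)) (stepProg (hangExpr b)) ]

lemma _root_.Search.ext_of_forall {σ τ : Search} (h1 : σ.k = τ.k) (h2 : σ.id = τ.id)
    (h3 : σ.cnt = τ.cnt) (h4 : ∀ v, σ.lev v = τ.lev v) (h5 : ∀ v, σ.done v = τ.done v)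
    (h6 : ∀ v, σ.exh v = τ.exh v)
    (h7 : ∀ v, σ.rt v = τ.rt v) (h8 : ∀ v, σ.root v = τ.root v) (h9 : ∀ v, σ.lu v = τ.lu v)
    (h10 : ∀ v, σ.lw v = τ.lw v) : σ = τ := by
  cases σ
  cases τ
  simp only [Search.mk.injEq]
  exact ⟨h1, h2, h3, funext h4, funext h5, funext h6, funext h7, funext h8, funext h9, funext h10⟩

variable {s : State} {n : ℕ}

lemma runs_startProg (hn : s.reg .n = n) : Runs startProg s fun t s' =>
    t ≤ 20 ∧ s'.toSearch = s.toSearch.start n (s.reg (.tmp 1)) := by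
  simp only [startProg, runs_block_cons, runs_block_singleton, runs_assign, runs_store]
  refine ⟨by simp [Expr.cost], ?_⟩
  apply Search.ext_of_forall <;>
    simp [State.toSearch, Search.start, Expr.eval, State.setReg_reg, State.setArr_arr,
      Function.update_apply, hn]

lemma runs_popProg (hn : s.reg .n = n) : Runs popProg s fun t s' =>
    t ≤ 40 * n + 40 ∧ s'.toSearch = s.toSearch.pop n := by
  rw [popProg, runs_block_cons]
  refine (Runs.fillColumn (a := .tmp 2) (m := n) (T := 20)
    (f := fun v => if s.arr (.tmp 1) v 0 = s.reg (.tmp 0) ∧ s.arr (.tmp 2) v 0 = 0 then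
      s.reg (.tmp 4) + 1 else s.arr (.tmp 2) v 0) ?_ ?_).imp ?_
  · intro s' h1 _
    simp [Expr.eval, h1, hn]
  · intro i hi s' h1 h2 h3 h4
    rw [runs_ite, runs_store, runs_skip]
    simp only [Cond.holds, Cond.cost, Expr.eval, Expr.cost, h4, h3, h2 (.tmp 1) (by decide),
      h1 (.tmp 0) (by decide), h1 (.tmp 4) (by decide)]
    refine ⟨fun hc => ⟨by omega, ?_⟩, fun hc => ⟨by omega, ?_⟩⟩
    · rw [if_pos hc]
    · rw [if_neg hc, ← h3, State.setArr_eq_self]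
  · rintro t s' ⟨ht, h1, h2, h3⟩
    simp only [runs_block_cons, runs_block_singleton, runs_assign, runs_store]
    refine ⟨by simp only [Expr.cost] at *; omega, ?_⟩
    apply Search.ext_of_forall <;>
      simp [State.toSearch, Search.pop, Expr.eval, State.setReg_reg, State.setArr_arr,
        Function.update_apply, h1, h2, h3]
    intro v
    grind

lemma runs_pushProg {b : Bool} (hn : s.reg .n = n) :
    Runs (pushProg (hangExpr b)) s fun t s' =>
      t ≤ 40 ∧ s'.toSearch = s.toSearch.push n b (s.reg (.tmp 1)) (s.reg (.tmp 2)) := by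
  have hcost : (hangExpr b).cost = 1 := by cases b <;> rfl
  simp only [pushProg, recordProg, runs_block_cons, runs_block_singleton, runs_assign, runs_store]
  refine ⟨by simp [Expr.cost, hcost], ?_⟩
  apply Search.ext_of_forall <;> cases b <;>
    simp [State.toSearch, Search.push, Expr.eval, State.setReg_reg, State.setArr_arr,
      Function.update_apply, hn, hangExpr]

lemma runs_mergeProg (hn : s.reg .n = n) : Runs mergeProg s fun t s' =>
    t ≤ 40 * n + 60 ∧ s'.toSearch = s.toSearch.merge n (s.reg (.tmp 1)) (s.reg (.tmp 2)) := by
  have hrec : Runs recordProg s fun t s' => t ≤ 20 ∧ s'.toSearch =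
      { s.toSearch with
        cnt := s.reg (.tmp 5) + 1
        lu := Function.update s.toSearch.lu (s.reg (.tmp 5)) (s.reg (.tmp 1))
        lw := Function.update s.toSearch.lw (s.reg (.tmp 5)) (s.reg (.tmp 2)) } ∧
      s'.reg (.tmp 2) = s.reg (.tmp 2) ∧ s'.reg .n = n := by
    simp only [recordProg, runs_block_cons, runs_block_singleton, runs_assign, runs_store]
    refine ⟨by simp [Expr.cost], ?_, ?_, ?_⟩
    · apply Search.ext_of_forall <;>
        simp [State.toSearch, Expr.eval, State.setReg_reg, State.setArr_arr, Function.update_apply]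
    · simp [State.setReg_reg]
    · simp [State.setReg_reg, hn]
  rw [mergeProg, runs_block_cons]
  refine hrec.imp ?_
  rintro t₁ s₁ ⟨ht₁, hs₁, hw, hn₁⟩
  have htgt : Runs (.seq (.assign (.tmp 6) (entry (.tmp 1) (.tmp 2)))
      (.ite (.eq (.get (.tmp 4) (.succ (.reg (.tmp 6))) (.const 0)) (.reg (.tmp 2)))
        (.assign (.tmp 6) (.succ (.reg (.tmp 6)))) .skip)) s₁ fun t s' => t ≤ 20 ∧
      s'.toSearch = s₁.toSearch ∧ s'.reg .n = n ∧
      s'.reg (.tmp 6) = s.toSearch.target (s.reg (.tmp 2)) := by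
    have hlev : ∀ v, s₁.arr (.tmp 1) v 0 = s.toSearch.lev v := fun v => by
      change s₁.toSearch.lev v = _
      rw [hs₁]
    have hrt : ∀ v, s₁.arr (.tmp 4) v 0 = s.toSearch.rt v := fun v => by
      change s₁.toSearch.rt v = _
      rw [hs₁]
    simp only [runs_seq, runs_assign, runs_ite, runs_skip]
    simp only [Cond.holds, Expr.eval, State.setReg_reg, State.setReg_arr, Cond.cost, Expr.cost,
      hlev, hrt, hw, Search.target]
    refine ⟨fun hc => ⟨by omega, ?_, ?_, ?_⟩, fun hc => ⟨by omega, ?_, ?_, ?_⟩⟩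
    · apply Search.ext_of_forall <;> simp [State.toSearch, State.setReg_reg]
    · simp [hn₁]
    · simp at hc
      simp [hc]
    · apply Search.ext_of_forall <;> simp [State.toSearch, State.setReg_reg]
    · simp [hn₁]
    · simp at hc
      simp [hc]
  rw [runs_block_cons]
  obtain ⟨t₂, s₂, hex, ht₂, hs₂, hn₂, hj⟩ := htgt
  cases hex with
  | @seq _ _ _ s₃ _ t₃ t₄ hex₁ hex₂ =>
  refine ⟨_, _, hex₁, runs_block_cons.2 ⟨_, _, hex₂, runs_block_cons.2 ?_⟩⟩
  refine (Runs.fillColumn (a := .tmp 1) (m := n) (T := 20)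
    (f := fun v => if s₂.arr (.tmp 2) v 0 = 0 ∧ s₂.reg (.tmp 6) < s₂.arr (.tmp 1) v 0 then
      s₂.reg (.tmp 6) else s₂.arr (.tmp 1) v 0) ?_ ?_).imp ?_
  · intro s' h1 _
    simp [Expr.eval, h1, hn₂]
  · intro i hi s' h1 h2 h3 h4
    rw [runs_ite, runs_store, runs_skip]
    simp only [Cond.holds, Cond.cost, Expr.eval, Expr.cost, h4, h3, h2 (.tmp 2) (by decide),
      h1 (.tmp 6) (by decide)]
    refine ⟨fun hc => ⟨by omega, ?_⟩, fun hc => ⟨by omega, ?_⟩⟩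
    · rw [if_pos hc]
    · rw [if_neg hc, ← h3, State.setArr_eq_self]
  · rintro t s' ⟨ht, h1, h2, h3⟩
    simp only [runs_block_singleton, runs_assign]
    refine ⟨by simp only [Expr.cost] at *; omega, ?_⟩
    have hσ : s₂.toSearch = _ := hs₂.trans hs₁
    have hτ : (s'.setReg (.tmp 0) (s'.reg (.tmp 6))).toSearch =
        { s₂.toSearch with
          k := s₂.reg (.tmp 6)
          lev := fun v => if v < n ∧ s₂.toSearch.done v = 0 ∧ s₂.reg (.tmp 6) < s₂.toSearch.lev v
            then s₂.reg (.tmp 6) else s₂.toSearch.lev v } := by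
      apply Search.ext_of_forall <;> simp [State.toSearch, State.setReg_reg, h1, h2, h3]
      intro v
      grind
    simp only [Expr.eval]
    rw [hτ, hσ, hj]
    rfl

lemma toSearch_congr {s s' : State} (h0 : s'.reg (.tmp 0) = s.reg (.tmp 0))
    (h4 : s'.reg (.tmp 4) = s.reg (.tmp 4)) (h5 : s'.reg (.tmp 5) = s.reg (.tmp 5))
    (ha : s'.arr = s.arr) : s'.toSearch = s.toSearch := by
  simp [State.toSearch, h0, h4, h5, ha]

/-- The adjacency relation of the matrix in the array `tmp 0`. -/
def State.Edge (s : State) (u w : ℕ) : Prop := s.arr (.tmp 0) u w = 1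

lemma runs_stepProg {b : Bool} (hn : s.reg .n = n) :
    Runs (stepProg (hangExpr b)) s fun t s' => t ≤ 200 * n + 200 ∧
      ((s'.reg (.tmp 7) = s.reg (.tmp 7) ∧ s.toSearch.Step n s.Edge b s'.toSearch) ∨
        (s'.reg (.tmp 7) = 0 ∧ s'.toSearch = s.toSearch ∧ s.toSearch.Final n)) := by
  rw [stepProg, runs_seq]
  refine (runs_findVertex (P := fun u => s.toSearch.lev u = s.toSearch.k ∧
    s.toSearch.exh u = 0 ∧ s.toSearch.done u = 0) hn (by decide) (by decide) ?_).imp ?_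
  · intro i hi s' h1 h2 h3
    simp only [Cond.holds, Expr.eval, h3, h1, h2 (.tmp 0) (by decide) (by decide)]
    rfl
  rintro t₁ s₁ ⟨ht₁, ha₁, hr₁, hu⟩
  have hσ₁ : s₁.toSearch = s.toSearch := toSearch_congr (hr₁ _ (by decide) (by decide))
    (hr₁ _ (by decide) (by decide)) (hr₁ _ (by decide) (by decide)) ha₁
  have hn₁ : s₁.reg .n = n := (hr₁ .n (by decide) (by decide)).trans hn
  have hgo₁ : s₁.reg (.tmp 7) = s.reg (.tmp 7) := hr₁ _ (by decide) (by decide)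
  have hk₁ : s₁.reg (.tmp 0) = s.toSearch.k := hr₁ _ (by decide) (by decide)
  simp only [Cond.cost, Expr.cost] at ht₁
  rw [runs_ite]
  simp only [Cond.holds, Expr.eval, hn₁, Cond.cost, Expr.cost]
  refine ⟨fun huv => ?_, fun huv => ?_⟩
  · -- There is no open vertex.
    have hno : ∀ u, ¬ s.toSearch.Open n u := by
      rintro u ⟨h1, h2, h3, h4⟩
      rcases hu with hu | hu
      · exact hu.2 u h1 ⟨h2, h3, h4⟩
      · omega
    rw [runs_ite]
    simp only [Cond.holds, Expr.eval, hk₁, Cond.cost, Expr.cost]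
    refine ⟨fun hk => ?_, fun hk => ?_⟩
    · rw [runs_assign]
      refine ⟨by simp only [Expr.cost]; omega, Or.inr ⟨by simp [Expr.eval], ?_, hk, hno⟩⟩
      rw [← hσ₁]
      exact toSearch_congr (State.setReg_of_ne _ _ (by decide))
        (State.setReg_of_ne _ _ (by decide)) (State.setReg_of_ne _ _ (by decide)) rfl
    · refine (runs_popProg hn₁).frame.imp ?_
      rintro t₂ s₂ ⟨⟨ht₂, hσ₂⟩, hf, -⟩
      refine ⟨by omega, Or.inl ⟨(hf _ rfl).trans hgo₁, ?_⟩⟩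
      rw [hσ₂, hσ₁]
      exact .pop (Nat.pos_of_ne_zero hk) hno
  · have hopen : s.toSearch.Open n (s₁.reg (.tmp 1)) := by
      rcases hu with hu | hu
      · exact absurd hu.1 huv
      · exact hu
    rw [runs_ite]
    simp only [Cond.holds, Expr.eval, hk₁, Cond.cost, Expr.cost]
    refine ⟨fun hk => ?_, fun hk => ?_⟩
    · refine (runs_startProg hn₁).frame.imp ?_
      rintro t₂ s₂ ⟨⟨ht₂, hσ₂⟩, hf, -⟩
      refine ⟨by omega, Or.inl ⟨(hf _ rfl).trans hgo₁, ?_⟩⟩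
      rw [hσ₂, hσ₁]
      exact .start _ hk hopen
    rw [runs_seq]
    refine (runs_findVertex (P := fun w => s.Edge (s₁.reg (.tmp 1)) w ∧
      s.toSearch.lev w ≠ s.toSearch.k ∧ s.toSearch.done w = 0 ∧
      w ≠ s.toSearch.rt s.toSearch.k) hn₁ (by decide) (by decide) ?_).imp ?_
    · intro i hi s' h1 h2 h3
      simp only [Cond.holds, Expr.eval, h3, h1, ha₁, h2 (.tmp 0) (by decide) (by decide),
        h2 (.tmp 1) (by decide) (by decide), hk₁]
      rfl
    rintro t₂ s₂ ⟨ht₂, ha₂, hr₂, hw⟩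
    have hσ₂ : s₂.toSearch = s.toSearch := hσ₁ ▸ toSearch_congr (hr₂ _ (by decide) (by decide))
      (hr₂ _ (by decide) (by decide)) (hr₂ _ (by decide) (by decide)) ha₂
    have hn₂ : s₂.reg .n = n := (hr₂ .n (by decide) (by decide)).trans hn₁
    have hgo₂ : s₂.reg (.tmp 7) = s.reg (.tmp 7) := (hr₂ _ (by decide) (by decide)).trans hgo₁
    have hu₂ : s₂.reg (.tmp 1) = s₁.reg (.tmp 1) := hr₂ _ (by decide) (by decide)
    simp only [Cond.cost, Expr.cost] at ht₂
    have hk' := Nat.pos_of_ne_zero hk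
    rw [runs_ite]
    simp only [Cond.holds, Expr.eval, hn₂, Cond.cost, Expr.cost]
    refine ⟨fun hwv => ?_, fun hwv => ?_⟩
    · have hno : ∀ w, ¬ s.toSearch.Leads n s.Edge (s₁.reg (.tmp 1)) w := by
        rintro w ⟨h1, h2, h3, h4, h5⟩
        rcases hw with hw | hw
        · exact hw.2 w h1 ⟨h2, h3, h4, h5⟩
        · omega
      rw [runs_store]
      refine ⟨by simp only [Expr.cost]; omega, Or.inl ⟨hgo₂, ?_⟩⟩
      have : ∀ s' : State, s'.toSearch = s₂.toSearch.exhaust (s₁.reg (.tmp 1)) →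
          s.toSearch.Step n s.Edge b s'.toSearch := by
        intro s' hs'
        rw [hs', hσ₂]
        exact .exhaust _ hk' hopen hno
      apply this
      apply Search.ext_of_forall <;>
        simp [State.toSearch, Search.exhaust, Expr.eval, State.setArr_arr, Function.update_apply,
          hu₂]
    · have hleads : s.toSearch.Leads n s.Edge (s₁.reg (.tmp 1)) (s₂.reg (.tmp 2)) := by
        rcases hw with hw | hw
        · exact absurd hw.1 hwv
        · exact hw
      have hlev : s₂.arr (.tmp 1) (s₂.reg (.tmp 2)) 0 = s.toSearch.lev (s₂.reg (.tmp 2)) := by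
        rw [← hσ₂]
        rfl
      rw [runs_ite]
      simp only [Cond.holds, Expr.eval, hlev, Cond.cost, Expr.cost]
      refine ⟨fun hl => ?_, fun hl => ?_⟩
      · refine (runs_pushProg hn₂).frame.imp ?_
        rintro t₃ s₃ ⟨⟨ht₃, hσ₃⟩, hf, -⟩
        refine ⟨by omega, Or.inl ⟨(hf _ rfl).trans hgo₂, ?_⟩⟩
        rw [hσ₃, hσ₂, hu₂]
        exact .push _ _ hk' hopen hleads hl
      · refine (runs_mergeProg hn₂).frame.imp ?_
        rintro t₃ s₃ ⟨⟨ht₃, hσ₃⟩, hf, -⟩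
        refine ⟨by omega, Or.inl ⟨(hf _ rfl).trans hgo₂, ?_⟩⟩
        rw [hσ₃, hσ₂, hu₂]
        exact .merge _ _ hk' hopen hleads hl

end RAM

namespace RAM

variable {s : State} {n : ℕ}

/-- The search halts in quadratic time: the potential is at most `3 n` in the beginning. The
mode-specific part of the invariant is a parameter. -/
lemma runs_searchProg {b : Bool} {I : Search → Prop} (hn : s.reg .n = n) (h1 : 1 ≤ n)
    (hI0 : ∀ σ : Search, σ.Initial n → I σ)
    (hI : ∀ σ τ : Search, σ.Inv n s.Edge b → I σ → σ.Step n s.Edge b τ → I τ) :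
    Runs (searchProg b) s fun t s' => t ≤ 5000 * n ^ 2 ∧ s'.toSearch.Inv n s.Edge b ∧
      I s'.toSearch ∧ s'.toSearch.Final n ∧ s'.reg (.tmp 5) ≤ 3 * n := by
  have hfill : ∀ (a : Arr) (s : State), s.reg .n = n →
      Runs (forLt (.tmp 3) (.reg .n) (.store a (.reg (.tmp 3)) (.const 0) (.const 0))) s
        fun t s' => t ≤ 20 * n + 20 ∧ s'.reg .n = n ∧ (∀ a', a' ≠ a → s'.arr a' = s.arr a') ∧
          ∀ v < n, s'.arr a v 0 = 0 := by
    intro a s hn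
    refine (Runs.fillColumn (a := a) (m := n) (T := 4) (f := fun _ => 0) ?_ ?_).imp ?_
    · intro s' h1 _
      simp [Expr.eval, h1, hn]
    · intro i hi s' h1 h2 h3 h4
      rw [runs_store]
      simp [Expr.cost, Expr.eval, h4]
    · rintro t s' ⟨ht, h1, h2, h3⟩
      refine ⟨by simp only [Expr.cost] at *; omega, (h1 _ (by decide)).trans hn, h2, ?_⟩
      intro v hv
      simp [h3, hv]
  rw [searchProg, runs_block_cons]
  refine (hfill (.tmp 1) s hn).imp ?_
  rintro t₁ s₁ ⟨ht₁, hn₁, ha₁, hz₁⟩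
  rw [runs_block_cons]
  refine (hfill (.tmp 2) s₁ hn₁).imp ?_
  rintro t₂ s₂ ⟨ht₂, hn₂, ha₂, hz₂⟩
  rw [runs_block_cons]
  refine (hfill (.tmp 3) s₂ hn₂).imp ?_
  rintro t₃ s₃ ⟨ht₃, hn₃, ha₃, hz₃⟩
  simp only [runs_block_cons, runs_block_singleton, runs_assign, Expr.eval]
  set s₄ := (((s₃.setReg (.tmp 0) 0).setReg (.tmp 4) 0).setReg (.tmp 5) 0).setReg (.tmp 7) 1
    with hs₄
  have hA₄ : s₄.arr (.tmp 0) = s.arr (.tmp 0) := by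
    rw [← ha₁ _ (by decide), ← ha₂ _ (by decide), ← ha₃ _ (by decide)]
    rfl
  have hinit : s₄.toSearch.Initial n := by
    refine ⟨by simp [State.toSearch, hs₄, State.setReg_reg],
      by simp [State.toSearch, hs₄, State.setReg_reg],
      by simp [State.toSearch, hs₄, State.setReg_reg], fun v hv => ⟨?_, ?_, hz₃ v hv⟩⟩
    · change s₃.arr (.tmp 1) v 0 = 0
      rw [ha₃ _ (by decide), ha₂ _ (by decide), hz₁ v hv]
    · change s₃.arr (.tmp 2) v 0 = 0
      rw [ha₃ _ (by decide), hz₂ v hv]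
  have hcnt₄ : s₄.reg (.tmp 5) = 0 := by simp [hs₄, State.setReg_reg]
  have hgo₄ : s₄.reg (.tmp 7) = 1 := by simp [hs₄]
  have hpot₄ : s₄.toSearch.potential n ≤ 3 * n := by
    have h1 := Search.count_le n fun v => s₄.toSearch.lev v = 0 ∧ s₄.toSearch.done v = 0
    have h2 := Search.count_le n fun v => s₄.toSearch.exh v = 0
    have h3 := hinit.k
    unfold Search.potential
    omega
  refine (Runs.while (T := 200 * n + 200) (fun s' => s'.reg .n = n ∧
      s'.arr (.tmp 0) = s.arr (.tmp 0) ∧ s'.toSearch.Inv n s.Edge b ∧ I s'.toSearch ∧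
      s'.reg (.tmp 5) + s'.toSearch.potential n ≤ 3 * n ∧
      (s'.reg (.tmp 7) = 1 ∨ s'.toSearch.Final n))
    (fun s' => s'.toSearch.potential n + s'.reg (.tmp 7)) ?_ ?_).imp ?_
  · rintro s' ⟨hn', ha', hinv, hI', hpot, -⟩ hc
    simp only [Cond.holds, Expr.eval] at hc
    refine (runs_stepProg (b := b) hn').frame.imp ?_
    have hE : s'.Edge = s.Edge := by
      funext u w
      simp [State.Edge, ha']
    have hkeep : (stepProg (hangExpr b)).keepsReg .n = true ∧
      (stepProg (hangExpr b)).keepsArr (.tmp 0) = true := ⟨rfl, rfl⟩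
    rintro t s'' ⟨⟨ht, hstep⟩, hfr, hfa⟩
    rw [hE] at hstep
    refine ⟨ht, ⟨(hfr _ hkeep.1).trans hn', (hfa _ hkeep.2).trans ha', ?_⟩, ?_⟩
    · rcases hstep with ⟨h1, h2⟩ | ⟨h1, h2, h3⟩
      · have := hinv.potential_lt h2
        have e1 : s''.toSearch.cnt = s''.reg (.tmp 5) := rfl
        have e2 : s'.toSearch.cnt = s'.reg (.tmp 5) := rfl
        exact ⟨hinv.step h2, hI _ _ hinv hI' h2, by omega, Or.inl (h1.trans hc)⟩
      · have e1 : s''.toSearch.cnt = s''.reg (.tmp 5) := rfl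
        have e2 : s'.toSearch.cnt = s'.reg (.tmp 5) := rfl
        rw [h2]
        exact ⟨hinv, hI', by rw [← e1, h2, e2]; exact hpot, Or.inr h3⟩
    · rcases hstep with ⟨h1, h2⟩ | ⟨h1, h2, h3⟩
      · have := hinv.potential_lt h2
        omega
      · rw [h2]
        omega
  · refine ⟨by simp [hs₄, State.setReg_reg, hn₃], hA₄, hinit.inv, hI0 _ hinit, ?_, Or.inl hgo₄⟩
    omega
  · rintro t s' ⟨ht, ⟨hn', ha', hinv, hI', hpot, hfin⟩, hc⟩
    simp only [Cond.holds, Expr.eval] at hc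
    refine ⟨?_, hinv, hI', hfin.resolve_left hc, by omega⟩
    rw [hgo₄] at ht
    simp only [Cond.cost, Expr.cost] at *
    have h2 : (s₄.toSearch.potential n + 1 + 1) * (200 * n + 200 + (1 + 1 + 1) + 1) ≤
        (5 * n) * (404 * n) := by
      gcongr <;> omega
    nlinarith

lemma runs_searchProg_scc (hn : s.reg .n = n) (h1 : 1 ≤ n) :
    Runs (searchProg false) s fun t s' => t ≤ 5000 * n ^ 2 ∧
      s'.toSearch.SccResult n s.Edge ∧ s'.reg (.tmp 5) ≤ 3 * n :=
  (runs_searchProg (I := Search.SccInv n) hn h1 (fun _ h => h.sccInv)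
    fun _ _ h h' hs => Search.SccInv.step h h' hs).imp
    fun _ _ h => ⟨h.1, ⟨h.2.1, h.2.2.1, h.2.2.2.1⟩, h.2.2.2.2⟩

lemma runs_searchProg_bcc (hn : s.reg .n = n) (h1 : 1 ≤ n) :
    Runs (searchProg true) s fun t s' => t ≤ 5000 * n ^ 2 ∧
      s'.toSearch.BccResult n s.Edge ∧ s'.reg (.tmp 5) ≤ 3 * n :=
  (runs_searchProg (I := Search.BccInv n) hn h1 (fun _ h => h.bccInv)
    fun _ _ h h' hs => Search.BccInv.step h h' hs).imp
    fun _ _ h => ⟨h.1, ⟨h.2.1, h.2.2.1, h.2.2.2.1⟩, h.2.2.2.2⟩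

/-! ### Listing vertex sets -/

lemma State.HoldsFamily.append {s s' : State} {cnt : Reg} {size elt : Arr}
    {F : Set (Set (Fin n))} {B : Set (Fin n)} (h : s.HoldsFamily cnt size elt F) (hB : B ∉ F)
    (hcnt : s'.reg cnt = s.reg cnt + 1)
    (hsize : ∀ i < s.reg cnt, s'.arr size i 0 = s.arr size i 0)
    (helt : ∀ i < s.reg cnt, s'.arr elt i = s.arr elt i)
    (hlt : ∀ j < s'.arr size (s.reg cnt) 0, s'.arr elt (s.reg cnt) j < n)
    (hinj : Set.InjOn (s'.arr elt (s.reg cnt)) (Set.Iio (s'.arr size (s.reg cnt) 0)))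
    (hset : s'.rowSet n size elt (s.reg cnt) = B) :
    s'.HoldsFamily cnt size elt (insert B F) := by
  obtain ⟨h1, h2, h3⟩ := h
  have hcases : ∀ i < s'.reg cnt, i < s.reg cnt ∨ i = s.reg cnt := fun i hi => by omega
  refine ⟨fun i hi j hj => ?_, fun i hi => ?_, ?_⟩
  · rcases hcases i hi with hi | rfl
    · rw [hsize i hi] at hj
      rw [helt i hi]
      exact h1 i hi j hj
    · exact hlt j hj
  · rcases hcases i hi with hi | rfl
    · rw [hsize i hi, helt i hi]
      exact h2 i hi
    · exact hinj
  · have hIio : Set.Iio (s'.reg cnt) = insert (s.reg cnt) (Set.Iio (s.reg cnt)) := by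
      ext i
      simp only [Set.mem_Iio, Set.mem_insert_iff]
      omega
    have hrow : Set.EqOn (s.rowSet n size elt) (s'.rowSet n size elt) (Set.Iio (s.reg cnt)) := by
      intro i hi
      ext v
      simp only [State.rowSet, hsize i hi, helt i hi]
    rw [hIio, ← hset]
    exact (h3.congr hrow).insert (hset ▸ hB)

/-- Append the row of the vertices that satisfy `c` to the list; the candidate is in `tmp 3`. -/
def appendRow (cnt : Reg) (size elt : Arr) (c : Cond) : Prog :=
  block
    [ .assign (.tmp 8) (.const 0),
      forLt (.tmp 3) (.reg .n)
        (.ite c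
          (.seq (.store elt (.reg cnt) (.reg (.tmp 8)) (.reg (.tmp 3)))
            (.assign (.tmp 8) (.succ (.reg (.tmp 8)))))
          .skip),
      .store size (.reg cnt) (.const 0) (.reg (.tmp 8)),
      .assign cnt (.succ (.reg cnt)) ]

/-- `cnt`, `size` and `elt` do not interfere with the scratch memory of the search. -/
structure IsOutput (cnt : Reg) (size elt : Arr) : Prop where
  cnt_ne : cnt ≠ .n ∧ ∀ j < 20, cnt ≠ .tmp j
  size_ne : ∀ j < 20, size ≠ .tmp j
  elt_ne : ∀ j < 20, elt ≠ .tmp j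
  ne : size ≠ elt

lemma runs_appendRow {cnt : Reg} {size elt : Arr} (ho : IsOutput cnt size elt) {c : Cond}
    {P : ℕ → Prop} {F : Set (Set (Fin n))} (hn : s.reg .n = n) (hF : s.HoldsFamily cnt size elt F)
    (hP : {v : Fin n | P v} ∉ F)
    (hc : ∀ i < n, ∀ s' : State, (∀ a, a ≠ elt → s'.arr a = s.arr a) →
      (∀ q, q ≠ .tmp 3 → q ≠ .tmp 8 → s'.reg q = s.reg q) → s'.reg (.tmp 3) = i →
      (c.holds s' ↔ P i)) :
    Runs (appendRow cnt size elt c) s fun t s' => t ≤ n * (c.cost + 20) + 30 ∧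
      s'.HoldsFamily cnt size elt (insert {v : Fin n | P v} F) ∧
      (∀ q, q ≠ cnt → q ≠ .tmp 3 → q ≠ .tmp 8 → s'.reg q = s.reg q) ∧
      (∀ a, a ≠ size → a ≠ elt → s'.arr a = s.arr a) := by
  have hc3 := ho.cnt_ne.2 3 (by norm_num)
  have hc8 := ho.cnt_ne.2 8 (by norm_num)
  rw [appendRow, runs_block_cons, runs_assign, runs_block_cons]
  refine (Runs.forLt (m := n) (T := c.cost + 12) (fun i s' =>
    (∀ a, a ≠ elt → s'.arr a = s.arr a) ∧ (∀ q, q ≠ .tmp 3 → q ≠ .tmp 8 → s'.reg q = s.reg q) ∧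
    (∀ k, k ≠ s.reg cnt → s'.arr elt k = s.arr elt k) ∧
    (∀ j < s'.reg (.tmp 8), s'.arr elt (s.reg cnt) j < i ∧ P (s'.arr elt (s.reg cnt) j)) ∧
    Set.InjOn (s'.arr elt (s.reg cnt)) (Set.Iio (s'.reg (.tmp 8))) ∧
    ∀ v < i, P v → ∃ j < s'.reg (.tmp 8), s'.arr elt (s.reg cnt) j = v) ?_ ?_ ?_).imp ?_
  · have h8 : ((s.setReg (.tmp 8) 0).setReg (.tmp 3) 0).reg (.tmp 8) = 0 := by
      simp [State.setReg_reg]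
    simp only [Expr.eval]
    refine ⟨fun _ _ => rfl, fun q h1 h2 => ?_, fun _ _ => rfl, ?_, ?_, by simp⟩
    · rw [State.setReg_of_ne _ _ h1, State.setReg_of_ne _ _ h2]
    · rw [h8]
      simp
    · rw [h8]
      intro i hi
      simp at hi
  · rintro i s' ⟨-, h, -⟩
    simp [Expr.eval, h .n, hn]
  · rintro i hi s' ⟨h1, h2, h3, h4, h5, h6⟩ hr
    rw [runs_ite, hc i hi s' h1 h2 hr]
    refine ⟨fun hPi => ?_, fun hPi => ?_⟩
    · rw [runs_seq, runs_store, runs_assign]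
      have hcs : s'.reg cnt = s.reg cnt := h2 cnt hc3 hc8
      have hval : ∀ x y, ((s'.setArr elt (s.reg cnt) (s'.reg (.tmp 8)) i)).arr elt x y =
          if x = s.reg cnt ∧ y = s'.reg (.tmp 8) then i else s'.arr elt x y := by
        intro x y
        rw [State.setArr_arr]
        simp
      simp only [Expr.eval, Expr.cost, hcs, hr, State.setArr_reg, State.setReg_arr]
      have hlen : (((s'.setArr elt (s.reg cnt) (s'.reg (.tmp 8)) i).setReg (.tmp 8)
          (s'.reg (.tmp 8) + 1)).setReg (.tmp 3) (i + 1)).reg (.tmp 8) =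
          s'.reg (.tmp 8) + 1 := by
        simp [State.setReg_reg]
      have hlen' : ((s'.setArr elt (s.reg cnt) (s'.reg (.tmp 8)) i).setReg (.tmp 8)
          (s'.reg (.tmp 8) + 1)).reg (.tmp 3) = i := by
        simp [State.setReg_reg, hr]
      simp only [hlen, hlen']
      refine ⟨by omega, trivial, fun a ha => ?_, fun q hq1 hq2 => ?_, fun k hk => ?_,
        fun j hj => ?_, ?_, fun v hv hPv => ?_⟩
      · rw [State.setArr_of_ne _ _ _ _ ha, h1 a ha]
      · rw [State.setReg_of_ne _ _ hq1, State.setReg_of_ne _ _ hq2]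
        exact h2 q hq1 hq2
      · funext y
        rw [hval, ← h3 k hk]
        simp [hk]
      · rw [hval]
        by_cases hj' : j = s'.reg (.tmp 8)
        · simp [hj', hPi]
        · have := h4 j (by omega)
          simp only [hj', and_false, if_false]
          exact ⟨by omega, this.2⟩
      · intro x hx y hy hxy
        simp only [Set.mem_Iio] at hx hy
        rw [hval, hval] at hxy
        by_cases hx' : x = s'.reg (.tmp 8) <;> by_cases hy' : y = s'.reg (.tmp 8)
        · omega
        · have := (h4 y (by omega)).1
          simp only [hx', hy', and_false, and_true, if_true, if_false] at hxy
          omega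
        · have := (h4 x (by omega)).1
          simp only [hx', hy', and_false, and_true, if_true, if_false] at hxy
          omega
        · simp only [hx', hy', and_false, if_false] at hxy
          exact h5 (by simp only [Set.mem_Iio]; omega) (by simp only [Set.mem_Iio]; omega) hxy
      · by_cases hv' : v = i
        · exact ⟨s'.reg (.tmp 8), by omega, by rw [hval]; simp [hv']⟩
        · obtain ⟨j, hj, hjv⟩ := h6 v (by omega) hPv
          refine ⟨j, by omega, ?_⟩
          rw [hval, if_neg (by omega), hjv]
    · rw [runs_skip]
      refine ⟨by omega, hr, h1, fun q hq1 hq2 => ?_, h3, fun j hj => ?_, h5, fun v hv hPv => ?_⟩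
      · rw [State.setReg_of_ne _ _ hq1]
        exact h2 q hq1 hq2
      · have := h4 j hj
        exact ⟨by simp only [State.setReg_arr]; omega, this.2⟩
      · by_cases hv' : v = i
        · exact absurd (hv' ▸ hPv) hPi
        · exact h6 v (by omega) hPv
  · rintro t s' ⟨ht, -, h1, h2, h3, h4, h5, h6⟩
    have hcs : s'.reg cnt = s.reg cnt := h2 cnt hc3 hc8
    simp only [runs_block_cons, runs_block_singleton, runs_store, runs_assign, Expr.eval,
      Expr.cost, hcs, State.setArr_reg, State.setReg_arr] at *
    have helt : ∀ v, (s'.setArr size (s.reg cnt) 0 v).arr elt = s'.arr elt := fun v =>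
      State.setArr_of_ne _ _ _ _ ho.ne.symm
    refine ⟨by linarith, hF.append hP ?_ (fun i hi => ?_) (fun i hi => ?_) (fun j hj => ?_) ?_ ?_,
      fun q hq1 hq2 hq3 => ?_, fun a ha1 ha2 => ?_⟩
    · simp
    · rw [State.setReg_arr, State.setArr_arr, if_neg (by omega), h1 size ho.ne]
    · rw [State.setReg_arr, helt, h3 i (by omega)]
    · rw [State.setReg_arr, State.setArr_self] at hj
      rw [State.setReg_arr, helt]
      exact (h4 j hj).1
    · rw [State.setReg_arr, State.setArr_self, helt]
      exact h5
    · ext v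
      simp only [State.rowSet, State.setReg_arr, State.setArr_self, helt, Set.mem_ofPred_eq]
      constructor
      · rintro ⟨j, hj, hjv⟩
        exact hjv ▸ (h4 j hj).2
      · exact fun hv => h6 v v.2 hv
    · rw [State.setReg_of_ne _ _ hq1]
      exact h2 q hq2 hq3
    · rw [State.setArr_of_ne _ _ _ _ ha1]
      exact h1 a ha2

end RAM

namespace RAM

variable {s : State} {n : ℕ}

/-- List the blocks found by a search: the finished classes that hang at a vertex, each one together
with this vertex. The condition says `v = root i ∨ done v = i + 1`; there is no disjunction in the
language. -/
def listBlocks (cnt : Reg) (size elt : Arr) : Prog :=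
  .seq (.assign cnt (.const 0))
    (forLt (.tmp 9) (.reg (.tmp 4))
      (.ite (.lt (entry (.tmp 5) (.tmp 9)) (.reg .n))
        (appendRow cnt size elt
          (.not (.and (.not (.eq (.reg (.tmp 3)) (entry (.tmp 5) (.tmp 9))))
            (.not (.eq (entry (.tmp 2) (.tmp 3)) (.succ (.reg (.tmp 9))))))))
        .skip))

/-- There are at most `n` classes, since they are disjoint and nonempty. -/
lemma _root_.Search.BccResult.id_le {E : ℕ → ℕ → Prop} {σ : Search} (r : σ.BccResult n E) :
    σ.id ≤ n := by
  choose f hf using r.inv.home_nonempty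
  have hinj : Function.Injective fun i : Fin σ.id => (⟨f i i.2, (hf i i.2).1⟩ : Fin n) := by
    intro i j hij
    have h1 := (hf i i.2).2
    have h2 := (hf j j.2).2
    have h3 : f i i.2 = f j j.2 := congrArg Fin.val hij
    rw [h3, h2] at h1
    exact Fin.ext (by omega)
  simpa using Fintype.card_le_of_injective _ hinj

lemma runs_listBlocks {cnt : Reg} {size elt : Arr} (ho : IsOutput cnt size elt)
    {E : ℕ → ℕ → Prop} (hn : s.reg .n = n) (r : s.toSearch.BccResult n E) :
    Runs (listBlocks cnt size elt) s fun t s' => t ≤ n * (n * 40 + 70) + 12 ∧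
      s'.HoldsFamily cnt size elt {S : Set (Fin n) | ∃ i < s.toSearch.id,
        s.toSearch.root i < n ∧ S = s.toSearch.vertexBlock n i} ∧
      (∀ q, q ≠ cnt → q ≠ .tmp 3 → q ≠ .tmp 8 → q ≠ .tmp 9 → s'.reg q = s.reg q) ∧
      (∀ a, a ≠ size → a ≠ elt → s'.arr a = s.arr a) := by
  have hc := fun j (hj : j < 20) => ho.cnt_ne.2 j hj
  rw [listBlocks, runs_seq, runs_assign]
  refine (Runs.forLt (m := s.toSearch.id) (T := n * 40 + 60) (fun i s' =>
    s'.HoldsFamily cnt size elt {S : Set (Fin n) | ∃ i' < i,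
        s.toSearch.root i' < n ∧ S = s.toSearch.vertexBlock n i'} ∧
      (∀ q, q ≠ cnt → q ≠ .tmp 3 → q ≠ .tmp 8 → q ≠ .tmp 9 → s'.reg q = s.reg q) ∧
      (∀ a, a ≠ size → a ≠ elt → s'.arr a = s.arr a)) ?_ ?_ ?_).imp ?_
  · have h0 : ((s.setReg cnt 0).setReg (.tmp 9) 0).reg cnt = 0 := by
      rw [State.setReg_of_ne _ _ (hc 9 (by norm_num)), State.setReg_self]
    simp only [Expr.eval]
    refine ⟨⟨?_, ?_, ?_⟩, fun q h1 _ _ h4 => ?_, fun _ _ _ => rfl⟩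
    · rw [h0]; simp
    · rw [h0]; simp
    · rw [h0]
      have h1 : Set.Iio 0 = (∅ : Set ℕ) := by ext; simp
      have h2 : {S : Set (Fin n) | ∃ i' < 0, s.toSearch.root i' < n ∧
          S = s.toSearch.vertexBlock n i'} = ∅ := by ext; simp
      rw [h1, h2]
      exact Set.bijOn_empty _
    · rw [State.setReg_of_ne _ _ h4, State.setReg_of_ne _ _ h1]
  · rintro i s' ⟨-, h, -⟩
    exact h (.tmp 4) (hc 4 (by norm_num)).symm (by decide) (by decide) (by decide)
  · rintro i hi s' ⟨h1, h2, h3⟩ hr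
    have hn' : s'.reg .n = n :=
      (h2 .n ho.cnt_ne.1.symm (by decide) (by decide) (by decide)).trans hn
    have h5 : s'.arr (.tmp 5) = s.arr (.tmp 5) :=
      h3 _ (ho.size_ne 5 (by norm_num)).symm (ho.elt_ne 5 (by norm_num)).symm
    have h2' : s'.arr (.tmp 2) = s.arr (.tmp 2) :=
      h3 _ (ho.size_ne 2 (by norm_num)).symm (ho.elt_ne 2 (by norm_num)).symm
    have hroot : s'.arr (.tmp 5) i 0 = s.toSearch.root i := by rw [h5]; rfl
    rw [runs_ite]
    simp only [Cond.holds, Cond.cost, Expr.eval, Expr.cost, hr, hroot, hn']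
    refine ⟨fun hlt => ?_, fun hlt => ?_⟩
    · refine (runs_appendRow (P := fun v => v ∈ s.toSearch.block n i) ho hn' h1 ?_ ?_).imp ?_
      · rintro ⟨i', hi', hr', heq⟩
        have := r.eq_of_vertexBlock_subset hi hlt (by omega) hr' (subset_of_eq heq)
        omega
      · intro v hv s'' ha hq hv'
        have e1 : s''.arr (.tmp 5) = s.arr (.tmp 5) :=
          (ha _ (ho.elt_ne 5 (by norm_num)).symm).trans h5
        have e2 : s''.arr (.tmp 2) = s.arr (.tmp 2) :=
          (ha _ (ho.elt_ne 2 (by norm_num)).symm).trans h2'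
        have e3 : s''.reg (.tmp 9) = i := (hq _ (by decide) (by decide)).trans hr
        simp only [Cond.holds, Expr.eval, e1, e2, e3, hv']
        simp only [Search.block, Set.mem_insert_iff, Set.mem_ofPred_eq]
        have e4 : s.toSearch.root i = s.arr (.tmp 5) i 0 := rfl
        have e5 : s.toSearch.done v = s.arr (.tmp 2) v 0 := rfl
        rw [e4, e5]
        tauto
      · rintro t s'' ⟨ht, hF, hq, ha⟩
        simp only [Cond.cost, Expr.cost] at ht
        have h9 : s''.reg (.tmp 9) = i :=
          (hq _ (hc 9 (by norm_num)).symm (by decide) (by decide)).trans hr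
        refine ⟨by omega, h9, ?_, fun q hq1 hq2 hq3 hq4 => ?_, fun a ha1 ha2 => ?_⟩
        · have hins : {S : Set (Fin n) | ∃ i' < i + 1, s.toSearch.root i' < n ∧
              S = s.toSearch.vertexBlock n i'} = insert {v : Fin n | (v : ℕ) ∈ s.toSearch.block n i}
              {S : Set (Fin n) | ∃ i' < i, s.toSearch.root i' < n ∧
                S = s.toSearch.vertexBlock n i'} := by
            ext S
            simp only [Set.mem_insert_iff, Set.mem_ofPred_eq]
            constructor
            · rintro ⟨i', hi', hr', rfl⟩
              rcases Nat.lt_succ_iff_lt_or_eq.1 hi' with hi' | rfl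
              · exact Or.inr ⟨i', hi', hr', rfl⟩
              · exact Or.inl rfl
            · rintro (rfl | ⟨i', hi', hr', rfl⟩)
              · exact ⟨i, by omega, hlt, rfl⟩
              · exact ⟨i', by omega, hr', rfl⟩
          rw [hins]
          have hcnt : (s''.setReg (.tmp 9) (i + 1)).reg cnt = s''.reg cnt :=
            State.setReg_of_ne _ _ (hc 9 (by norm_num))
          unfold State.HoldsFamily at hF ⊢
          rw [hcnt]
          exact hF
        · rw [State.setReg_of_ne _ _ hq4, hq q hq1 hq2 hq3]
          exact h2 q hq1 hq2 hq3 hq4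
        · rw [State.setReg_arr, ha a ha1 ha2]
          exact h3 a ha1 ha2
    · rw [runs_skip]
      refine ⟨by omega, hr, ?_, fun q hq1 hq2 hq3 hq4 => ?_, fun a ha1 ha2 => ?_⟩
      · have hins : {S : Set (Fin n) | ∃ i' < i + 1, s.toSearch.root i' < n ∧
              S = s.toSearch.vertexBlock n i'} = {S : Set (Fin n) | ∃ i' < i,
              s.toSearch.root i' < n ∧ S = s.toSearch.vertexBlock n i'} := by
          ext S
          simp only [Set.mem_ofPred_eq]
          constructor
          · rintro ⟨i', hi', hr', h⟩
            rcases Nat.lt_succ_iff_lt_or_eq.1 hi' with hi' | rfl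
            · exact ⟨i', hi', hr', h⟩
            · exact absurd hr' hlt
          · rintro ⟨i', hi', h⟩
            exact ⟨i', by omega, h⟩
        have hcnt : (s'.setReg (.tmp 9) (i + 1)).reg cnt = s'.reg cnt :=
          State.setReg_of_ne _ _ (hc 9 (by norm_num))
        rw [hins]
        unfold State.HoldsFamily at h1 ⊢
        rw [hcnt]
        exact h1
      · rw [State.setReg_of_ne _ _ hq4]
        exact h2 q hq1 hq2 hq3 hq4
      · exact h3 a ha1 ha2
  · rintro t s' ⟨ht, -, h⟩
    refine ⟨?_, h⟩
    have hid := r.id_le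
    simp only [Expr.cost] at *
    have : s.toSearch.id * (n * 40 + 60 + 1 + 7) ≤ n * (n * 40 + 60 + 1 + 7) := by gcongr
    linarith

/-- Append a row for each isolated vertex of the graph in the array `tmp 0`. -/
def listIsolated (cnt : Reg) (size elt : Arr) : Prog :=
  forLt (.tmp 9) (.reg .n)
    (.seq (findVertex (.tmp 10) (.eq (.get (.tmp 0) (.reg (.tmp 9)) (.reg (.tmp 3))) (.const 1)))
      (.ite (.eq (.reg (.tmp 10)) (.reg .n))
        (appendRow cnt size elt (.eq (.reg (.tmp 3)) (.reg (.tmp 9))))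
        .skip))

lemma runs_listIsolated {cnt : Reg} {size elt : Arr} (ho : IsOutput cnt size elt)
    {F : Set (Set (Fin n))} (hn : s.reg .n = n) (hF : s.HoldsFamily cnt size elt F)
    (hnt : ∀ S ∈ F, S.Nontrivial) :
    Runs (listIsolated cnt size elt) s fun t s' => t ≤ n * (n * 40 + 60) + 12 ∧
      s'.HoldsFamily cnt size elt
        (F ∪ {C | ∃ v : Fin n, C = {v} ∧ ∀ w : Fin n, ¬ s.Edge v w}) := by
  have hc := fun j (hj : j < 20) => ho.cnt_ne.2 j hj
  set G : ℕ → Set (Set (Fin n)) := fun i =>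
    F ∪ {C | ∃ v : Fin n, v < i ∧ C = {v} ∧ ∀ w : Fin n, ¬ s.Edge v w} with hG
  refine (Runs.forLt (m := n) (T := n * 40 + 50) (fun i s' =>
    s'.HoldsFamily cnt size elt (G i) ∧ s'.reg .n = n ∧ s'.arr (.tmp 0) = s.arr (.tmp 0))
    ?_ ?_ ?_).imp ?_
  · have h0 : (s.setReg (.tmp 9) 0).reg cnt = s.reg cnt :=
      State.setReg_of_ne _ _ (hc 9 (by norm_num))
    have hG0 : G 0 = F := by ext; simp [hG]
    refine ⟨?_, hn, rfl⟩
    rw [hG0]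
    unfold State.HoldsFamily at hF ⊢
    rw [h0]
    exact hF
  · rintro i s' ⟨-, h, -⟩
    exact h
  · rintro i hi s' ⟨h1, h2, h3⟩ hr
    rw [runs_seq]
    refine (runs_findVertex (P := fun w => s.Edge i w) h2 (by decide) (by decide) ?_).imp ?_
    · intro v hv s'' ha hq hv'
      simp only [Cond.holds, Expr.eval, ha, h3, hv', hq (.tmp 9) (by decide) (by decide), hr]
      rfl
    rintro t₁ s₁ ⟨ht₁, ha₁, hq₁, hfind⟩
    have hn₁ : s₁.reg .n = n := (hq₁ _ (by decide) (by decide)).trans h2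
    have hr₁ : s₁.reg (.tmp 9) = i := (hq₁ _ (by decide) (by decide)).trans hr
    have hF₁ : s₁.HoldsFamily cnt size elt (G i) := by
      unfold State.HoldsFamily at h1 ⊢
      rw [hq₁ cnt (hc 10 (by norm_num)) (hc 3 (by norm_num))]
      unfold State.rowSet at h1 ⊢
      rw [ha₁]
      exact h1
    simp only [Cond.cost, Expr.cost] at ht₁
    rw [runs_ite]
    simp only [Cond.holds, Cond.cost, Expr.eval, Expr.cost, hn₁]
    refine ⟨fun hv => ?_, fun hv => ?_⟩
    · have hiso : ∀ w : Fin n, ¬ s.Edge i w := by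
        rcases hfind with h | h
        · exact fun w => h.2 w w.2
        · omega
      have hsing : {v : Fin n | (v : ℕ) = i} = {(⟨i, hi⟩ : Fin n)} := by
        ext v
        simp [Fin.ext_iff]
      refine (runs_appendRow (P := fun v => v = i) ho hn₁ hF₁ ?_ ?_).imp ?_
      · rw [hsing]
        rintro (h | ⟨v, hv, h, -⟩)
        · exact Set.not_nontrivial_singleton (hnt _ h)
        · rw [Set.singleton_eq_singleton_iff] at h
          rw [← h] at hv
          exact lt_irrefl _ hv
      · intro v hv s'' ha hq hv'
        simp [Cond.holds, Expr.eval, hv', hq, hr₁]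
      · rintro t s'' ⟨ht, hF', hq, ha⟩
        simp only [Cond.cost, Expr.cost] at ht
        refine ⟨by omega, ?_, ?_, ?_, ?_⟩
        · exact (hq _ (hc 9 (by norm_num)).symm (by decide) (by decide)).trans hr₁
        · have hins : G (i + 1) = insert {v : Fin n | (v : ℕ) = i} (G i) := by
            ext C
            simp only [hG, Set.mem_union, Set.mem_insert_iff, Set.mem_ofPred_eq]
            constructor
            · rintro (h | ⟨v, hv, rfl, hvw⟩)
              · exact Or.inr (Or.inl h)
              · rcases Nat.lt_succ_iff_lt_or_eq.1 hv with hv | hv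
                · exact Or.inr (Or.inr ⟨v, hv, rfl, hvw⟩)
                · refine Or.inl ?_
                  ext w
                  simp [Fin.ext_iff, hv]
            · rintro (rfl | h | ⟨v, hv, rfl, hvw⟩)
              · exact Or.inr ⟨⟨i, hi⟩, by simp, hsing, hiso⟩
              · exact Or.inl h
              · exact Or.inr ⟨v, by omega, rfl, hvw⟩
          have hcnt : (s''.setReg (.tmp 9) (i + 1)).reg cnt = s''.reg cnt :=
            State.setReg_of_ne _ _ (hc 9 (by norm_num))
          rw [hins]
          unfold State.HoldsFamily at hF' ⊢
          rw [hcnt]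
          exact hF'
        · rw [State.setReg_of_ne _ _ (by decide)]
          exact (hq _ ho.cnt_ne.1.symm (by decide) (by decide)).trans hn₁
        · rw [State.setReg_arr, ha _ (ho.size_ne 0 (by norm_num)).symm
            (ho.elt_ne 0 (by norm_num)).symm, ha₁, h3]
    · have hniso : ∃ w : Fin n, s.Edge i w := by
        rcases hfind with h | h
        · exact absurd h.1 hv
        · exact ⟨⟨_, h.1⟩, h.2⟩
      rw [runs_skip]
      refine ⟨by omega, hr₁, ?_, ?_, ?_⟩
      · have hins : G (i + 1) = G i := by
          ext C
          simp only [hG, Set.mem_union, Set.mem_ofPred_eq]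
          refine or_congr_right ⟨?_, ?_⟩
          · rintro ⟨v, hv, rfl, hvw⟩
            rcases Nat.lt_succ_iff_lt_or_eq.1 hv with hv | hv
            · exact ⟨v, hv, rfl, hvw⟩
            · rw [hv] at hvw
              exact absurd hniso (by simpa using hvw)
          · rintro ⟨v, hv, h⟩
            exact ⟨v, by omega, h⟩
        have hcnt : (s₁.setReg (.tmp 9) (i + 1)).reg cnt = s₁.reg cnt :=
          State.setReg_of_ne _ _ (hc 9 (by norm_num))
        rw [hins]
        unfold State.HoldsFamily at hF₁ ⊢
        rw [hcnt]
        exact hF₁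
      · rw [State.setReg_of_ne _ _ (by decide)]
        exact hn₁
      · rw [State.setReg_arr, ha₁, h3]
  · rintro t s' ⟨ht, -, h, -⟩
    refine ⟨?_, ?_⟩
    · simp only [Expr.cost] at ht
      linarith
    · convert h using 2
      ext C
      simp

/-! ### The subroutines for components and blocks -/

/-- Copy the matrix in the array `a` to the array `b`. -/
def copyMatrix (a b : Arr) : Prog :=
  pairLoop (.tmp 8) (.tmp 9)
    (.store b (.reg (.tmp 8)) (.reg (.tmp 9)) (.get a (.reg (.tmp 8)) (.reg (.tmp 9))))

lemma runs_copyMatrix {a b : Arr} (hab : a ≠ b) (hn : s.reg .n = n) :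
    Runs (copyMatrix a b) s fun t s' => t ≤ n * (n * 20 + 16) + 8 ∧
      (∀ r, r ≠ .tmp 8 → r ≠ .tmp 9 → s'.reg r = s.reg r) ∧
      (∀ a', a' ≠ b → s'.arr a' = s.arr a') ∧
      ∀ x < n, ∀ y < n, s'.arr b x y = s.arr a x y := by
  refine (Runs.fillSquare (n := n) (T := 12) (a := b) (f := fun x y => s.arr a x y) hn
    (by decide) (by decide) (by decide) ?_).imp ?_
  · intro x hx y hy s' h1 h2 h3 h4 h5
    rw [runs_store]
    simp [Expr.eval, Expr.cost, h4, h5, h2 a hab]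
  · rintro t s' ⟨ht, h1, h2, h3⟩
    exact ⟨ht, h1, h2, fun x hx y hy => by simp [h3, hx, hy]⟩

/-- Store in the array `tmp 0` the adjacency matrix of the underlying graph of the digraph in the
array `a`, restricted to the pairs `(tmp 8, tmp 9)` that satisfy `c`. -/
def symmetrize (a : Arr) (c : Cond) : Prog :=
  pairLoop (.tmp 8) (.tmp 9)
    (.ite
      (.and (.not (.eq (.reg (.tmp 8)) (.reg (.tmp 9))))
        (.and c
          (.not (.and (.not (.eq (.get a (.reg (.tmp 8)) (.reg (.tmp 9))) (.const 1)))
            (.not (.eq (.get a (.reg (.tmp 9)) (.reg (.tmp 8))) (.const 1)))))))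
      (.store (.tmp 0) (.reg (.tmp 8)) (.reg (.tmp 9)) (.const 1))
      (.store (.tmp 0) (.reg (.tmp 8)) (.reg (.tmp 9)) (.const 0)))

open Classical in
lemma runs_symmetrize {a : Arr} {c : Cond} {P : ℕ → ℕ → Prop} (ha : a ≠ .tmp 0)
    (hn : s.reg .n = n)
    (hc : ∀ x < n, ∀ y < n, ∀ s' : State, (∀ a', a' ≠ .tmp 0 → s'.arr a' = s.arr a') →
      s'.reg (.tmp 8) = x → s'.reg (.tmp 9) = y → (c.holds s' ↔ P x y)) :
    Runs (symmetrize a c) s fun t s' => t ≤ n * (n * (c.cost + 48) + 16) + 8 ∧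
      (∀ r, r ≠ .tmp 8 → r ≠ .tmp 9 → s'.reg r = s.reg r) ∧
      (∀ a', a' ≠ .tmp 0 → s'.arr a' = s.arr a') ∧
      ∀ x < n, ∀ y < n, s'.Edge x y ↔
        x ≠ y ∧ P x y ∧ (s.arr a x y = 1 ∨ s.arr a y x = 1) := by
  refine (Runs.fillSquare (n := n) (T := c.cost + 40) (a := .tmp 0)
    (f := fun x y => if x ≠ y ∧ P x y ∧ (s.arr a x y = 1 ∨ s.arr a y x = 1) then 1 else 0) hn
    (by decide) (by decide) (by decide) ?_).imp ?_
  · intro x hx y hy s' h1 h2 h3 h4 h5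
    rw [runs_ite]
    simp only [Cond.holds, Cond.cost, Expr.eval, Expr.cost, runs_store, h4, h5, h2 a ha,
      hc x hx y hy s' h2 h4 h5]
    refine ⟨fun h => ⟨by omega, ?_⟩, fun h => ⟨by omega, ?_⟩⟩
    · rw [if_pos (by tauto)]
    · rw [if_neg (by tauto)]
  · rintro t s' ⟨ht, h1, h2, h3⟩
    refine ⟨by simpa [add_assoc] using ht, h1, h2, fun x hx y hy => ?_⟩
    simp only [State.Edge, h3, hx, hy, and_self, if_true]
    split_ifs with h <;> simp [h]

/-- Compute the strongly biconnected components of the digraph in the array `a`: after a search for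
strongly connected components, the edges between different components are dropped, and the blocks of
what remains, isolated vertices included, are listed. -/
def componentsProg (a : Arr) (cnt : Reg) (size elt : Arr) : Prog :=
  block
    [ copyMatrix a (.tmp 0),
      searchProg false,
      symmetrize a (.eq (entry (.tmp 2) (.tmp 8)) (entry (.tmp 2) (.tmp 9))),
      searchProg true,
      listBlocks cnt size elt,
      listIsolated cnt size elt ]

lemma State.HoldsDigraph.edge_iff {a : Arr} {G : Digraph (Fin n)} (h : s.HoldsDigraph a G)
    (x y : Fin n) : s.arr a x y = 1 ↔ G.Adj x y := by
  have := h.2 x y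
  by_cases hxy : G.Adj x y
  · simp [hxy, this.1 hxy]
  · simp [hxy, this.2 hxy]

lemma runs_componentsProg {a : Arr} {cnt : Reg} {size elt : Arr} (ho : IsOutput cnt size elt)
    (ha : ∀ j < 20, a ≠ .tmp j) {G : Digraph (Fin n)} (h1 : 1 ≤ n) (hs : s.HoldsDigraph a G) :
    Runs (componentsProg a cnt size elt) s fun t s' => t ≤ 20000 * n ^ 2 ∧
      s'.HoldsFamily cnt size elt {C | G.IsStronglyBiconnectedComponent C} := by
  have hn := hs.1
  rw [componentsProg, runs_block_cons]
  refine (runs_copyMatrix (ha 0 (by norm_num)) hn).imp ?_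
  rintro t₁ s₁ ⟨ht₁, hr₁, ha₁, hm₁⟩
  have hn₁ : s₁.reg .n = n := (hr₁ _ (by decide) (by decide)).trans hn
  have hE₁ : ∀ x y : Fin n, s₁.Edge x y ↔ G.Adj x y := by
    intro x y
    rw [State.Edge, hm₁ x x.2 y y.2, hs.edge_iff]
  rw [runs_block_cons]
  refine (runs_searchProg_scc hn₁ h1).frame.imp ?_
  rintro t₂ s₂ ⟨⟨ht₂, r₂, -⟩, hr₂, ha₂⟩
  have hn₂ : s₂.reg .n = n := (hr₂ _ rfl).trans hn₁
  have haa₂ : s₂.arr a = s.arr a := by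
    rw [← ha₁ a (ha 0 (by norm_num))]
    apply ha₂
    simp [Prog.keepsArr, searchProg, block, forLt, stepProg, findVertex, startProg, popProg,
      pushProg, mergeProg, recordProg, (ha 1 (by norm_num)).symm, (ha 2 (by norm_num)).symm,
      (ha 3 (by norm_num)).symm, (ha 4 (by norm_num)).symm, (ha 5 (by norm_num)).symm,
      (ha 6 (by norm_num)).symm, (ha 7 (by norm_num)).symm]
  rw [runs_block_cons]
  refine (runs_symmetrize (P := fun x y => s₂.toSearch.done x = s₂.toSearch.done y)
    (ha 0 (by norm_num)) hn₂ ?_).imp ?_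
  · intro x hx y hy s' ha' hx' hy'
    simp only [Cond.holds, Expr.eval, hx', hy', ha' (.tmp 2) (by decide)]
    rfl
  rintro t₃ s₃ ⟨ht₃, hr₃, -, hE₃⟩
  have hn₃ : s₃.reg .n = n := (hr₃ _ (by decide) (by decide)).trans hn₂
  have hinner : ∀ x y : Fin n, s₃.Edge x y ↔ G.innerGraph.Adj x y := by
    intro x y
    rw [hE₃ x x.2 y y.2, haa₂, hs.edge_iff, hs.edge_iff, Digraph.innerGraph_adj,
      r₂.reach_iff hE₁]
    simp [Fin.ext_iff]
  rw [runs_block_cons]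
  refine (runs_searchProg_bcc hn₃ h1).frame.imp ?_
  rintro t₄ s₄ ⟨⟨ht₄, r₄, -⟩, hr₄, ha₄⟩
  have hn₄ : s₄.reg .n = n := (hr₄ _ rfl).trans hn₃
  rw [runs_block_cons]
  refine (runs_listBlocks ho hn₄ r₄).imp ?_
  rintro t₅ s₅ ⟨ht₅, hF₅, hr₅, ha₅⟩
  have hn₅ : s₅.reg .n = n :=
    (hr₅ _ ho.cnt_ne.1.symm (by decide) (by decide) (by decide)).trans hn₄
  have hE₅ : s₅.Edge = s₃.Edge := by
    funext x y
    rw [State.Edge, State.Edge, ha₅ _ (ho.size_ne 0 (by norm_num)).symm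
      (ho.elt_ne 0 (by norm_num)).symm, ha₄ _ rfl]
  rw [runs_block_singleton]
  refine (runs_listIsolated ho hn₅ hF₅ ?_).imp ?_
  · rintro S ⟨i, hi, hr, rfl⟩
    exact r₄.vertexBlock_nontrivial hi hr
  rintro t₆ s₆ ⟨ht₆, hF₆⟩
  refine ⟨?_, ?_⟩
  · simp only [Cond.cost, Expr.cost] at *
    nlinarith
  · convert hF₆ using 1
    ext C
    rw [hE₅]
    exact r₄.isComponent_iff hinner C

/-- Compute the blocks with at least two vertices of the graph in the array `eb`. -/
def blocksProg : Prog :=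
  block
    [ symmetrize .eb (.eq (.const 0) (.const 0)),
      searchProg true,
      listBlocks .numOut .outSize .out ]

lemma isOutput_out : IsOutput .numOut .outSize .out :=
  ⟨⟨by decide, by simp⟩, by simp, by simp, by decide⟩

lemma isOutput_comp : IsOutput .numComps .compSize .comp :=
  ⟨⟨by decide, by simp⟩, by simp, by simp, by decide⟩

lemma computesBlocks_blocksProg : ComputesBlocks blocksProg fun n => 20000 * n ^ 2 := by
  intro n H h1 s hs
  have hn := hs.1
  have hruns : Runs blocksProg s fun t s' => t ≤ 20000 * n ^ 2 ∧
      s'.HoldsFamily .numOut .outSize .out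
        {B | H.toSimpleGraphInclusive.IsBlock B ∧ B.Nontrivial} := by
    rw [blocksProg, runs_block_cons]
    refine (runs_symmetrize (P := fun _ _ => True) (by decide) hn ?_).imp ?_
    · intro x hx y hy s' _ _ _
      simp [Cond.holds]
    rintro t₁ s₁ ⟨ht₁, hr₁, -, hE₁⟩
    have hn₁ : s₁.reg .n = n := (hr₁ _ (by decide) (by decide)).trans hn
    have hE : ∀ x y : Fin n, s₁.Edge x y ↔ H.toSimpleGraphInclusive.Adj x y := by
      intro x y
      rw [hE₁ x x.2 y y.2, hs.edge_iff, hs.edge_iff]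
      change _ ↔ H.SymAdj x y
      simp [Digraph.symAdj_iff, Fin.ext_iff]
    rw [runs_block_cons]
    refine (runs_searchProg_bcc hn₁ h1).frame.imp ?_
    rintro t₂ s₂ ⟨⟨ht₂, r₂, -⟩, hr₂, ha₂⟩
    have hn₂ : s₂.reg .n = n := (hr₂ _ rfl).trans hn₁
    rw [runs_block_singleton]
    refine (runs_listBlocks isOutput_out hn₂ r₂).imp ?_
    rintro t₃ s₃ ⟨ht₃, hF₃, -, -⟩
    refine ⟨?_, ?_⟩
    · simp only [Cond.cost, Expr.cost] at *
      nlinarith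
    · convert hF₃ using 1
      ext B
      exact r₂.isBlock_nontrivial_iff hE B
  obtain ⟨t, s', hex, ⟨ht, hF⟩, hr, ha⟩ := hruns.frame
  refine ⟨t, s', hex, ht, hF, fun r h1 h2 => ?_, fun a h1 h2 => ?_⟩
  · cases r with
    | numOut => simp at h1
    | tmp j => exact absurd rfl (h2 j)
    | _ => exact hr _ rfl
  · cases a with
    | outSize => simp at h1
    | out => simp at h1
    | tmp j => exact absurd rfl (h2 j)
    | _ => exact ha _ rfl

lemma computesComponents_componentsProg :
    ComputesComponents (componentsProg .adj .numComps .compSize .comp)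
      fun n => 20000 * n ^ 2 := by
  intro n G h1 s hs
  obtain ⟨t, s', hex, ⟨ht, hF⟩, hr, ha⟩ :=
    (runs_componentsProg isOutput_comp (by simp) h1 hs).frame
  refine ⟨t, s', hex, ht, hF, fun r h1 h2 => ?_, fun a h1 h2 => ?_⟩
  · cases r with
    | numComps => simp at h1
    | tmp j => exact absurd rfl (h2 j)
    | _ => exact hr _ rfl
  · cases a with
    | compSize => simp at h1
    | comp => simp at h1
    | tmp j => exact absurd rfl (h2 j)
    | _ => exact ha _ rfl

end RAM

/-! ### The subroutine for b-bridges -/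

namespace RAM

variable {s : State} {n : ℕ}

lemma State.HoldsFamily.ncard_rowSet {cnt : Reg} {size elt : Arr} {F : Set (Set (Fin n))}
    (h : s.HoldsFamily cnt size elt F) {i : ℕ} (hi : i < s.reg cnt) :
    (s.rowSet n size elt i).ncard = s.arr size i 0 := by
  have h1 : Fin.val '' s.rowSet n size elt i = s.arr elt i '' Set.Iio (s.arr size i 0) := by
    ext v
    constructor
    · rintro ⟨w, ⟨j, hj, hjw⟩, rfl⟩
      exact ⟨j, hj, hjw⟩
    · rintro ⟨j, hj, rfl⟩
      exact ⟨⟨_, h.1 i hi j hj⟩, ⟨j, hj, rfl⟩, rfl⟩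
  rw [← Set.ncard_image_of_injective _ Fin.val_injective, h1, (h.2.1 i hi).ncard_image,
    Set.ncard_eq_toFinset_card']
  simp

/-- A digraph is strongly biconnected if it has a single component, with all vertices. -/
lemma State.HoldsFamily.isStronglyBiconnected_iff {cnt : Reg} {size elt : Arr}
    {G : Digraph (Fin n)}
    (h : s.HoldsFamily cnt size elt {C | G.IsStronglyBiconnectedComponent C}) :
    G.IsStronglyBiconnected ↔ s.reg cnt = 1 ∧ s.arr size 0 0 = n := by
  constructor
  · intro hG
    have hF : {C | G.IsStronglyBiconnectedComponent C} = {Set.univ} := by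
      ext C
      exact ⟨fun hC => hG.eq_univ_of_isComponent hC, fun hC => hC ▸ hG.isComponent_univ⟩
    have hcard : s.reg cnt = 1 := by
      have := h.2.2.image_eq ▸ h.2.2.injOn.ncard_image
      rw [hF, Set.ncard_singleton, Set.ncard_eq_toFinset_card'] at this
      simpa using this.symm
    refine ⟨hcard, ?_⟩
    have hmem : s.rowSet n size elt 0 ∈ {C | G.IsStronglyBiconnectedComponent C} :=
      h.2.2.mapsTo (by simp [hcard])
    rw [hF] at hmem
    rw [← h.ncard_rowSet (i := 0) (by omega), hmem, Set.ncard_univ, Nat.card_fin]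
  · rintro ⟨h1, h2⟩
    have hmem : G.IsStronglyBiconnectedComponent (s.rowSet n size elt 0) :=
      h.2.2.mapsTo (by simp [h1])
    have huniv : s.rowSet n size elt 0 = Set.univ := by
      apply Set.eq_of_subset_of_ncard_le (Set.subset_univ _)
      rw [h.ncard_rowSet (i := 0) (by omega), h2, Set.ncard_univ, Nat.card_fin]
    rw [Digraph.isStronglyBiconnected_iff_univ, ← huniv]
    exact hmem.prop

lemma State.HoldsDigraph.deleteEdge {a : Arr} {G : Digraph (Fin n)} (h : s.HoldsDigraph a G)
    (b : Fin n × Fin n) : (s.setArr a b.1 b.2 0).HoldsDigraph a (G.deleteEdge b) := by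
  refine ⟨h.1, fun u v => ?_⟩
  have hval : (s.setArr a b.1 b.2 0).arr a u v = if (u, v) = b then 0 else s.arr a u v := by
    rw [State.setArr_arr]
    congr 1
    simp [Prod.ext_iff, Fin.ext_iff]
  rw [hval]
  have := h.2 u v
  unfold Digraph.deleteEdge
  split_ifs with huv
  · simp [huv]
  · simpa [huv] using this

/-- The pair of the numbers `x` and `y` is a b-bridge of `G`. -/
def BridgePair (G : Digraph (Fin n)) (x y : ℕ) : Prop :=
  ∃ (hx : x < n) (hy : y < n), G.IsBBridge (⟨x, hx⟩, ⟨y, hy⟩)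

/-- Set the mark of the pair `(p, q)` in the array `tmp 23` if this pair is a b-bridge: delete it
from a copy of the adjacency matrix, and see whether there is a single component, with all
vertices. -/
def testEdge (p q : Reg) : Prog :=
  .ite (.eq (.get .adj (.reg p) (.reg q)) (.const 1))
    (block
      [ copyMatrix .adj (.tmp 22),
        .store (.tmp 22) (.reg p) (.reg q) (.const 0),
        componentsProg (.tmp 22) (.tmp 20) (.tmp 20) (.tmp 21),
        .ite (.and (.eq (.reg (.tmp 20)) (.const 1))
            (.eq (.get (.tmp 20) (.const 0) (.const 0)) (.reg .n)))
          .skip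
          (.store (.tmp 23) (.reg p) (.reg q) (.const 1)) ])
    .skip

lemma isOutput_tmp : IsOutput (.tmp 20) (.tmp 20) (.tmp 21) := by
  refine ⟨⟨by decide, fun j hj => ?_⟩, fun j hj => ?_, fun j hj => ?_, by decide⟩ <;>
    simp only [ne_eq, Reg.tmp.injEq, Arr.tmp.injEq] <;> omega

lemma keeps_componentsProg :
    (∀ j, 20 < j → (componentsProg (.tmp 22) (.tmp 20) (.tmp 20) (.tmp 21)).keepsReg (.tmp j)) ∧
    (∀ j, 21 < j → (componentsProg (.tmp 22) (.tmp 20) (.tmp 20) (.tmp 21)).keepsArr (.tmp j)) := by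
  constructor <;> intro j hj <;>
  · simp [Prog.keepsReg, Prog.keepsArr, componentsProg, searchProg, block, forLt, stepProg,
      findVertex, startProg, popProg, pushProg, mergeProg, recordProg, copyMatrix, symmetrize,
      listBlocks, listIsolated, appendRow, pairLoop]
    omega

open Classical in
lemma runs_testEdge {p q : ℕ} (hp : 22 < p) (hq : 22 < q) {G : Digraph (Fin n)} (h1 : 1 ≤ n)
    (hs : s.HoldsDigraph .adj G) {x y : ℕ} (hx : s.reg (.tmp p) = x) (hy : s.reg (.tmp q) = y)
    (hxn : x < n) (hyn : y < n) :
    Runs (testEdge (.tmp p) (.tmp q)) s fun t s' => t ≤ 21000 * n ^ 2 ∧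
      (∀ r, r = .n ∨ (∃ j > 20, r = .tmp j) → s'.reg r = s.reg r) ∧
      (∀ a, a = .adj ∨ (∃ j > 23, a = .tmp j) → s'.arr a = s.arr a) ∧
      ∀ u v, s'.arr (.tmp 23) u v =
        if u = x ∧ v = y ∧ BridgePair G u v then 1 else s.arr (.tmp 23) u v := by
  have hn := hs.1
  set b : Fin n × Fin n := (⟨x, hxn⟩, ⟨y, hyn⟩) with hb
  have hadj : s.arr .adj x y = 1 ↔ G.Adj b.1 b.2 := hs.edge_iff b.1 b.2
  rw [testEdge, runs_ite]
  simp only [Cond.holds, Cond.cost, Expr.eval, Expr.cost, hx, hy, hadj]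
  refine ⟨fun hG => ?_, fun hG => ?_⟩
  · rw [runs_block_cons]
    refine (runs_copyMatrix (by decide) hn).imp ?_
    rintro t₁ s₁ ⟨ht₁, hr₁, ha₁, hm₁⟩
    have hreg₁ : ∀ r, r = .n ∨ (∃ j > 20, r = .tmp j) → s₁.reg r = s.reg r := by
      rintro r (rfl | ⟨j, hj, rfl⟩)
      · exact hr₁ _ (by decide) (by decide)
      · exact hr₁ _ (by simp; omega) (by simp; omega)
    rw [runs_block_cons, runs_store]
    simp only [Expr.eval, Expr.cost, hreg₁ (.tmp p) (Or.inr ⟨p, by omega, rfl⟩),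
      hreg₁ (.tmp q) (Or.inr ⟨q, by omega, rfl⟩), hx, hy]
    have hs₁ : s₁.HoldsDigraph (.tmp 22) G := by
      refine ⟨(hreg₁ _ (Or.inl rfl)).trans hn, fun u v => ?_⟩
      rw [hm₁ u u.2 v v.2]
      exact hs.2 u v
    have hdel : (s₁.setArr (.tmp 22) x y 0).HoldsDigraph (.tmp 22) (G.deleteEdge b) :=
      hs₁.deleteEdge b
    rw [runs_block_cons]
    refine (runs_componentsProg isOutput_tmp (fun j hj => by simp; omega) h1 hdel).frame.imp ?_
    rintro t₂ s₂ ⟨⟨ht₂, hF₂⟩, hr₂, ha₂⟩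
    have hreg₂ : ∀ r, r = .n ∨ (∃ j > 20, r = .tmp j) → s₂.reg r = s.reg r := by
      intro r hr
      rw [← hreg₁ r hr]
      apply hr₂
      rcases hr with rfl | ⟨j, hj, rfl⟩
      · rfl
      · exact keeps_componentsProg.1 j hj
    have harr₂ : ∀ a, a = .adj ∨ (∃ j > 22, a = .tmp j) → s₂.arr a = s.arr a := by
      rintro a (rfl | ⟨j, hj, rfl⟩)
      · exact (ha₂ _ rfl).trans (ha₁ _ (by decide))
      · rw [ha₂ _ (keeps_componentsProg.2 j (by omega)),
          State.setArr_of_ne _ _ _ _ (by simp; omega), ha₁ _ (by simp; omega)]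
    have hres := hF₂.isStronglyBiconnected_iff
    have hbr : BridgePair G x y ↔ ¬ (G.deleteEdge b).IsStronglyBiconnected :=
      ⟨fun ⟨_, _, h⟩ => h.2, fun h => ⟨hxn, hyn, hG, h⟩⟩
    rw [runs_block_singleton, runs_ite]
    simp only [Cond.holds, Cond.cost, Expr.eval, Expr.cost, hreg₂ .n (Or.inl rfl), hn, ← hres]
    refine ⟨fun hsb => ?_, fun hsb => ?_⟩
    · rw [runs_skip]
      refine ⟨by nlinarith, hreg₂, fun a ha => harr₂ a ?_, fun u v => ?_⟩
      · exact ha.imp_right fun ⟨j, hj, h⟩ => ⟨j, by omega, h⟩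
      · rw [harr₂ _ (Or.inr ⟨23, by omega, rfl⟩), if_neg]
        rintro ⟨rfl, rfl, h⟩
        exact hbr.1 h hsb
    · rw [runs_store]
      simp only [Expr.eval, Expr.cost, hreg₂ (.tmp p) (Or.inr ⟨p, by omega, rfl⟩),
        hreg₂ (.tmp q) (Or.inr ⟨q, by omega, rfl⟩), hx, hy]
      refine ⟨by nlinarith, hreg₂, fun a ha => ?_, fun u v => ?_⟩
      · rw [State.setArr_of_ne, harr₂ a]
        · exact ha.imp_right fun ⟨j, hj, h⟩ => ⟨j, by omega, h⟩
        · rcases ha with rfl | ⟨j, hj, rfl⟩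
          · decide
          · simp; omega
      · rw [State.setArr_arr, harr₂ _ (Or.inr ⟨23, by omega, rfl⟩)]
        have := hbr.2 hsb
        by_cases hu : u = x <;> by_cases hv : v = y <;> simp [hu, hv, this]
  · rw [runs_skip]
    refine ⟨by nlinarith, fun _ _ => rfl, fun _ _ => rfl, fun u v => ?_⟩
    rw [if_neg]
    rintro ⟨rfl, rfl, _, _, h⟩
    exact hG h.1

/-- Test the edges recorded by the last search, in both directions. The list of these edges is first
copied to the arrays `tmp 24` and `tmp 25`, since the tests run searches themselves. -/
def testRecorded : Prog :=
  block
    [ .assign (.tmp 21) (.reg (.tmp 5)),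
      forLt (.tmp 22) (.reg (.tmp 21))
        (.store (.tmp 24) (.reg (.tmp 22)) (.const 0) (entry (.tmp 6) (.tmp 22))),
      forLt (.tmp 22) (.reg (.tmp 21))
        (.store (.tmp 25) (.reg (.tmp 22)) (.const 0) (entry (.tmp 7) (.tmp 22))),
      forLt (.tmp 22) (.reg (.tmp 21))
        (block
          [ .assign (.tmp 23) (entry (.tmp 24) (.tmp 22)),
            .assign (.tmp 24) (entry (.tmp 25) (.tmp 22)),
            testEdge (.tmp 23) (.tmp 24),
            testEdge (.tmp 24) (.tmp 23) ]) ]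

lemma ite_or {a b c d : Prop} [Decidable a] [Decidable b] [Decidable c] [Decidable d] {z : ℕ}
    (h : d ↔ a ∨ b ∨ c) :
    (if a then 1 else if b then 1 else if c then 1 else z) = if d then 1 else z := by
  by_cases ha : a <;> by_cases hb : b <;> by_cases hc : c <;> simp [ha, hb, hc, h]

lemma exists_lt_succ_and_iff {Q : ℕ → Prop} {B : Prop} {i u v x y : ℕ}
    (hi : Q i ↔ (x = u ∧ y = v) ∨ (x = v ∧ y = u)) : ((∃ i' < i + 1, Q i') ∧ B) ↔
      (u = y ∧ v = x ∧ B) ∨ (u = x ∧ v = y ∧ B) ∨ ((∃ i' < i, Q i') ∧ B) := by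
  have hex : (∃ i' < i + 1, Q i') ↔ (u = y ∧ v = x) ∨ (u = x ∧ v = y) ∨ ∃ i' < i, Q i' := by
    constructor
    · rintro ⟨i', hi', h⟩
      rcases Nat.lt_succ_iff_lt_or_eq.1 hi' with hi' | rfl
      · exact Or.inr (Or.inr ⟨i', hi', h⟩)
      · rcases hi.1 h with ⟨h1, h2⟩ | ⟨h1, h2⟩
        · exact Or.inr (Or.inl ⟨h1.symm, h2.symm⟩)
        · exact Or.inl ⟨h2.symm, h1.symm⟩
    · rintro (⟨h1, h2⟩ | ⟨h1, h2⟩ | ⟨i', hi', h⟩)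
      · exact ⟨i, Nat.lt_succ_self i, hi.2 (Or.inr ⟨h2.symm, h1.symm⟩)⟩
      · exact ⟨i, Nat.lt_succ_self i, hi.2 (Or.inl ⟨h1.symm, h2.symm⟩)⟩
      · exact ⟨i', Nat.lt_succ_of_lt hi', h⟩
  rw [hex, or_and_right, or_and_right, and_assoc, and_assoc]

open Classical in
lemma runs_testRecorded {G : Digraph (Fin n)} (h1 : 1 ≤ n) (hs : s.HoldsDigraph .adj G)
    (hcnt : s.reg (.tmp 5) ≤ 3 * n)
    (hrec : ∀ x y, s.toSearch.Rec x y → x < n ∧ y < n) :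
    Runs testRecorded s fun t s' => t ≤ 130000 * n ^ 3 ∧ s'.HoldsDigraph .adj G ∧
      ∀ u v, s'.arr (.tmp 23) u v =
        if s.toSearch.SymRec u v ∧ BridgePair G u v then 1 else s.arr (.tmp 23) u v := by
  set m := s.reg (.tmp 5) with hm
  rw [testRecorded, runs_block_cons, runs_assign, runs_block_cons]
  refine (Runs.fillColumn (a := .tmp 24) (m := m) (T := 20) (f := s.toSearch.lu) ?_ ?_).imp ?_
  · intro s' hr _
    simp [Expr.eval, hr, hm]
  · intro i hi s' hr ha _ hi'
    rw [runs_store]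
    simp only [Expr.eval, Expr.cost, hi', ha (.tmp 6) (by decide)]
    exact ⟨by omega, rfl⟩
  rintro t₁ s₁ ⟨ht₁, hr₁, ha₁, hm₁⟩
  have hr₁' : ∀ r, r ≠ .tmp 21 → r ≠ .tmp 22 → s₁.reg r = s.reg r := fun r h h' => by
    rw [hr₁ r h', State.setReg_of_ne _ _ h]
  have hr₁'' : s₁.reg (.tmp 21) = m := by
    rw [hr₁ _ (by decide), State.setReg_self]
    rfl
  rw [runs_block_cons]
  refine (Runs.fillColumn (a := .tmp 25) (m := m) (T := 20) (f := s.toSearch.lw) ?_ ?_).imp ?_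
  · intro s' hr _
    simp [Expr.eval, hr, hr₁'']
  · intro i hi s' hr ha _ hi'
    rw [runs_store]
    simp only [Expr.eval, Expr.cost, hi', ha (.tmp 7) (by decide), ha₁ (.tmp 7) (by decide)]
    exact ⟨by omega, rfl⟩
  rintro t₂ s₂ ⟨ht₂, hr₂, ha₂, hm₂⟩
  have hlu : ∀ i < m, s₂.arr (.tmp 24) i 0 = s.toSearch.lu i := by
    intro i hi
    rw [ha₂ _ (by decide), hm₁]
    simp [hi]
  have hlw : ∀ i < m, s₂.arr (.tmp 25) i 0 = s.toSearch.lw i := by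
    intro i hi
    rw [hm₂]
    simp [hi]
  have hs₂ : s₂.HoldsDigraph .adj G := by
    unfold State.HoldsDigraph
    rw [hr₂ _ (by decide), hr₁' _ (by decide) (by decide), ha₂ _ (by decide), ha₁ _ (by decide)]
    exact hs
  have hmark : s₂.arr (.tmp 23) = s.arr (.tmp 23) := by
    rw [ha₂ _ (by decide), ha₁ _ (by decide)]
    rfl
  rw [runs_block_singleton]
  refine (Runs.forLt (m := m) (T := 42100 * n ^ 2) (fun i s' => s'.reg (.tmp 21) = m ∧
    s'.HoldsDigraph .adj G ∧ s'.arr (.tmp 24) = s₂.arr (.tmp 24) ∧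
    s'.arr (.tmp 25) = s₂.arr (.tmp 25) ∧ ∀ u v, s'.arr (.tmp 23) u v =
      if (∃ i' < i, (s.toSearch.lu i' = u ∧ s.toSearch.lw i' = v) ∨
        (s.toSearch.lu i' = v ∧ s.toSearch.lw i' = u)) ∧ BridgePair G u v then 1
      else s.arr (.tmp 23) u v) ?_ ?_ ?_).imp ?_
  · refine ⟨?_, hs₂, rfl, rfl, ?_⟩
    · rw [State.setReg_of_ne _ _ (by decide), hr₂ _ (by decide), hr₁'']
    · simp [hmark]
  · rintro i s' ⟨h, -⟩
    exact h
  · rintro i hi s' ⟨h21, hs', h24, h25, h23⟩ hi'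
    rw [runs_block_cons, runs_assign, runs_block_cons, runs_assign]
    simp only [Expr.eval, Expr.cost, State.setReg_arr, hi', h24, h25, hlu i hi, hlw i hi,
      State.setReg_of_ne s' (s.toSearch.lu i) (show Reg.tmp 22 ≠ .tmp 23 by decide)]
    set x := s.toSearch.lu i with hx
    set y := s.toSearch.lw i with hy
    obtain ⟨hxn, hyn⟩ := hrec x y ⟨i, hi, rfl, rfl⟩
    set s₃ := (s'.setReg (.tmp 23) x).setReg (.tmp 24) y with hs₃
    have hs₃' : s₃.HoldsDigraph .adj G := hs'
    rw [runs_block_cons]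
    refine (runs_testEdge (p := 23) (q := 24) (by omega) (by omega) h1 hs₃' (x := x) (y := y)
      (by simp [hs₃, State.setReg_reg]) (by simp [hs₃]) hxn hyn).imp ?_
    rintro t₄ s₄ ⟨ht₄, hr₄, ha₄, hm₄⟩
    have hs₄ : s₄.HoldsDigraph .adj G := by
      unfold State.HoldsDigraph
      rw [hr₄ _ (Or.inl rfl), ha₄ _ (Or.inl rfl)]
      exact hs₃'
    have h23₄ : s₄.reg (.tmp 23) = x := by
      rw [hr₄ _ (Or.inr ⟨23, by omega, rfl⟩)]
      simp [hs₃, State.setReg_reg]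
    have h24₄ : s₄.reg (.tmp 24) = y := by
      rw [hr₄ _ (Or.inr ⟨24, by omega, rfl⟩)]
      simp [hs₃]
    rw [runs_block_singleton]
    refine (runs_testEdge (p := 24) (q := 23) (by omega) (by omega) h1 hs₄ h24₄ h23₄ hyn hxn).imp ?_
    rintro t₅ s₅ ⟨ht₅, hr₅, ha₅, hm₅⟩
    refine ⟨by nlinarith, ?_, ?_, ?_, ?_, ?_, fun u v => ?_⟩
    · rw [hr₅ _ (Or.inr ⟨22, by omega, rfl⟩), hr₄ _ (Or.inr ⟨22, by omega, rfl⟩), ← hi']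
      simp [hs₃, State.setReg_reg]
    · rw [State.setReg_of_ne _ _ (by decide), hr₅ _ (Or.inr ⟨21, by omega, rfl⟩),
        hr₄ _ (Or.inr ⟨21, by omega, rfl⟩), ← h21]
      simp [hs₃, State.setReg_reg]
    · unfold State.HoldsDigraph
      rw [State.setReg_of_ne _ _ (by decide), State.setReg_arr, hr₅ _ (Or.inl rfl),
        ha₅ _ (Or.inl rfl)]
      exact hs₄
    · rw [ha₅ _ (Or.inr ⟨24, by omega, rfl⟩),
        ha₄ _ (Or.inr ⟨24, by omega, rfl⟩), ← h24]
      rfl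
    · rw [ha₅ _ (Or.inr ⟨25, by omega, rfl⟩),
        ha₄ _ (Or.inr ⟨25, by omega, rfl⟩), ← h25]
      rfl
    · have h23' : s₃.arr (.tmp 23) u v = _ := h23 u v
      rw [hm₅, hm₄, h23']
      exact ite_or (exists_lt_succ_and_iff (Q := fun i' =>
        (s.toSearch.lu i' = u ∧ s.toSearch.lw i' = v) ∨
        (s.toSearch.lu i' = v ∧ s.toSearch.lw i' = u)) Iff.rfl)
  · rintro t s' ⟨ht, -, -, hs', -, -, h23⟩
    refine ⟨?_, hs', fun u v => ?_⟩
    · simp only [Expr.cost] at *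
      have h2 : m * (42100 * n ^ 2 + 1 + 7) ≤ (3 * n) * (42100 * n ^ 2 + 8 * n ^ 2) := by
        have h4 : 1 ≤ n ^ 2 := Nat.one_le_pow _ _ h1
        exact Nat.mul_le_mul hcnt (by omega)
      have h3 : n ≤ n ^ 3 := Nat.le_self_pow (by norm_num) n
      have h4 : 3 * n * (42100 * n ^ 2 + 8 * n ^ 2) = 126324 * n ^ 3 := by ring
      omega
    · rw [h23]
      congr 1
      simp only [Search.SymRec, Search.Rec, eq_iff_iff]
      refine and_congr_left fun _ => ⟨?_, ?_⟩
      · rintro ⟨i, hi, h | h⟩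
        · exact Or.inl ⟨i, hi, h⟩
        · exact Or.inr ⟨i, hi, h⟩
      · rintro (⟨i, hi, h⟩ | ⟨i, hi, h⟩)
        · exact ⟨i, hi, Or.inl h⟩
        · exact ⟨i, hi, Or.inr h⟩

end RAM

namespace RAM

variable {s : State} {n : ℕ}

/-- List the pairs marked in the array `tmp 23` in the array `bridge`. -/
def collectMarked : Prog :=
  .seq (.assign .numBridges (.const 0))
    (pairLoop (.tmp 8) (.tmp 9)
      (.ite (.eq (.get (.tmp 23) (.reg (.tmp 8)) (.reg (.tmp 9))) (.const 1))
        (block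
          [ .store .bridge (.reg .numBridges) (.const 0) (.reg (.tmp 8)),
            .store .bridge (.reg .numBridges) (.const 1) (.reg (.tmp 9)),
            .assign .numBridges (.succ (.reg .numBridges)) ])
        .skip))

lemma runs_collectMarked (hn : s.reg .n = n) :
    Runs collectMarked s fun t s' => t ≤ n * (n * 40 + 16) + 12 ∧
      Set.BijOn (fun i => (s'.arr .bridge i 0, s'.arr .bridge i 1)) (Set.Iio (s'.reg .numBridges))
        {p | p.1 < n ∧ p.2 < n ∧ s.arr (.tmp 23) p.1 p.2 = 1} := by
  rw [collectMarked, runs_seq, runs_assign]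
  refine (Runs.forLt_forLt (m := n) (T := 32) (fun x y s' => s'.reg .n = n ∧
    s'.arr (.tmp 23) = s.arr (.tmp 23) ∧
    Set.BijOn (fun i => (s'.arr .bridge i 0, s'.arr .bridge i 1)) (Set.Iio (s'.reg .numBridges))
      {p | (p.1 < x ∨ p.1 = x ∧ p.2 < y) ∧ p.2 < n ∧ s.arr (.tmp 23) p.1 p.2 = 1})
    (by decide) ?_ ?_ ?_ ?_ ?_ ?_).imp ?_
  · intro x y s' v h
    simpa [State.setReg_reg] using h
  · intro x y s' v h
    simpa [State.setReg_reg] using h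
  · refine ⟨hn, rfl, ?_⟩
    simp only [Expr.eval, State.setReg_self]
    convert Set.bijOn_empty _ using 1
    · ext i; simp
    · ext p; simp
  · rintro x s' ⟨h1, h2, h3⟩
    refine ⟨h1, h2, ?_⟩
    convert h3 using 1
    ext p
    simp only [Set.mem_ofPred_eq]
    constructor
    · rintro ⟨h, h'⟩
      exact ⟨by omega, h'⟩
    · rintro ⟨h, h'⟩
      exact ⟨by omega, h'⟩
  · rintro x y s' ⟨h, -⟩
    exact h
  · rintro x hx y hy s' ⟨h1, h2, h3⟩ hrx hry
    rw [runs_ite]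
    simp only [Cond.holds, Cond.cost, Expr.eval, Expr.cost, hrx, hry, h2]
    refine ⟨fun hmark => ?_, fun hmark => ?_⟩
    · simp only [runs_block_cons, runs_block_singleton, runs_store, runs_assign, Expr.eval,
        Expr.cost, State.setArr_reg, hrx, hry]
      set N := s'.reg .numBridges with hN
      refine ⟨by omega, ?_, ?_, ?_, ?_, ?_⟩
      · simp [State.setReg_reg, hrx]
      · simp [State.setReg_reg, hry]
      · simp [State.setReg_reg, h1]
      · rw [State.setReg_arr, State.setArr_of_ne _ _ _ _ (by decide),
          State.setArr_of_ne _ _ _ _ (by decide), h2]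
      · simp only [State.setReg_self, State.setReg_arr]
        have hdom : Set.Iio (N + 1) = insert N (Set.Iio N) := by
          ext i
          simp only [Set.mem_Iio, Set.mem_insert_iff]
          omega
        have hcod : {p : ℕ × ℕ | (p.1 < x ∨ p.1 = x ∧ p.2 < y + 1) ∧ p.2 < n ∧
            s.arr (.tmp 23) p.1 p.2 = 1} = insert (x, y) {p : ℕ × ℕ |
              (p.1 < x ∨ p.1 = x ∧ p.2 < y) ∧ p.2 < n ∧ s.arr (.tmp 23) p.1 p.2 = 1} := by
          ext ⟨u, v⟩
          simp only [Set.mem_insert_iff, Set.mem_ofPred_eq, Prod.mk.injEq]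
          constructor
          · rintro ⟨h, h'⟩
            by_cases huv : u = x ∧ v = y
            · exact Or.inl huv
            · exact Or.inr ⟨by omega, h'⟩
          · rintro (⟨rfl, rfl⟩ | ⟨h, h'⟩)
            · exact ⟨by omega, hy, hmark⟩
            · exact ⟨by omega, h'⟩
        rw [hdom, hcod]
        have h3' : Set.BijOn (fun i =>
            ((((s'.setArr .bridge N 0 x).setArr .bridge N 1 y).arr .bridge i 0),
              (((s'.setArr .bridge N 0 x).setArr .bridge N 1 y).arr .bridge i 1))) (Set.Iio N)
            {p : ℕ × ℕ | (p.1 < x ∨ p.1 = x ∧ p.2 < y) ∧ p.2 < n ∧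
              s.arr (.tmp 23) p.1 p.2 = 1} := by
          refine h3.congr fun i hi => ?_
          have : i ≠ N := Nat.ne_of_lt hi
          simp [State.setArr_arr, this]
        have hval : ((((s'.setArr .bridge N 0 x).setArr .bridge N 1 y).arr .bridge N 0),
              (((s'.setArr .bridge N 0 x).setArr .bridge N 1 y).arr .bridge N 1)) = (x, y) := by
          simp [State.setArr_arr]
        rw [← hval]
        refine h3'.insert ?_
        rw [hval]
        rintro ⟨h, -⟩
        simp at h
    · rw [runs_skip]
      refine ⟨by omega, hrx, hry, h1, h2, ?_⟩
      convert h3 using 1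
      ext ⟨u, v⟩
      simp only [Set.mem_ofPred_eq]
      constructor
      · rintro ⟨h, h', h''⟩
        refine ⟨?_, h', h''⟩
        have : ¬ (u = x ∧ v = y) := by
          rintro ⟨rfl, rfl⟩
          exact hmark h''
        omega
      · rintro ⟨h, h'⟩
        exact ⟨by omega, h'⟩
  · rintro t s' ⟨ht, -, -, h⟩
    refine ⟨?_, ?_⟩
    · simp only [Expr.cost] at *
      linarith
    · convert h using 1
      ext p
      simp only [Set.mem_ofPred_eq]
      constructor
      · rintro ⟨h, h'⟩
        exact ⟨Or.inl h, h'⟩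
      · rintro ⟨h, h'⟩
        exact ⟨by omega, h'⟩

/-- Compute the b-bridges of a strongly biconnected digraph: only the edges recorded by the search
on the digraph and by the search on its underlying graph have to be tested. -/
def bridgesProg : Prog :=
  block
    [ pairLoop (.tmp 8) (.tmp 9)
        (.store (.tmp 23) (.reg (.tmp 8)) (.reg (.tmp 9)) (.const 0)),
      copyMatrix .adj (.tmp 0),
      searchProg false,
      testRecorded,
      symmetrize .adj (.eq (.const 0) (.const 0)),
      searchProg true,
      testRecorded,
      collectMarked ]

open Classical in
lemma runs_bridgesProg {G : Digraph (Fin n)} (hG : G.IsStronglyBiconnected)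
    (hs : s.HoldsDigraph .adj G) :
    Runs bridgesProg s fun t s' => t ≤ 300000 * n ^ 3 ∧ s'.HoldsBridges G := by
  have hn := hs.1
  have h1 : 1 ≤ n := by
    obtain ⟨x⟩ := hG.1.1
    exact Nat.one_le_of_lt x.2
  rw [bridgesProg, runs_block_cons]
  refine (Runs.fillSquare (n := n) (T := 10) (a := .tmp 23) (f := fun _ _ => 0) hn
    (by decide) (by decide) (by decide) ?_).imp ?_
  · intro x hx y hy s' _ _ _ hrx hry
    simp [runs_store, Expr.eval, Expr.cost, hrx, hry]
  rintro t₁ s₁ ⟨ht₁, hr₁, ha₁, hm₁⟩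
  have hs₁ : s₁.HoldsDigraph .adj G := by
    unfold State.HoldsDigraph
    rw [hr₁ _ (by decide) (by decide), ha₁ _ (by decide)]
    exact hs
  rw [runs_block_cons]
  refine (runs_copyMatrix (by decide) hs₁.1).imp ?_
  rintro t₂ s₂ ⟨ht₂, hr₂, ha₂, hm₂⟩
  have hs₂ : s₂.HoldsDigraph .adj G := by
    unfold State.HoldsDigraph
    rw [hr₂ _ (by decide) (by decide), ha₂ _ (by decide)]
    exact hs₁
  have hE₂ : ∀ x y : Fin n, s₂.Edge x y ↔ G.Adj x y := by
    intro x y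
    rw [State.Edge, hm₂ x x.2 y y.2, hs₁.edge_iff]
  rw [runs_block_cons]
  refine (runs_searchProg_scc hs₂.1 h1).frame.imp ?_
  rintro t₃ s₃ ⟨⟨ht₃, r₃, hcnt₃⟩, hr₃, ha₃⟩
  have hs₃ : s₃.HoldsDigraph .adj G := by
    unfold State.HoldsDigraph
    rw [hr₃ _ rfl, ha₃ _ rfl]
    exact hs₂
  have hm₃ : s₃.arr (.tmp 23) = s₁.arr (.tmp 23) := by
    rw [ha₃ _ rfl, ha₂ _ (by decide)]
  rw [runs_block_cons]
  refine (runs_testRecorded h1 hs₃ hcnt₃ fun x y h =>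
    ⟨(r₃.inv.edge_of_rec h).1, (r₃.inv.edge_of_rec h).2.1⟩).imp ?_
  rintro t₄ s₄ ⟨ht₄, hs₄, hm₄⟩
  rw [runs_block_cons]
  refine (runs_symmetrize (P := fun _ _ => True) (by decide) hs₄.1 ?_).imp ?_
  · intro x hx y hy s' _ _ _
    simp [Cond.holds]
  rintro t₅ s₅ ⟨ht₅, hr₅, ha₅, hE₅⟩
  have hs₅ : s₅.HoldsDigraph .adj G := by
    unfold State.HoldsDigraph
    rw [hr₅ _ (by decide) (by decide), ha₅ _ (by decide)]
    exact hs₄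
  have hsym : ∀ x y : Fin n, s₅.Edge x y ↔ G.SymAdj x y := by
    intro x y
    rw [hE₅ x x.2 y y.2, hs₄.edge_iff, hs₄.edge_iff]
    simp [Digraph.symAdj_iff, Fin.ext_iff]
  rw [runs_block_cons]
  refine (runs_searchProg_bcc hs₅.1 h1).frame.imp ?_
  rintro t₆ s₆ ⟨⟨ht₆, r₆, hcnt₆⟩, hr₆, ha₆⟩
  have hs₆ : s₆.HoldsDigraph .adj G := by
    unfold State.HoldsDigraph
    rw [hr₆ _ rfl, ha₆ _ rfl]
    exact hs₅
  rw [runs_block_cons]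
  refine (runs_testRecorded h1 hs₆ hcnt₆ fun x y h =>
    ⟨(r₆.inv.edge_of_rec h).1, (r₆.inv.edge_of_rec h).2.1⟩).imp ?_
  rintro t₇ s₇ ⟨ht₇, hs₇, hm₇⟩
  have hmark : ∀ x < n, ∀ y < n, s₇.arr (.tmp 23) x y = 1 ↔ BridgePair G x y := by
    intro x hx y hy
    rw [hm₇, ha₆ _ rfl, ha₅ _ (by decide), hm₄, hm₃, hm₁]
    constructor
    · intro h
      by_contra hb
      simp [hb, hx, hy] at h
    · intro hb
      by_cases h₆ : s₆.toSearch.SymRec x y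
      · simp [h₆, hb]
      by_cases h₃ : s₃.toSearch.SymRec x y
      · simp [h₃, hb]
      obtain ⟨_, _, hb⟩ := hb
      exact absurd (r₃.isStronglyBiconnected_deleteEdge hG hE₂ r₆ hsym
        (fun h => h₃ (Or.inl h)) h₆) hb.2
  rw [runs_block_singleton]
  refine (runs_collectMarked hs₇.1).imp ?_
  rintro t₈ s₈ ⟨ht₈, hb₈⟩
  refine ⟨?_, ?_⟩
  · simp only [Cond.cost, Expr.cost] at *
    have e1 : n ≤ n ^ 3 := Nat.le_self_pow (by norm_num) n
    have e2 : n ^ 2 ≤ n ^ 3 := Nat.pow_le_pow_right h1 (by norm_num)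
    have e3 : 1 ≤ n ^ 3 := Nat.one_le_pow _ _ h1
    nlinarith
  · unfold State.HoldsBridges
    convert hb₈ using 1
    ext ⟨x, y⟩
    simp only [Set.mem_ofPred_eq]
    constructor
    · rintro ⟨b, hb, h⟩
      obtain ⟨rfl, rfl⟩ := Prod.mk.inj h
      exact ⟨b.1.2, b.2.2, (hmark _ b.1.2 _ b.2.2).2 ⟨b.1.2, b.2.2, hb⟩⟩
    · rintro ⟨hx, hy, h⟩
      obtain ⟨_, _, hb⟩ := (hmark x hx y hy).1 h
      exact ⟨_, hb, rfl⟩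

lemma computesBBridges_bridgesProg : ComputesBBridges bridgesProg fun n => 300000 * n ^ 3 := by
  intro n G hG s hs
  obtain ⟨t, s', hex, ⟨ht, hF⟩, hr, ha⟩ := (runs_bridgesProg hG hs).frame
  refine ⟨t, s', hex, ht, hF, fun r h1 h2 => ?_, fun a h1 h2 => ?_⟩
  · cases r with
    | numBridges => simp at h1
    | tmp j => exact absurd rfl (h2 j)
    | _ => exact hr _ rfl
  · cases a with
    | bridge => simp at h1
    | tmp j => exact absurd rfl (h2 j)
    | _ => exact ha _ rfl

end RAM

/-! ### The number of b-bridges -/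

namespace RAM

variable {s : State} {n : ℕ}

open Classical in
lemma exists_sccResult (h1 : 1 ≤ n) (E : ℕ → ℕ → Prop) :
    ∃ σ : Search, σ.SccResult n E ∧ σ.cnt ≤ 3 * n := by
  let s : State := ⟨fun _ => n, fun _ u v => if E u v then 1 else 0⟩
  obtain ⟨_, s', -, -, h, hc⟩ := runs_searchProg_scc (s := s) rfl h1
  have hE : s.Edge = E := by
    funext u v
    simp [State.Edge, s]
  exact ⟨s'.toSearch, hE ▸ h, hc⟩

open Classical in
lemma exists_bccResult (h1 : 1 ≤ n) (E : ℕ → ℕ → Prop) :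
    ∃ σ : Search, σ.BccResult n E ∧ σ.cnt ≤ 3 * n := by
  let s : State := ⟨fun _ => n, fun _ u v => if E u v then 1 else 0⟩
  obtain ⟨_, s', -, -, h, hc⟩ := runs_searchProg_bcc (s := s) rfl h1
  have hE : s.Edge = E := by
    funext u v
    simp [State.Edge, s]
  exact ⟨s'.toSearch, hE ▸ h, hc⟩

lemma ncard_setOf_rec_le (σ : Search) : {p : ℕ × ℕ | σ.Rec p.1 p.2}.Finite ∧
    {p : ℕ × ℕ | σ.Rec p.1 p.2}.ncard ≤ σ.cnt := by
  have h : {p : ℕ × ℕ | σ.Rec p.1 p.2} = (fun i => (σ.lu i, σ.lw i)) '' Set.Iio σ.cnt := by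
    ext ⟨x, y⟩
    simp [Search.Rec, Prod.ext_iff]
  rw [h]
  refine ⟨(Set.finite_Iio _).image _, (Set.ncard_image_le (Set.finite_Iio _)).trans ?_⟩
  rw [Set.ncard_eq_toFinset_card']
  simp

/-- A strongly biconnected digraph has only linearly many b-bridges, since each of them is recorded
by one of two searches. -/
lemma State.HoldsBridges.numBridges_le {G : Digraph (Fin n)} (hG : G.IsStronglyBiconnected)
    (h : s.HoldsBridges G) : s.reg .numBridges ≤ 9 * n := by
  have h1 : 1 ≤ n := by
    obtain ⟨x⟩ := hG.1.1
    exact Nat.one_le_of_lt x.2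
  obtain ⟨σ, r, hc⟩ := exists_sccResult h1 fun x y =>
    ∃ (hx : x < n) (hy : y < n), G.Adj ⟨x, hx⟩ ⟨y, hy⟩
  obtain ⟨σ', r', hc'⟩ := exists_bccResult h1 fun x y =>
    ∃ (hx : x < n) (hy : y < n), G.SymAdj ⟨x, hx⟩ ⟨y, hy⟩
  obtain ⟨hf, hle⟩ := ncard_setOf_rec_le σ
  obtain ⟨hf', hle'⟩ := ncard_setOf_rec_le σ'
  have hsub : {p : ℕ × ℕ | ∃ b : Fin n × Fin n, G.IsBBridge b ∧ p = ((b.1 : ℕ), (b.2 : ℕ))} ⊆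
      {p : ℕ × ℕ | σ.Rec p.1 p.2} ∪ ({p : ℕ × ℕ | σ'.Rec p.1 p.2} ∪
        Prod.swap '' {p : ℕ × ℕ | σ'.Rec p.1 p.2}) := by
    rintro _ ⟨b, hb, rfl⟩
    by_contra hn
    simp only [Set.mem_union, Set.mem_ofPred_eq, Set.mem_image, not_or] at hn
    refine hb.2 (r.isStronglyBiconnected_deleteEdge hG ?_ r' ?_ hn.1 ?_)
    · intro x y
      simp
    · intro x y
      simp
    · rintro (h | h)
      · exact hn.2.1 h
      · exact hn.2.2 ⟨(b.2, b.1), h, rfl⟩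
  have hcard := h.image_eq ▸ h.injOn.ncard_image
  have hIio : (Set.Iio (s.reg .numBridges)).ncard = s.reg .numBridges := by
    rw [Set.ncard_eq_toFinset_card']
    simp
  rw [hIio] at hcard
  rw [← hcard]
  refine (Set.ncard_le_ncard hsub (hf.union (hf'.union (hf'.image _)))).trans ?_
  have e1 := Set.ncard_union_le {p : ℕ × ℕ | σ.Rec p.1 p.2} ({p : ℕ × ℕ | σ'.Rec p.1 p.2} ∪
        Prod.swap '' {p : ℕ × ℕ | σ'.Rec p.1 p.2})
  have e2 := Set.ncard_union_le {p : ℕ × ℕ | σ'.Rec p.1 p.2}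
    (Prod.swap '' {p : ℕ × ℕ | σ'.Rec p.1 p.2})
  have e3 : (Prod.swap '' {p : ℕ × ℕ | σ'.Rec p.1 p.2}).ncard ≤ _ := Set.ncard_image_le hf'
  omega

/-! ### The main algorithm -/

/-- The sizes of sets that pairwise share at most one point: a pair of distinct points lies in at
most one of the sets, so that the squares of the sizes sum up to `O(n ^ 2)`. -/
lemma sum_ncard_sq_le {ι : Type*} (I : Finset ι) (C : ι → Set (Fin n))
    (hne : ∀ i ∈ I, (C i).Nonempty) (hinj : Set.InjOn C I)
    (hmeet : ∀ i ∈ I, ∀ j ∈ I, ∀ x y, x ≠ y → x ∈ C i → y ∈ C i → x ∈ C j → y ∈ C j → C i = C j) :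
    ∑ i ∈ I, (C i).ncard ^ 2 ≤ 2 * n ^ 2 := by
  classical
  -- The singletons among the sets are represented by the pairs `(x, x)`.
  let P : ι → Finset (Fin n × Fin n) := fun i =>
    {p | p.1 ∈ C i ∧ p.2 ∈ C i ∧ (p.1 = p.2 → (C i).Subsingleton)}
  have hP : ∀ i ∈ I, (C i).ncard ^ 2 ≤ 2 * (P i).card := by
    intro i hi
    rcases (C i).subsingleton_or_nontrivial with hs | hs
    · obtain ⟨x, hx⟩ := hne i hi
      have h1 : C i = {x} := hs.eq_singleton_of_mem hx
      have h2 : 0 < (P i).card := Finset.card_pos.2 ⟨(x, x), by simp [P, hx, hs]⟩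
      rw [h1, Set.ncard_singleton]
      omega
    · have hsub : (C i).toFinset.offDiag ⊆ P i := by
        rintro ⟨x, y⟩ h
        simp only [Finset.mem_offDiag, Set.mem_toFinset] at h
        simp [P, h.1, h.2.1, h.2.2]
      have h1 := Finset.card_le_card hsub
      rw [Finset.offDiag_card, ← Set.ncard_eq_toFinset_card'] at h1
      have h2 : 2 ≤ (C i).ncard := (Set.one_lt_ncard_iff_nontrivial).2 hs
      have h3 : 2 * (C i).ncard ≤ (C i).ncard * (C i).ncard := Nat.mul_le_mul_right _ h2
      rw [sq]
      omega
  have hdisj : (I : Set ι).PairwiseDisjoint P := by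
    intro i hi j hj hij
    rw [Function.onFun, Finset.disjoint_left]
    rintro ⟨x, y⟩ h1 h2
    simp only [P, Finset.mem_filter, Finset.mem_univ, true_and] at h1 h2
    refine hij (hinj hi hj ?_)
    by_cases hxy : x = y
    · rw [(h1.2.2 hxy).eq_singleton_of_mem h1.1, (h2.2.2 hxy).eq_singleton_of_mem h2.1]
    · exact hmeet i hi j hj x y hxy h1.1 h1.2.1 h2.1 h2.2.1
  calc ∑ i ∈ I, (C i).ncard ^ 2 ≤ ∑ i ∈ I, 2 * (P i).card := Finset.sum_le_sum hP
    _ = 2 * (I.biUnion P).card := by rw [Finset.card_biUnion hdisj, Finset.mul_sum]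
    _ ≤ 2 * n ^ 2 := by
      have := (I.biUnion P).card_le_univ
      simp only [Fintype.card_prod, Fintype.card_fin] at this
      rw [sq]
      omega

end RAM

namespace RAM

variable {s : State} {n : ℕ}

open Classical in
/-- The triple loop that marks in `same` the pairs of vertices which lie in a common row. It takes
quadratic time if the rows list sets which pairwise share at most one vertex. -/
lemma runs_markRows {F : Set (Set (Fin n))} (hF : s.HoldsFamily .numComps .compSize .comp F)
    (hne : ∀ C ∈ F, C.Nonempty)
    (hmeet : ∀ C ∈ F, ∀ D ∈ F, ∀ x y, x ≠ y → x ∈ C → y ∈ C → x ∈ D → y ∈ D → C = D) :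
    Runs (forLt .i (.reg .numComps)
        (forLt .x (.get .compSize (.reg .i) (.const 0))
          (forLt .y (.get .compSize (.reg .i) (.const 0))
            (.store .same (.get .comp (.reg .i) (.reg .x)) (.get .comp (.reg .i) (.reg .y))
              (.const 1))))) s fun t s' => t ≤ 120 * n ^ 2 + 8 ∧
      (∀ r, r ≠ .i → r ≠ .x → r ≠ .y → s'.reg r = s.reg r) ∧
      (∀ a, a ≠ .same → s'.arr a = s.arr a) ∧
      ∀ x y : Fin n, s'.arr .same x y = if ∃ C ∈ F, x ∈ C ∧ y ∈ C then 1 else s.arr .same x y := by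
  set N := s.reg .numComps with hN
  set k : ℕ → ℕ := fun i => s.arr .compSize i 0 with hk
  set c : ℕ → Set (Fin n) := s.rowSet n .compSize .comp with hc
  refine (Runs.forLt_sum (m := N) (T := fun i => k i * (k i * 18 + 20) + 10) (fun i s' =>
    (∀ r, r ≠ .i → r ≠ .x → r ≠ .y → s'.reg r = s.reg r) ∧
    (∀ a, a ≠ .same → s'.arr a = s.arr a) ∧ ∀ x y : Fin n, s'.arr .same x y =
      if ∃ i' < i, x ∈ c i' ∧ y ∈ c i' then 1 else s.arr .same x y) ?_ ?_ ?_).imp ?_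
  · refine ⟨fun r hr _ _ => State.setReg_of_ne _ _ hr, fun _ _ => rfl, by simp⟩
  · rintro i s' ⟨h, -⟩
    exact h _ (by decide) (by decide) (by decide)
  · rintro i hi s' ⟨h1, h2, h3⟩ hri
    refine (Runs.forLt_forLt (m := k i) (T := 8) (fun p q s'' =>
      (∀ r, r ≠ .x → r ≠ .y → s''.reg r = s'.reg r) ∧
      (∀ a, a ≠ .same → s''.arr a = s.arr a) ∧ ∀ x y : Fin n, s''.arr .same x y =
        if ∃ p' q', (p' < p ∧ q' < k i ∨ p' = p ∧ q' < q) ∧ s.arr .comp i p' = x ∧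
          s.arr .comp i q' = y then 1 else s'.arr .same x y) (by decide) ?_ ?_ ?_ ?_ ?_ ?_).imp ?_
    · rintro p q s'' v ⟨h1, h⟩
      exact ⟨fun r hx hy => (State.setReg_of_ne _ _ hx).trans (h1 r hx hy), h⟩
    · rintro p q s'' v ⟨h1, h⟩
      exact ⟨fun r hx hy => (State.setReg_of_ne _ _ hy).trans (h1 r hx hy), h⟩
    · exact ⟨fun _ _ _ => rfl, h2, by simp⟩
    · rintro p s'' ⟨h1', h2', h3'⟩
      refine ⟨h1', h2', fun x y => ?_⟩
      rw [h3']
      congr 1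
      simp only [eq_iff_iff]
      refine exists₂_congr fun p' q' => and_congr_left fun _ => ?_
      omega
    · rintro p q s'' ⟨h1', h2', -⟩
      simp [Expr.eval, h1' .i (by decide) (by decide), hri, h2' .compSize (by decide), hk]
    · rintro p hp q hq s'' ⟨h1', h2', h3'⟩ hx hy
      rw [runs_store]
      simp only [Expr.eval, Expr.cost, h1' .i (by decide) (by decide), hri, hx, hy,
        h2' .comp (by decide)]
      refine ⟨by omega, hx, hy, h1', fun a ha => ?_, fun x y => ?_⟩
      · rw [State.setArr_of_ne _ _ _ _ ha]
        exact h2' a ha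
      · rw [State.setArr_arr, h3']
        simp only [true_and]
        by_cases hxy : (x : ℕ) = s.arr .comp i p ∧ (y : ℕ) = s.arr .comp i q
        · rw [if_pos hxy, if_pos]
          exact ⟨p, q, Or.inr ⟨rfl, by omega⟩, hxy.1.symm, hxy.2.symm⟩
        · rw [if_neg hxy]
          congr 1
          simp only [eq_iff_iff]
          refine exists₂_congr fun p' q' => and_congr_left fun h => ?_
          have : ¬ (p' = p ∧ q' = q) := by
            rintro ⟨rfl, rfl⟩
            exact hxy ⟨h.1.symm, h.2.symm⟩
          omega
    · rintro t s'' ⟨ht, h1', h2', h3'⟩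
      refine ⟨?_, ?_, fun r hi hx hy => ?_, h2', fun x y => ?_⟩
      · simpa [Expr.cost] using ht
      · rw [h1' _ (by decide) (by decide), hri]
      · rw [State.setReg_of_ne _ _ hi, h1' r hx hy, h1 r hi hx hy]
      · rw [State.setReg_arr, h3', h3]
        have hmem : (∃ p' q', (p' < k i ∧ q' < k i ∨ p' = k i ∧ q' < 0) ∧
            s.arr .comp i p' = x ∧ s.arr .comp i q' = y) ↔ x ∈ c i ∧ y ∈ c i := by
          constructor
          · rintro ⟨p, q, h, h'⟩
            have hp : p < k i := by omega
            have hq : q < k i := by omega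
            exact ⟨⟨p, hp, h'.1⟩, ⟨q, hq, h'.2⟩⟩
          · rintro ⟨⟨p, hp, hx⟩, ⟨q, hq, hy⟩⟩
            exact ⟨p, q, Or.inl ⟨hp, hq⟩, hx, hy⟩
        rw [if_congr hmem rfl rfl]
        by_cases hi' : x ∈ c i ∧ y ∈ c i
        · rw [if_pos hi', if_pos ⟨i, by omega, hi'⟩]
        · rw [if_neg hi']
          congr 1
          simp only [eq_iff_iff]
          constructor
          · rintro ⟨i', h, h'⟩
            exact ⟨i', by omega, h'⟩
          · rintro ⟨i', h, h'⟩
            refine ⟨i', ?_, h'⟩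
            have : i' ≠ i := by
              rintro rfl
              exact hi' h'
            omega
  · rintro t s' ⟨ht, -, h1, h2, h3⟩
    have hcF : ∀ i < N, c i ∈ F := fun i hi => hF.2.2.mapsTo hi
    refine ⟨?_, h1, h2, fun x y => ?_⟩
    · have hsum := sum_ncard_sq_le (Finset.range N) c
        (fun i hi => hne _ (hcF i (Finset.mem_range.1 hi)))
        (fun i hi j hj h => hF.2.2.injOn (Finset.mem_range.1 hi) (Finset.mem_range.1 hj) h)
        (fun i hi j hj x y => hmeet _ (hcF i (Finset.mem_range.1 hi)) _
          (hcF j (Finset.mem_range.1 hj)) x y)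
      have hle : ∑ i ∈ Finset.range N, (k i * (k i * 18 + 20) + 10 + 1 + 7) ≤
          ∑ i ∈ Finset.range N, 56 * (c i).ncard ^ 2 := by
        refine Finset.sum_le_sum fun i hi => ?_
        have hi := Finset.mem_range.1 hi
        have hcard : (c i).ncard = k i := hF.ncard_rowSet hi
        have hpos : 0 < (c i).ncard := (Set.ncard_pos).2 (hne _ (hcF i hi))
        rw [hcard] at hpos ⊢
        nlinarith
      rw [← Finset.mul_sum] at hle
      simp only [Expr.cost] at ht
      omega
    · rw [h3]
      congr 1
      simp only [eq_iff_iff]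
      constructor
      · rintro ⟨i, hi, h⟩
        exact ⟨_, hcF i hi, h⟩
      · rintro ⟨C, hC, h⟩
        obtain ⟨i, hi, rfl⟩ := hF.2.2.surjOn hC
        exact ⟨i, hi, h⟩

open Classical in
lemma runs_processBridge {findComponents : Prog} {c : ℕ}
    (hfc : ComputesComponents findComponents fun n => c * n ^ 2) {G : Digraph (Fin n)} (h1 : 1 ≤ n)
    {b : Fin n × Fin n} (hb : G.Adj b.1 b.2) (hs : s.HoldsDigraph .adj G)
    (hb1 : s.arr .bridge (s.reg .k) 0 = b.1) (hb2 : s.arr .bridge (s.reg .k) 1 = b.2) :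
    Runs (processBridge findComponents) s fun t s' => t ≤ (c + 400) * n ^ 2 ∧
      s'.HoldsDigraph .adj G ∧ s'.reg .k = s.reg .k ∧ s'.reg .numBridges = s.reg .numBridges ∧
      s'.arr .bridge = s.arr .bridge ∧ ∀ x y : Fin n, s'.arr .L x y =
        if ∃ C, (G.deleteEdge b).IsStronglyBiconnectedComponent C ∧ x ∈ C ∧ y ∈ C
          then s.arr .L x y else 0 := by
  have hn := hs.1
  rw [processBridge, runs_block_cons, runs_store]
  simp only [Expr.eval, Expr.cost, hb1, hb2]
  set s₁ := s.setArr .adj b.1 b.2 0 with hs₁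
  have hdel : s₁.HoldsDigraph .adj (G.deleteEdge b) := hs.deleteEdge b
  rw [runs_block_cons]
  refine Runs.imp (hfc n _ h1 s₁ hdel) ?_
  rintro t₂ s₂ ⟨ht₂, hF₂, hr₂, ha₂⟩
  have hk₂ : s₂.reg .k = s.reg .k := hr₂ _ (by simp) (by simp)
  have hb₂ : s₂.arr .bridge = s.arr .bridge :=
    (ha₂ _ (by simp) (by simp)).trans (State.setArr_of_ne _ _ _ _ (by decide))
  rw [runs_block_cons, runs_store]
  simp only [Expr.eval, Expr.cost, hk₂, hb₂, hb1, hb2]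
  set s₃ := s₂.setArr .adj b.1 b.2 1 with hs₃
  have hadj₃ : s₃.arr .adj = s.arr .adj := by
    funext x y
    have h2 : s₂.arr .adj = s₁.arr .adj := ha₂ _ (by simp) (by simp)
    rw [hs₃, State.setArr_arr, h2, hs₁, State.setArr_arr]
    by_cases hxy : x = b.1 ∧ y = b.2
    · obtain ⟨rfl, rfl⟩ := hxy
      simp [(hs.edge_iff _ _).2 hb]
    · simp [hxy]
  have hreg₃ : ∀ r, r ≠ .numComps → (∀ j, r ≠ .tmp j) → s₃.reg r = s.reg r :=
    fun r h h' => hr₂ r h h'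
  have harr₃ : ∀ a, a ≠ .adj → a ≠ .compSize → a ≠ .comp → (∀ j, a ≠ .tmp j) →
      s₃.arr a = s.arr a := by
    intro a h1 h2 h3 h4
    rw [hs₃, State.setArr_of_ne _ _ _ _ h1, ha₂ a (by simp [h2, h3]) h4, hs₁,
      State.setArr_of_ne _ _ _ _ h1]
  have hF₃ : s₃.HoldsFamily .numComps .compSize .comp
      {C | (G.deleteEdge b).IsStronglyBiconnectedComponent C} := by
    unfold State.HoldsFamily State.rowSet at hF₂ ⊢
    rw [hs₃, State.setArr_of_ne _ _ _ _ (by decide), State.setArr_of_ne _ _ _ _ (by decide)]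
    exact hF₂
  rw [runs_block_cons]
  refine (Runs.fillSquare (n := n) (T := 10) (a := .same) (f := fun _ _ => 0) (rx := .x) (ry := .y)
    ((hreg₃ _ (by decide) (by simp)).trans hn) (by decide) (by decide) (by decide) ?_).imp ?_
  · intro x hx y hy s' _ _ _ hrx hry
    simp [runs_store, Expr.eval, Expr.cost, hrx, hry]
  rintro t₄ s₄ ⟨ht₄, hr₄, ha₄, hm₄⟩
  have hF₄ : s₄.HoldsFamily .numComps .compSize .comp
      {C | (G.deleteEdge b).IsStronglyBiconnectedComponent C} := by
    unfold State.HoldsFamily State.rowSet at hF₃ ⊢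
    rw [hr₄ _ (by decide) (by decide), ha₄ _ (by decide), ha₄ _ (by decide)]
    exact hF₃
  rw [runs_block_cons]
  refine (runs_markRows hF₄ ?_ ?_).imp ?_
  · intro C (hC : (G.deleteEdge b).IsStronglyBiconnectedComponent C)
    obtain ⟨x⟩ := hC.prop.1.1
    exact ⟨x, x.2⟩
  · intro C hC D hD x y hxy hxC hyC hxD hyD
    exact hC.eq_of_mem hD hxy hxC hyC hxD hyD
  rintro t₅ s₅ ⟨ht₅, hr₅, ha₅, hm₅⟩
  have hreg₅ : ∀ r, r ≠ .numComps → r ≠ .i → r ≠ .x → r ≠ .y → (∀ j, r ≠ .tmp j) →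
      s₅.reg r = s.reg r := by
    intro r h1 h2 h3 h4 h5
    rw [hr₅ r h2 h3 h4, hr₄ r h3 h4, hreg₃ r h1 h5]
  rw [runs_block_singleton]
  refine (Runs.fillSquare (n := n) (T := 20) (a := .L) (rx := .x) (ry := .y)
    (f := fun x y => if s₅.arr .same x y = 0 then 0 else s₅.arr .L x y)
    ((hreg₅ _ (by decide) (by decide) (by decide) (by decide) (by simp)).trans hn)
    (by decide) (by decide) (by decide) ?_).imp ?_
  · intro x hx y hy s' _ ha hL hrx hry
    rw [runs_ite]
    simp only [Cond.holds, Cond.cost, Expr.eval, Expr.cost, runs_store, runs_skip, hrx, hry,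
      ha .same (by decide)]
    refine ⟨fun h => ⟨by omega, by rw [if_pos h]⟩, fun h => ⟨by omega, ?_⟩⟩
    rw [if_neg h, ← hL, State.setArr_eq_self]
  rintro t₆ s₆ ⟨ht₆, hr₆, ha₆, hm₆⟩
  have hreg₆ : ∀ r, r ≠ .numComps → r ≠ .i → r ≠ .x → r ≠ .y → (∀ j, r ≠ .tmp j) →
      s₆.reg r = s.reg r := by
    intro r h1 h2 h3 h4 h5
    rw [hr₆ r h3 h4, hreg₅ r h1 h2 h3 h4 h5]
  have hadj₆ : s₆.arr .adj = s.arr .adj := by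
    rw [ha₆ _ (by decide), ha₅ _ (by decide), ha₄ _ (by decide), hadj₃]
  refine ⟨by nlinarith, ?_, ?_, ?_, ?_, fun x y => ?_⟩
  · unfold State.HoldsDigraph
    rw [hadj₆, hreg₆ _ (by decide) (by decide) (by decide) (by decide) (by simp)]
    exact hs
  · exact hreg₆ _ (by decide) (by decide) (by decide) (by decide) (by simp)
  · exact hreg₆ _ (by decide) (by decide) (by decide) (by decide) (by simp)
  · rw [ha₆ _ (by decide), ha₅ _ (by decide), ha₄ _ (by decide),
      harr₃ _ (by decide) (by decide) (by decide) (by simp)]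
  · have hL : s₅.arr .L = s.arr .L := by
      rw [ha₅ _ (by decide), ha₄ _ (by decide),
        harr₃ _ (by decide) (by decide) (by decide) (by simp)]
    rw [hm₆, hm₅, hm₄, hL]
    simp only [x.2, y.2, and_self, if_true, Set.mem_ofPred_eq]
    by_cases h : ∃ C, (G.deleteEdge b).IsStronglyBiconnectedComponent C ∧ x ∈ C ∧ y ∈ C
    · simp [h]
    · simp [h]

lemma runs_outputV (hn : s.reg .n = n) :
    Runs outputV s fun t s' => t ≤ 20 * n + 20 ∧
      s'.HoldsFamily .numOut .outSize .out {(Set.univ : Set (Fin n))} := by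
  rw [outputV]
  simp only [runs_block_cons, runs_block_singleton, runs_assign, runs_store, Expr.eval, Expr.cost]
  refine (Runs.forLt (m := n) (T := 10) (fun i s' => s'.reg .n = n ∧ s'.reg .numOut = 1 ∧
    s'.arr .outSize 0 0 = n ∧ ∀ j < i, s'.arr .out 0 j = j) ?_ ?_ ?_).imp ?_
  · simp [State.setReg_reg, hn]
  · rintro i s' ⟨h, -⟩
    exact h
  · rintro i hi s' ⟨h1, h2, h3, h4⟩ hx
    rw [runs_store]
    simp only [Expr.eval, Expr.cost, hx]
    refine ⟨by omega, hx, by simpa [State.setReg_reg] using h1,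
      by simpa [State.setReg_reg] using h2, ?_, fun j hj => ?_⟩
    · rw [State.setReg_arr, State.setArr_of_ne _ _ _ _ (by decide), h3]
    · rw [State.setReg_arr, State.setArr_arr]
      by_cases hji : j = i
      · simp [hji]
      · simp [hji, h4 j (by omega)]
  · rintro t s' ⟨ht, -, -, h2, h3, h4⟩
    refine ⟨by simp only [Expr.cost] at ht; omega, ?_, ?_, ?_⟩
    · intro i hi j hj
      obtain rfl : i = 0 := by omega
      rw [h3] at hj
      rw [h4 j hj]
      exact hj
    · intro i hi j hj j' hj' h
      obtain rfl : i = 0 := by omega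
      rw [h3, Set.mem_Iio] at hj hj'
      rwa [h4 j hj, h4 j' hj'] at h
    · have hrow : s'.rowSet n .outSize .out 0 = Set.univ := by
        ext v
        simp only [State.rowSet, Set.mem_ofPred_eq, Set.mem_univ, iff_true]
        exact ⟨v, by rw [h3]; exact v.2, h4 v v.2⟩
      have hIio : Set.Iio (s'.reg .numOut) = {0} := by
        ext i
        rw [h2]
        simp
      rw [hIio, ← hrow, Set.bijOn_singleton]

end RAM

namespace RAM

variable {s : State} {n : ℕ}

/-- Correctness and running time of the algorithm, when there are b-bridges. The entry `L[x,y]` is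
`1` as long as `x` and `y` lie in a common component of `G ∖ {b}` for all b-bridges `b` processed so
far. -/
lemma runs_blockAlgorithm_of_bridges {findComponents findBlocks : Prog} {c : ℕ}
    (hfc : ComputesComponents findComponents fun n => c * n ^ 2)
    (hfb : ComputesBlocks findBlocks fun n => c * n ^ 2) {G : Digraph (Fin n)}
    (hG : G.IsStronglyBiconnected) (h1 : 1 ≤ n) (hs : s.HoldsDigraph .adj G)
    (hB : s.HoldsBridges G) :
    Runs (block
        [ forPairs (.store .L (.reg .x) (.reg .y) (.const 1)),
          forLt .k (.reg .numBridges) (processBridge findComponents),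
          forPairs (.store .eb (.reg .x) (.reg .y) (.const 0)),
          forPairs
            (.ite (.and (.eq (.get .L (.reg .x) (.reg .y)) (.const 1))
                (.eq (.get .L (.reg .y) (.reg .x)) (.const 1)))
              (.store .eb (.reg .x) (.reg .y) (.const 1))
              .skip),
          findBlocks ]) s fun t s' => t ≤ (10 * c + 5000) * n ^ 3 ∧
      s'.HoldsFamily .numOut .outSize .out {U | G.IsTwoEdgeBiconnectedBlock U} := by
  classical
  have hn := hs.1
  set N := s.reg .numBridges with hN
  have hbridge : ∀ i < N, ∃ b : Fin n × Fin n, G.IsBBridge b ∧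
      s.arr .bridge i 0 = b.1 ∧ s.arr .bridge i 1 = b.2 := by
    intro i hi
    obtain ⟨b, hb, h⟩ := hB.mapsTo hi
    obtain ⟨e1, e2⟩ := Prod.mk.inj h
    exact ⟨b, hb, e1, e2⟩
  have : Nonempty (Fin n) := ⟨⟨0, h1⟩⟩
  choose! β hβ hβ1 hβ2 using hbridge
  have hsurj : ∀ b, G.IsBBridge b → ∃ i < N, β i = b := by
    intro b hb
    obtain ⟨i, hi, h⟩ := hB.surjOn ⟨b, hb, rfl⟩
    obtain ⟨e1, e2⟩ := Prod.mk.inj h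
    have hi' : i < N := hi
    refine ⟨i, hi', Prod.ext (Fin.ext ?_) (Fin.ext ?_)⟩
    · rw [← hβ1 i hi', e1]
    · rw [← hβ2 i hi', e2]
  rw [runs_block_cons]
  refine (Runs.fillSquare (n := n) (T := 10) (a := .L) (f := fun _ _ => 1) (rx := .x) (ry := .y)
    hn (by decide) (by decide) (by decide) ?_).imp ?_
  · intro x hx y hy s' _ _ _ hrx hry
    simp [runs_store, Expr.eval, Expr.cost, hrx, hry]
  rintro t₁ s₁ ⟨ht₁, hr₁, ha₁, hm₁⟩
  rw [runs_block_cons]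
  refine (Runs.forLt (m := N) (T := (c + 400) * n ^ 2) (fun k s' => s'.HoldsDigraph .adj G ∧
    s'.reg .numBridges = N ∧ s'.arr .bridge = s.arr .bridge ∧ ∀ x y : Fin n, s'.arr .L x y =
      if ∀ i < k, ∃ C, (G.deleteEdge (β i)).IsStronglyBiconnectedComponent C ∧ x ∈ C ∧ y ∈ C
        then 1 else 0) ?_ ?_ ?_).imp ?_
  · refine ⟨?_, ?_, ?_, fun x y => ?_⟩
    · unfold State.HoldsDigraph
      rw [State.setReg_of_ne _ _ (by decide), State.setReg_arr, hr₁ _ (by decide) (by decide),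
        ha₁ _ (by decide)]
      exact hs
    · rw [State.setReg_of_ne _ _ (by decide), hr₁ _ (by decide) (by decide)]
    · exact ha₁ _ (by decide)
    · simp [hm₁]
  · rintro k s' ⟨-, h, -⟩
    exact h
  · rintro k hk s' ⟨h1', h2', h3', h4'⟩ hrk
    refine (runs_processBridge hfc h1 (hβ k hk).1 h1' (by rw [h3', hrk, hβ1 k hk])
      (by rw [h3', hrk, hβ2 k hk])).imp ?_
    rintro t s'' ⟨ht, h1'', hk'', h2'', h3'', h4''⟩
    refine ⟨ht, hk''.trans hrk, h1'', ?_, h3''.trans h3', fun x y => ?_⟩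
    · rw [State.setReg_of_ne _ _ (by decide), h2'', h2']
    · rw [State.setReg_arr, h4'', h4']
      simp only [Nat.forall_lt_succ_right]
      by_cases ha : ∃ C, (G.deleteEdge (β k)).IsStronglyBiconnectedComponent C ∧ x ∈ C ∧ y ∈ C
      · simp only [ha, if_true, and_true]
      · simp only [ha, if_false, and_false]
  rintro t₂ s₂ ⟨ht₂, -, hs₂, -, -, hm₂⟩
  have hL : ∀ x y : Fin n, s₂.arr .L x y = 1 ↔ G.EdgeBiconnectedPair x y := by
    intro x y
    rw [hm₂, Digraph.edgeBiconnectedPair_iff]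
    split_ifs with h
    · simp only [true_iff]
      intro b hb
      obtain ⟨i, hi, rfl⟩ := hsurj b hb
      exact h i hi
    · simp only [false_iff]
      exact fun h' => h fun i hi => h' _ (hβ i hi)
  rw [runs_block_cons]
  refine (Runs.fillSquare (n := n) (T := 10) (a := .eb) (f := fun _ _ => 0) (rx := .x) (ry := .y)
    hs₂.1 (by decide) (by decide) (by decide) ?_).imp ?_
  · intro x hx y hy s' _ _ _ hrx hry
    simp [runs_store, Expr.eval, Expr.cost, hrx, hry]
  rintro t₃ s₃ ⟨ht₃, hr₃, ha₃, hm₃⟩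
  have hn₃ : s₃.reg .n = n := (hr₃ _ (by decide) (by decide)).trans hs₂.1
  rw [runs_block_cons]
  refine (Runs.fillSquare (n := n) (T := 30) (a := .eb) (rx := .x) (ry := .y)
    (f := fun x y => if s₂.arr .L x y = 1 ∧ s₂.arr .L y x = 1 then 1 else s₃.arr .eb x y)
    hn₃ (by decide) (by decide) (by decide) ?_).imp ?_
  · intro x hx y hy s' _ ha heb hrx hry
    rw [runs_ite]
    simp only [Cond.holds, Cond.cost, Expr.eval, Expr.cost, runs_store, runs_skip, hrx, hry,
      ha .L (by decide), ha₃ .L (by decide)]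
    refine ⟨fun h => ⟨by omega, by rw [if_pos h]⟩, fun h => ⟨by omega, ?_⟩⟩
    rw [if_neg h, ← heb, State.setArr_eq_self]
  rintro t₄ s₄ ⟨ht₄, hr₄, ha₄, hm₄⟩
  have hs₄ : s₄.HoldsDigraph .eb (⟨G.EdgeBiconnectedPair⟩ : Digraph (Fin n)) := by
    refine ⟨(hr₄ _ (by decide) (by decide)).trans hn₃, fun x y => ?_⟩
    have hval : s₄.arr .eb x y = if G.EdgeBiconnectedPair x y then 1 else 0 := by
      rw [hm₄, hm₃]
      simp only [x.2, y.2, and_self, if_true]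
      have : (s₂.arr .L x y = 1 ∧ s₂.arr .L y x = 1) ↔ G.EdgeBiconnectedPair x y := by
        rw [hL, hL]
        exact ⟨fun h => h.1, fun h => ⟨h, h.symm⟩⟩
      simp only [this]
    rw [hval]
    constructor <;> intro h
    · exact if_pos h
    · exact if_neg h
  rw [runs_block_singleton]
  refine Runs.imp (hfb n _ h1 s₄ hs₄) ?_
  rintro t₅ s₅ ⟨ht₅, hF₅, -⟩
  refine ⟨?_, ?_⟩
  · have hle : N ≤ 9 * n := hB.numBridges_le hG
    have hle' : N * ((c + 400) * n ^ 2 + 8) ≤ 9 * n * ((c + 400) * n ^ 2 + 8) := by gcongr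
    have e1 : n ≤ n ^ 3 := Nat.le_self_pow (by norm_num) n
    have e2 : n ^ 2 ≤ n ^ 3 := Nat.pow_le_pow_right h1 (by norm_num)
    have e3 : 1 ≤ n ^ 3 := Nat.one_le_pow _ _ h1
    have e4 : c * n ^ 2 ≤ c * n ^ 3 := by gcongr
    simp only [Expr.cost] at *
    nlinarith
  · convert hF₅ using 1
    ext U
    exact (Digraph.isBlock_nontrivial_iff (fun x y _ => Iff.rfl) U).symm

/-- The constant `11 c + 5010` leaves room for the call of `findBridges` and for the case without
b-bridges. -/
theorem computesTwoEdgeBiconnectedBlocks_blockAlgorithm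
    {findBridges findComponents findBlocks : Prog} {c : ℕ}
    (hbr : ComputesBBridges findBridges fun n => c * n ^ 3)
    (hfc : ComputesComponents findComponents fun n => c * n ^ 2)
    (hfb : ComputesBlocks findBlocks fun n => c * n ^ 2) :
    ComputesTwoEdgeBiconnectedBlocks (blockAlgorithm findBridges findComponents findBlocks)
      fun n => (11 * c + 5010) * n ^ 3 := by
  intro n G hG s hs
  have h1 : 1 ≤ n := by
    obtain ⟨x⟩ := hG.1.1
    exact Nat.one_le_of_lt x.2
  have e1 : n ≤ n ^ 3 := Nat.le_self_pow (by norm_num) n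
  have e3 : 1 ≤ n ^ 3 := Nat.one_le_pow _ _ h1
  change Runs _ s fun t s' => t ≤ (11 * c + 5010) * n ^ 3 ∧
    (2 ≤ n → s'.HoldsFamily .numOut .outSize .out {U | G.IsTwoEdgeBiconnectedBlock U})
  rw [blockAlgorithm, runs_seq]
  refine Runs.imp (hbr n G hG s hs) ?_
  rintro t₁ s₁ ⟨ht₁, hB₁, hr₁, ha₁⟩
  have hs₁ : s₁.HoldsDigraph .adj G := by
    unfold State.HoldsDigraph
    rw [hr₁ _ (by simp) (by simp), ha₁ _ (by simp) (by simp)]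
    exact hs
  rw [runs_ite]
  simp only [Cond.holds, Cond.cost, Expr.eval, Expr.cost]
  refine ⟨fun h0 => ?_, fun h0 => ?_⟩
  · refine (runs_outputV hs₁.1).imp ?_
    rintro t₂ s₂ ⟨ht₂, hF₂⟩
    refine ⟨by nlinarith, fun h2 => ?_⟩
    have hno : ∀ b, ¬ G.IsBBridge b := by
      intro b hb
      obtain ⟨i, hi, -⟩ := hB₁.surjOn ⟨b, hb, rfl⟩
      rw [h0] at hi
      exact Nat.not_lt_zero i hi
    have : Nontrivial (Fin n) := Fin.nontrivial_iff_two_le.2 h2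
    convert hF₂ using 1
    ext U
    exact Digraph.isTwoEdgeBiconnectedBlock_iff_eq_univ hno U
  · refine (runs_blockAlgorithm_of_bridges hfc hfb hG h1 hs₁ hB₁).imp ?_
    rintro t₂ s₂ ⟨ht₂, hF₂⟩
    exact ⟨by nlinarith, fun _ => hF₂⟩

end RAM

theorem mainTheorem1 :
    -- the subroutines of the algorithm exist, with the required running times
    (∃ (findBridges findComponents findBlocks : RAM.Prog) (c : ℕ),
      RAM.ComputesBBridges findBridges (fun n => c * n ^ 3) ∧
      RAM.ComputesComponents findComponents (fun n => c * n ^ 2) ∧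
      RAM.ComputesBlocks findBlocks (fun n => c * n ^ 2)) ∧
    -- with any such subroutines, the algorithm is correct and runs in cubic time
    (∀ (findBridges findComponents findBlocks : RAM.Prog) (c : ℕ),
      RAM.ComputesBBridges findBridges (fun n => c * n ^ 3) →
      RAM.ComputesComponents findComponents (fun n => c * n ^ 2) →
      RAM.ComputesBlocks findBlocks (fun n => c * n ^ 2) →
      ∃ C : ℕ, RAM.ComputesTwoEdgeBiconnectedBlocks
        (RAM.blockAlgorithm findBridges findComponents findBlocks) (fun n => C * n ^ 3)) := by
  refine ⟨⟨RAM.bridgesProg, RAM.componentsProg .adj .numComps .compSize .comp, RAM.blocksProg,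
    300000, RAM.computesBBridges_bridgesProg, ?_, ?_⟩,
    fun _ _ _ c hbr hfc hfb =>
      ⟨11 * c + 5010, RAM.computesTwoEdgeBiconnectedBlocks_blockAlgorithm hbr hfc hfb⟩⟩
  · intro n G h1 s hs
    obtain ⟨t, s', hex, ht, h⟩ := RAM.computesComponents_componentsProg n G h1 s hs
    exact ⟨t, s', hex, ht.trans (Nat.mul_le_mul_right _ (by norm_num)), h⟩
  · intro n H h1 s hs
    obtain ⟨t, s', hex, ht, h⟩ := RAM.computesBlocks_blocksProg n H h1 s hs
    exact ⟨t, s', hex, ht.trans (Nat.mul_le_mul_right _ (by norm_num)), h⟩
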